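/- Let $n\ge 1$, $\theta\in(0,\pi/2)$ and $A>0$. Let $E_{n+1}$ be the last coordinate vector of $\mathbb R^{n+1}$, $e=-E_{n+1}$, $\overline{\mathbb R^{n+1}_+}=\{x_{n+1}\ge 0\}$, and let $\sigma$ denote surface measure on unit spheres. **Capillary convex bodies and their entropy.** Let $\mathcal K_\theta$ be the set of compact convex bodies $\widehat\Sigma\subset\overline{\mathbb R^{n+1}_+}$ with non-empty interior that are enclosed by $\{x_{n+1}=0\}$ and a compact smooth embedded hypersurface $\Sigma$ with non-empty boundary $\partial\Sigma=\Sigma\cap\{x_{n+1}=0\}$, whose outward unit normal $\nu$ satisfies $\langle\nu,e\rangle=-\cos\theta$ along $\partial\Sigma$ (contact angle $\theta$). Let $\widehat{\partial\Sigma}=\partial\widehat\Sigma\cap\{x_{n+1}=0\}$ be the flat part of the boundary, with interior taken relative to $\{x_{n+1}=0\}$. Let $\mathcal C_\theta=\{\xi\in\overline{\mathbb R^{n+1}_+}:|\xi-\cos\theta\, e|=1\}$, let $\widehat{\mathcal C_\theta}$ be the body it encloses with $\{x_{n+1}=0\}$, $\ell(\xi)=\sin^2\theta+\cos\theta\langle\xi,e\rangle$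 on $\mathcal C_\theta$, and $\omega_\theta=|\mathcal C_\theta|-\cos\theta\,|\widehat{\partial\mathcal C_\theta}|$. For $z\in\widehat{\partial\Sigma}$ put $u_z(\xi)=\ell(\xi)^{-1}\max_{X\in\Sigma}\langle\xi-\cos\theta\, e,X-z\rangle$ on $\mathcal C_\theta$, and $$\mathcal E_\theta(\widehat\Sigma,z)=\frac1{\omega_\theta}\int_{\mathcal C_\theta}(\log u_z)\,\ell\,d\sigma,\qquad \mathcal E_\theta(\widehat\Sigma)=\sup_{z\in\mathrm{int}(\widehat{\partial\Sigma})}\mathcal E_\theta(\widehat\Sigma,z).$$ A capillary entropy point of $\widehat\Sigma$ is a point $z_e\in\widehat{\partial\Sigma}$ with $\mathcal E_\theta(\widehat\Sigma)=\mathcal E_\theta(\widehat\Sigma,z_e)$ (the integral being convergent). Let $\Gamma_A$ be the set of $\widehat\Sigma\in\mathcal K_\theta$ with $0\in\mathrm{int}(\widehat{\partial\Sigma})$, $\mathrm{Vol}(\widehat\Sigma)=\mathrm{Vol}(\widehat{\mathcal C_\theta})$ and $\mathcal E_\theta(\widehat\Sigma)\le A$. **$\theta$-capillary convex bodies and the generalized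 entropy.** Let $\mathcal G_\theta$ be the set of convex bodies $K\subset\overline{\mathbb R^{n+1}_+}$ (compact, convex, non-empty interior) such that $\partial K\cap\{x_{n+1}>0\}\neq\emptyset$, the flat part $K_f=\partial K\cap\{x_{n+1}=0\}$ has interior points relative to $\{x_{n+1}=0\}$, and, at every relative boundary point $x$ of $K_f$, the contact angle $\vartheta(x)$ defined by $\cos\vartheta(x)=\sup\{\langle\zeta,E_{n+1}\rangle: |\zeta|=1,\ \langle\zeta,y-x\rangle\le 0\ \forall y\in K\}$ satisfies $\vartheta(x)\le\theta$. For $K\in\mathcal G_\theta$ put $$\mathcal F_\theta(K)=\sup_{z\in\mathrm{int}(K_f)}\frac1{\omega_\theta}\int_{\mathbb S^n_\theta}\log\!\Big(\frac{h_z(\zeta)}{\ell(\zeta)}\Big)\ell(\zeta)\,d\sigma,$$ where $\mathbb S^n_\theta=\{\zeta\in\mathbb S^n:\langle\zeta,E_{n+1}\rangle\ge\cos\theta\}$, $h_z(\zeta)=\sup_{y\in K}\langle y-z,\zeta\rangle$ and $\ell(\zeta)=1-\cos\theta\langle\zeta,E_{n+1}\rangle$. **Theorem.** (1) If $\{\widehat\Sigma_k\}_{k\ge1}\subset\Gamma_A$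 converges in Hausdorff distance to a compact set $\widehat\Sigma_\star$, then $\widehat\Sigma_\star\in\mathcal G_\theta$ and $\lim_{k\to\infty}\mathcal E_\theta(\widehat\Sigma_k)=\mathcal F_\theta(\widehat\Sigma_\star)$. (2) There is a constant $\delta>0$, depending only on $n$, $\theta$ and $A$, such that every $\widehat\Sigma\in\Gamma_A$ has exactly one capillary entropy point $z_e(\widehat\Sigma)$, and $\mathrm{dist}(z_e(\widehat\Sigma),\Sigma)\ge\delta$. -/

import Mathlib

open Set Filter Topology MeasureTheory
open scoped ContDiff

noncomputable section

namespace Capillary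

/-- The ambient Euclidean space `ℝ^{n+1}`. -/
abbrev Space (n : ℕ) : Type := EuclideanSpace ℝ (Fin (n + 1))

/-- The last coordinate vector `E_{n+1}`. -/
def lastVec (n : ℕ) : Space n := EuclideanSpace.single (Fin.last n) 1

/-- The vector `e = -E_{n+1}`, the outward unit normal of the half-space. -/
def eVec (n : ℕ) : Space n := -lastVec n

/-- The last coordinate `x_{n+1}` of `x`. -/
def height {n : ℕ} (x : Space n) : ℝ := x (Fin.last n)

/-- The closed half-space `{x_{n+1} ≥ 0}`. -/
def halfSpace (n : ℕ) : Set (Space n) := {x | 0 ≤ height x}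

/-- The flat part of the boundary: the part of `∂K` lying on the hyperplane `{x_{n+1} = 0}`. -/
def flatPart {n : ℕ} (K : Set (Space n)) : Set (Space n) := frontier K ∩ {x | height x = 0}

/-- The upper part of the boundary: the part of `∂K` lying in the open half-space. -/
def upperPart {n : ℕ} (K : Set (Space n)) : Set (Space n) := frontier K ∩ {x | 0 < height x}

/-- The interior of the flat part, relative to the hyperplane `{x_{n+1} = 0}`. -/
def flatInterior {n : ℕ} (K : Set (Space n)) : Set (Space n) :=
  {z | height z = 0 ∧ ∃ ε > 0, ∀ y : Space n, height y = 0 → dist y z < ε → y ∈ flatPart K}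

/-- The boundary of the (closed) flat part, relative to the hyperplane `{x_{n+1} = 0}`. -/
def flatBoundary {n : ℕ} (K : Set (Space n)) : Set (Space n) := flatPart K \ flatInterior K

/-- The hypersurface `Σ` (including its boundary `∂Σ`) which encloses, together with the
hyperplane `{x_{n+1} = 0}`, the body `K`. -/
def surface {n : ℕ} (K : Set (Space n)) : Set (Space n) := closure (upperPart K)

/-- The `n`-dimensional area of the slice of a set by the hyperplane `{x_{n+1} = 0} = ℝⁿ`. -/
def flatArea {n : ℕ} (K : Set (Space n)) : ℝ :=
  (volume : Measure (EuclideanSpace ℝ (Fin n))).real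
    {y | (WithLp.toLp 2 (Fin.snoc (α := fun _ => ℝ) y (0 : ℝ)) : Space n) ∈ K}

/-- Convex bodies `K` (compact, convex, with interior points) in the closed half-space whose
boundary `∂K` is smooth up to the boundary in the upper half-space and meets the hyperplane
`{x_{n+1} = 0}` at the constant angle `θ`: near each point of `Σ`, the body is the part in the
closed half-space of a sublevel set `{f ≤ 0}` of a smooth function with non-vanishing gradient, so
that the outward unit normal of `Σ` is `ν = ∇f / ‖∇f‖`; and `⟨ν, e⟩ = -cos θ` along `∂Σ`. -/
structure IsCapillaryConvexBody {n : ℕ} (θ : ℝ) (K : Set (Space n)) : Prop where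
  isCompact : IsCompact K
  convex : Convex ℝ K
  interior_nonempty : (interior K).Nonempty
  subset_halfSpace : K ⊆ halfSpace n
  flatPart_nonempty : (flatPart K).Nonempty
  smooth : ∀ x ∈ surface K, ∃ (U : Set (Space n)) (f : Space n → ℝ),
    IsOpen U ∧ x ∈ U ∧ ContDiffOn ℝ ∞ f U ∧ gradient f x ≠ 0 ∧
    K ∩ U = {y | y ∈ U ∧ f y ≤ 0 ∧ 0 ≤ height y} ∧
    (height x = 0 → inner ℝ (gradient f x) (eVec n) = -Real.cos θ * ‖gradient f x‖)

/-- The unit spherical cap `C_θ`. -/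
def cap (n : ℕ) (θ : ℝ) : Set (Space n) :=
  {ξ | 0 ≤ height ξ ∧ ‖ξ - Real.cos θ • eVec n‖ = 1}

/-- The body enclosed by the spherical cap `C_θ` and the hyperplane. -/
def capBody (n : ℕ) (θ : ℝ) : Set (Space n) :=
  {ξ | 0 ≤ height ξ ∧ ‖ξ - Real.cos θ • eVec n‖ ≤ 1}

/-- The part `{⟨ζ, E_{n+1}⟩ ≥ cos θ}` of the unit sphere. -/
def sphereCap (n : ℕ) (θ : ℝ) : Set (Space n) :=
  {ζ | ‖ζ‖ = 1 ∧ Real.cos θ ≤ inner ℝ ζ (lastVec n)}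

/-- The surface measure of the unit sphere, as a measure on the ambient space. -/
def sphereMeasure (n : ℕ) : Measure (Space n) :=
  (volume : Measure (Space n)).toSphere.map Subtype.val

/-- The surface measure of the unit sphere centred at `cos θ e`, on which the cap `C_θ` lies. -/
def capMeasure (n : ℕ) (θ : ℝ) : Measure (Space n) :=
  (sphereMeasure n).map (fun ζ => ζ + Real.cos θ • eVec n)

/-- The capillary area `ω_θ = |C_θ| - cos θ |∂̂C_θ|` of the spherical cap. -/
def capillaryArea (n : ℕ) (θ : ℝ) : ℝ :=
  (capMeasure n θ).real (cap n θ) - Real.cos θ * flatArea (capBody n θ)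

/-- The function `ℓ(ξ) = sin² θ + cos θ ⟨ξ, e⟩` on `C_θ`. -/
def capEll {n : ℕ} (θ : ℝ) (ξ : Space n) : ℝ :=
  Real.sin θ ^ 2 + Real.cos θ * inner ℝ ξ (eVec n)

/-- The support function `h_z(ξ) = max_{X ∈ Σ} ⟨ξ - cos θ e, X - z⟩` on `C_θ`. -/
def capSupport {n : ℕ} (θ : ℝ) (K : Set (Space n)) (z ξ : Space n) : ℝ :=
  sSup ((fun X => inner ℝ (ξ - Real.cos θ • eVec n) (X - z)) '' surface K)

/-- The integrand `(log u_z(ξ)) ℓ(ξ)`, with the capillary support function `u_z = h_z / ℓ`. -/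
def entropyIntegrand {n : ℕ} (θ : ℝ) (K : Set (Space n)) (z ξ : Space n) : ℝ :=
  Real.log (capSupport θ K z ξ / capEll θ ξ) * capEll θ ξ

/-- The entropy `E_θ(K, z)` of a capillary convex body with respect to the point `z`. -/
def entropyAt {n : ℕ} (θ : ℝ) (K : Set (Space n)) (z : Space n) : ℝ :=
  1 / capillaryArea n θ * ∫ ξ in cap n θ, entropyIntegrand θ K z ξ ∂(capMeasure n θ)

/-- The capillary entropy `E_θ(K)`. -/
def entropy {n : ℕ} (θ : ℝ) (K : Set (Space n)) : ℝ :=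
  sSup (entropyAt θ K '' flatInterior K)

/-- The point `z` of the flat part is a capillary entropy point of `K`: the supremum `E_θ(K)` is
attained at `z`, the integral that defines `E_θ(K, z)` being convergent. -/
def IsEntropyPoint {n : ℕ} (θ : ℝ) (K : Set (Space n)) (z : Space n) : Prop :=
  z ∈ flatPart K ∧ IntegrableOn (entropyIntegrand θ K z) (cap n θ) (capMeasure n θ) ∧
    entropy θ K = entropyAt θ K z

/-- The class `Γ_A` of the capillary convex bodies which have the origin in the interior of their
flat part, the volume of the body of the unit cap, and entropy at most `A`. -/
def Gam (n : ℕ) (θ A : ℝ) : Set (Set (Space n)) :=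
  {K | IsCapillaryConvexBody θ K ∧ (0 : Space n) ∈ flatInterior K ∧
    volume K = volume (capBody n θ) ∧ entropy θ K ≤ A}

/-- The (spherical) normal cone of `K` at `x`. -/
def normalCone {n : ℕ} (K : Set (Space n)) (x : Space n) : Set (Space n) :=
  {ζ | ‖ζ‖ = 1 ∧ ∀ y ∈ K, inner ℝ ζ (y - x) ≤ 0}

/-- Convex bodies restricted to the closed half-space. -/
structure IsRestrictedConvexBody {n : ℕ} (K : Set (Space n)) : Prop where
  isCompact : IsCompact K
  convex : Convex ℝ K
  interior_nonempty : (interior K).Nonempty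
  subset_halfSpace : K ⊆ halfSpace n
  upperPart_nonempty : (upperPart K).Nonempty
  flatInterior_nonempty : (flatInterior K).Nonempty

/-- The contact angle `ϑ` of `K` at `x`, given by
`cos ϑ = sup {⟨ζ, E_{n+1}⟩ : ζ in the normal cone at x}`. -/
def contactAngle {n : ℕ} (K : Set (Space n)) (x : Space n) : ℝ :=
  Real.arccos (sSup ((fun ζ => inner ℝ ζ (lastVec n)) '' normalCone K x))

/-- `θ`-capillary convex bodies (without smoothness): the contact angle is at most `θ`. -/
structure IsThetaCapillary {n : ℕ} (θ : ℝ) (K : Set (Space n)) : Prop where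
  restricted : IsRestrictedConvexBody K
  contactAngle_le : ∀ x ∈ flatBoundary K, contactAngle K x ≤ θ

/-- The function `ℓ(ζ) = 1 - cos θ ⟨ζ, E_{n+1}⟩` on the unit sphere. -/
def sphereEll {n : ℕ} (θ : ℝ) (ζ : Space n) : ℝ :=
  1 - Real.cos θ * inner ℝ ζ (lastVec n)

/-- The classical support function `h_z(ζ) = sup_{y ∈ K} ⟨y - z, ζ⟩`. -/
def support {n : ℕ} (K : Set (Space n)) (z ζ : Space n) : ℝ :=
  sSup ((fun y => inner ℝ (y - z) ζ) '' K)

/-- The generalized entropy `F_θ(K)`. -/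
def genEntropy {n : ℕ} (θ : ℝ) (K : Set (Space n)) : ℝ :=
  sSup ((fun z => 1 / capillaryArea n θ *
    ∫ ζ in sphereCap n θ, Real.log (support K z ζ / sphereEll θ ζ) * sphereEll θ ζ
      ∂(sphereMeasure n)) '' flatInterior K)

end Capillary

end

noncomputable section

namespace Capillary

/-! ### Heights, the spherical cap and the projection to the hyperplane -/

variable {n : ℕ} {θ : ℝ}


/-! Smoothness is lost in a Hausdorff limit, so the argument replaces it by a closed condition,
`IsConeBody`: below every point `y` of the body, the horizontal ball of radius `cot θ * height y`
about the foot of `y` lies in the body. A capillary body satisfies it because, at each relative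
boundary point of the flat part, a supporting hyperplane makes the angle `θ` with the base
(`IsCapillaryConvexBody.isConeBody`). The condition survives limits whose volume is bounded from
below (`isConeBody_of_limit`). For a cone body the flat part is cut out by the normals in the cap: a
point of the hyperplane is in the relative interior exactly when its support function is positive on
`sphereCap`. This gives the contact angle bound.

Translating the cap to the unit sphere turns the capillary entropy into the generalized one. If the
support functions of two bodies, based at a common point `o` of the hyperplane, satisfy `h_K ≤ a *
h_L` on the cap, then the homothety of ratio `1 / a` about `o` sends competitors for `K` to
competitors for `L` and changes the integral by at most `log a` times the mass of the weight.
Hausdorff closeness allows `a` near 1 in both directions, so the entropy is continuous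
(`IsConeBody.genEntropy_continuous`); this is part (1).

For part (2), a relative boundary point `z` of the flat part is never nearly optimal. There is a
horizontal `v` with `⟨v, y - z⟩ ≥ 0` on the body such that `z + v` is strictly inside; reflecting
the sphere across the orthogonal complement of `v` pairs a smaller value of the support function
with a larger one. Moving `z` along `v` shifts the two values towards each other, and the concavity
of the logarithm gives a first order gain on a set of positive measure against a second order loss
(`logInt_reflect_gain`, `exists_logInt_gain`). Hence a maximum exists, in the relative interior.
Strict concavity gives uniqueness, also among relative boundary points, since smoothness allows the
support function there to vanish at no more than one normal of the cap.

The bound `A` on the entropy bounds the bodies of `Γ_A` uniformly (`exists_bound`). Compactness and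
a stability estimate near each limit body then give one lower bound for the support functions at all
maximum points. Every point of the upper boundary has an outward normal in the cap, so this is a
lower bound for the distance to `Σ`. -/

theorem inner_lastVec (x : Space n) : inner ℝ x (lastVec n) = height x := by
  simp [lastVec, height, EuclideanSpace.inner_single_right]

theorem lastVec_inner (x : Space n) : inner ℝ (lastVec n) x = height x := by
  rw [real_inner_comm, inner_lastVec]

@[simp] theorem height_add (x y : Space n) : height (x + y) = height x + height y := rfl

@[simp] theorem height_sub (x y : Space n) : height (x - y) = height x - height y := rfl

@[simp] theorem height_neg (x : Space n) : height (-x) = -height x := rfl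

@[simp] theorem height_smul (t : ℝ) (x : Space n) : height (t • x) = t * height x := rfl

@[simp] theorem height_zero : height (0 : Space n) = 0 := rfl

@[simp] theorem height_lastVec : height (lastVec n) = 1 := by
  simp [lastVec, height]

@[simp] theorem norm_lastVec : ‖lastVec n‖ = 1 := by
  simp [lastVec]

@[fun_prop] theorem continuous_height : Continuous (height : Space n → ℝ) := by
  have : (height : Space n → ℝ) = fun x => inner ℝ x (lastVec n) := by
    funext x; rw [inner_lastVec]
  rw [this]; fun_prop

theorem abs_height_le (x : Space n) : |height x| ≤ ‖x‖ := by
  have := abs_real_inner_le_norm x (lastVec n)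
  simpa [inner_lastVec] using this

theorem mem_sphereCap {ζ : Space n} :
    ζ ∈ sphereCap n θ ↔ ‖ζ‖ = 1 ∧ Real.cos θ ≤ height ζ := by
  simp [sphereCap, inner_lastVec]

theorem sphereEll_eq (ζ : Space n) : sphereEll θ ζ = 1 - Real.cos θ * height ζ := by
  simp [sphereEll, inner_lastVec]

theorem isClosed_sphereCap : IsClosed (sphereCap n θ) := by
  have : sphereCap n θ = {ζ | ‖ζ‖ = 1} ∩ {ζ | Real.cos θ ≤ height ζ} := by
    ext ζ; exact mem_sphereCap
  rw [this]
  exact (isClosed_eq continuous_norm continuous_const).inter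
    (isClosed_le continuous_const continuous_height)

theorem isCompact_sphereCap : IsCompact (sphereCap n θ) := by
  refine (isCompact_sphere (0 : Space n) 1).of_isClosed_subset isClosed_sphereCap ?_
  intro ζ hζ
  simpa using (mem_sphereCap.1 hζ).1

theorem measurableSet_sphereCap : MeasurableSet (sphereCap n θ) :=
  isClosed_sphereCap.measurableSet

theorem lastVec_mem_sphereCap : lastVec n ∈ sphereCap n θ :=
  mem_sphereCap.2 ⟨norm_lastVec, by simpa using Real.cos_le_one θ⟩

/-- The projection of a point to the hyperplane `{x_{n+1} = 0}`. -/
def foot (y : Space n) : Space n := y - height y • lastVec n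

@[simp] theorem height_foot (y : Space n) : height (foot y) = 0 := by simp [foot]

theorem foot_add (y : Space n) : foot y + height y • lastVec n = y := by simp [foot]

theorem foot_eq_self {y : Space n} (hy : height y = 0) : foot y = y := by simp [foot, hy]

theorem inner_foot_of_height_eq_zero (y : Space n) {v : Space n} (hv : height v = 0) :
    inner ℝ (foot y) v = inner ℝ y v := by
  simp [foot, inner_sub_left, inner_smul_left, lastVec_inner, hv]

theorem inner_foot_right_of_height_eq_zero (y : Space n) {v : Space n} (hv : height v = 0) :
    inner ℝ v (foot y) = inner ℝ v y := by
  rw [real_inner_comm, inner_foot_of_height_eq_zero y hv, real_inner_comm]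

theorem norm_sq_eq_foot (y : Space n) : ‖y‖ ^ 2 = ‖foot y‖ ^ 2 + height y ^ 2 := by
  have h : ‖foot y + height y • lastVec n‖ ^ 2 = ‖foot y‖ ^ 2 + height y ^ 2 := by
    rw [norm_add_sq_real]
    simp [inner_smul_right, inner_lastVec, norm_smul]
  rwa [foot_add] at h

theorem norm_foot_le (y : Space n) : ‖foot y‖ ≤ ‖y‖ := by
  have := norm_sq_eq_foot y
  nlinarith [sq_nonneg (height y), norm_nonneg y, norm_nonneg (foot y)]

/-! ### Support functions -/

section Support

variable {K L : Set (Space n)} {z w ζ : Space n}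

theorem isCompact_image_inner (hK : IsCompact K) (z ζ : Space n) :
    IsCompact ((fun y => inner ℝ (y - z) ζ) '' K) :=
  hK.image (by fun_prop)

theorem inner_le_support (hK : IsCompact K) {y : Space n} (hy : y ∈ K) (z ζ : Space n) :
    inner ℝ (y - z) ζ ≤ support K z ζ :=
  le_csSup (isCompact_image_inner hK z ζ).bddAbove (mem_image_of_mem _ hy)

theorem exists_support_eq (hK : IsCompact K) (hne : K.Nonempty) (z ζ : Space n) :
    ∃ y ∈ K, support K z ζ = inner ℝ (y - z) ζ := by
  obtain ⟨y, hy, h⟩ := (isCompact_image_inner hK z ζ).sSup_mem (hne.image _)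
  exact ⟨y, hy, h.symm⟩

theorem support_eq_sub (hK : IsCompact K) (hne : K.Nonempty) (z w ζ : Space n) :
    support K z ζ = support K w ζ - inner ℝ (z - w) ζ := by
  obtain ⟨y, hy, hyz⟩ := exists_support_eq hK hne z ζ
  obtain ⟨x, hx, hxw⟩ := exists_support_eq hK hne w ζ
  have h1 := inner_le_support hK hx z ζ
  have h2 := inner_le_support hK hy w ζ
  simp only [inner_sub_left] at *
  linarith

theorem continuous_support (hK : IsCompact K) (z : Space n) :
    Continuous (fun ζ => support K z ζ) := by
  unfold support
  exact hK.continuous_sSup (f := fun ζ y => inner ℝ (y - z) ζ) (by fun_prop)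

theorem support_nonneg (hK : IsCompact K) (hz : z ∈ K) (ζ : Space n) : 0 ≤ support K z ζ := by
  simpa using inner_le_support hK hz z ζ

theorem support_le_of_forall (hK : IsCompact K) (hne : K.Nonempty) {b : ℝ}
    (h : ∀ y ∈ K, inner ℝ (y - z) ζ ≤ b) : support K z ζ ≤ b := by
  obtain ⟨y, hy, e⟩ := exists_support_eq hK hne z ζ
  rw [e]; exact h y hy

end Support

/-! ### The flat part of a convex body -/

theorem mem_flatPart_of_mem {K : Set (Space n)} (hs : K ⊆ halfSpace n) {z : Space n} (hz : z ∈ K)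
    (h0 : height z = 0) : z ∈ flatPart K := by
  refine ⟨⟨subset_closure hz, fun hi => ?_⟩, h0⟩
  obtain ⟨ε, hε, hb⟩ := Metric.mem_nhds_iff.1 (mem_interior_iff_mem_nhds.1 hi)
  have hm : z - (ε / 2) • lastVec n ∈ K := hb (by
    simp [norm_smul, abs_of_pos hε, hε])
  have := hs hm
  simp only [halfSpace, mem_ofPred_eq, height_sub, height_smul, height_lastVec] at this
  linarith

theorem mem_of_mem_flatPart {K : Set (Space n)} (hc : IsCompact K) {z : Space n}
    (hz : z ∈ flatPart K) : z ∈ K :=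
  hc.isClosed.closure_subset hz.1.1

theorem mem_flatPart_of_mem_flatInterior {K : Set (Space n)} {z : Space n}
    (hz : z ∈ flatInterior K) : z ∈ flatPart K := by
  obtain ⟨h0, ε, hε, h⟩ := hz
  exact h z h0 (by simpa using hε)

theorem exists_height_pos {K : Set (Space n)} (hi : (interior K).Nonempty)
    (hs : K ⊆ halfSpace n) : ∃ y ∈ interior K, 0 < height y := by
  obtain ⟨y, hy⟩ := hi
  refine ⟨y, hy, lt_of_le_of_ne (hs (interior_subset hy)) fun h => ?_⟩
  exact (mem_flatPart_of_mem hs (interior_subset hy) h.symm).1.2 hy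

/-- At relative interior points of the flat part, the support function is bounded away from zero
on the spherical cap. -/
theorem exists_le_support_of_mem_flatInterior {K : Set (Space n)} (hθ : 0 < Real.cos θ)
    (hc : IsCompact K) (hi : (interior K).Nonempty) (hs : K ⊆ halfSpace n) {z : Space n}
    (hz : z ∈ flatInterior K) : ∃ δ > 0, ∀ ζ ∈ sphereCap n θ, δ ≤ support K z ζ := by
  obtain ⟨y, hy, hpos⟩ := exists_height_pos hi hs
  obtain ⟨h0, ε, hε, h⟩ := hz
  set u := z - foot y with hu
  set τ := ε / (2 * (‖u‖ + 1)) with hτ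
  have hun : 0 < ‖u‖ + 1 := by positivity
  have hτpos : 0 < τ := by positivity
  -- This point lies beyond `z` as seen from `foot y`, so the segment from it to `y` passes above
  -- `z`. Accordingly, its support inequality plus `τ` times that of `y` eliminates `inner ℝ u ζ`.
  have hq : z + τ • u ∈ K := by
    refine mem_of_mem_flatPart hc (h _ (by simp [hu, h0]) ?_)
    rw [dist_self_add_left, norm_smul, Real.norm_of_nonneg hτpos.le]
    have : τ * (‖u‖ + 1) = ε / 2 := by rw [hτ]; field_simp
    nlinarith
  refine ⟨τ * (Real.cos θ * height y) / (1 + τ), by positivity, fun ζ hζ => ?_⟩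
  rw [div_le_iff₀ (by positivity)]
  have h1 := inner_le_support hc hq z ζ
  have h2 := inner_le_support hc (interior_subset hy) z ζ
  rw [← foot_add y] at h2
  have e1 : inner ℝ (z + τ • u - z) ζ = τ * inner ℝ u ζ := by
    rw [add_sub_cancel_left, inner_smul_left]; rfl
  have e2 : inner ℝ (foot y + height y • lastVec n - z) ζ = - inner ℝ u ζ + height y * height ζ := by
    rw [hu, show foot y + height y • lastVec n - z = -(z - foot y) + height y • lastVec n by abel,
      inner_add_left, inner_neg_left, inner_smul_left, lastVec_inner]; rfl
  rw [e1] at h1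
  rw [e2] at h2
  have h3 := (mem_sphereCap.1 hζ).2
  have h4 : Real.cos θ * height y ≤ height y * height ζ := by nlinarith
  nlinarith

/-! ### Bodies with the cone property -/

/-- Convex bodies in the half-space such that the downward cone of slope `tan θ` below every
point of the body meets the hyperplane inside the body. -/
structure IsConeBody (θ : ℝ) (K : Set (Space n)) : Prop where
  isCompact : IsCompact K
  convex : Convex ℝ K
  interior_nonempty : (interior K).Nonempty
  subset_halfSpace : K ⊆ halfSpace n
  cone_mem : ∀ y ∈ K, ∀ v : Space n, height v = 0 → Real.sin θ * ‖v‖ ≤ Real.cos θ * height y →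
    foot y + v ∈ K

namespace IsConeBody

variable {K L : Set (Space n)} {z w ζ : Space n}

theorem nonempty (hK : IsConeBody θ K) : K.Nonempty := hK.interior_nonempty.mono interior_subset

theorem foot_mem (hK : IsConeBody θ K) (hθ : 0 < Real.cos θ) {y : Space n} (hy : y ∈ K) :
    foot y ∈ K := by
  have := hK.cone_mem y hy 0 (by simp) (by
    have : 0 ≤ height y := hK.subset_halfSpace hy
    simp; positivity)
  simpa using this

/-- A convex body with the cone property is cut out by the normals in the spherical cap. -/
theorem mem_of_support_nonneg (hK : IsConeBody θ K) (hc : 0 < Real.cos θ) (hs : 0 < Real.sin θ)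
    (h0 : height z = 0)
    (h : ∀ ζ ∈ sphereCap n θ, 0 ≤ support K z ζ) : z ∈ K := by
  by_contra hz
  set D := K ∩ {x | height x = 0} with hD
  have hDc : IsClosed D := hK.isCompact.isClosed.inter (isClosed_eq continuous_height continuous_const)
  have hDconv : Convex ℝ D := by
    refine hK.convex.inter fun x hx y hy a b _ _ _ => ?_
    simp only [mem_ofPred_eq] at hx hy ⊢
    simp [hx, hy]
  obtain ⟨p, hp⟩ := hK.nonempty
  have hDne : D.Nonempty := ⟨foot p, hK.foot_mem hc hp, height_foot p⟩
  obtain ⟨x, hx, hmin⟩ := exists_norm_eq_iInf_of_complete_convex hDne hDc.isComplete hDconv z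
  have hproj := (norm_eq_iInf_iff_real_inner_le_zero hDconv hx).1 hmin
  set u := z - x with hu
  have hu0 : height u = 0 := by
    have : height x = 0 := hx.2
    simp [hu, h0, this]
  have hupos : 0 < ‖u‖ := by
    rw [norm_pos_iff, hu, sub_ne_zero]
    rintro rfl
    exact hz hx.1
  set ν := ‖u‖⁻¹ • u with hν
  have hν0 : height ν = 0 := by simp [hν, hu0]
  have hνn : ‖ν‖ = 1 := by rw [hν, norm_smul, norm_inv, norm_norm]; field_simp
  -- A unit vector on the rim of the cap, over the horizontal direction from the nearest flat point
  -- `x` to `z`; its support value at `z` turns out negative.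
  set ζ := Real.sin θ • ν + Real.cos θ • lastVec n with hζ
  have hζm : height ζ = Real.cos θ := by simp [hζ, hν0]
  have hfoot : foot ζ = Real.sin θ • ν := by rw [foot, hζm, hζ]; abel
  have hζn : ‖ζ‖ = 1 := by
    have := norm_sq_eq_foot ζ
    rw [hfoot, hζm, norm_smul, hνn, mul_one, Real.norm_eq_abs, sq_abs, Real.sin_sq_add_cos_sq] at this
    nlinarith [norm_nonneg ζ]
  obtain ⟨y, hy, hye⟩ := exists_support_eq hK.isCompact hK.nonempty z ζ
  have h1 := h ζ (mem_sphereCap.2 ⟨hζn, hζm.ge⟩)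
  have hyh : 0 ≤ height y := hK.subset_halfSpace hy
  -- The extreme point, in direction `ν`, of the base of the cone below `y`. That it is not beyond
  -- `x` says exactly that `⟨ζ, y - x⟩ ≤ 0`.
  have hmem : foot y + (Real.cos θ * height y / Real.sin θ) • ν ∈ D := by
    refine ⟨hK.cone_mem y hy _ (by simp [hν0]) ?_, by simp [hν0]⟩
    rw [norm_smul, hνn, Real.norm_of_nonneg (by positivity)]
    apply le_of_eq; field_simp
  have h2 := hproj _ hmem
  have h3 : inner ℝ ν (foot y + (Real.cos θ * height y / Real.sin θ) • ν - x) ≤ 0 := by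
    rw [hν, inner_smul_left]
    exact mul_nonpos_of_nonneg_of_nonpos (by simp) h2
  have h4 : inner ℝ ν (z - x) = ‖u‖ := by
    rw [← hu, hν, inner_smul_left, real_inner_self_eq_norm_sq]
    simp; field_simp
  rw [inner_sub_right, inner_add_right, inner_smul_right, real_inner_self_eq_norm_sq, hνn,
    inner_foot_right_of_height_eq_zero y hν0] at h3
  rw [inner_sub_right] at h4
  rw [hye, hζ, inner_add_right, inner_smul_right _ ν, inner_smul_right _ (lastVec n), inner_lastVec,
    height_sub, h0,
    real_inner_comm, inner_sub_right] at h1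
  have h5 : Real.sin θ * (Real.cos θ * height y / Real.sin θ) = Real.cos θ * height y := by field_simp
  nlinarith

/-- The support function is 1-Lipschitz in the base point, so it stays non-negative on the cap
throughout the disc of radius `δ`. -/
theorem mem_flatInterior (hK : IsConeBody θ K) (hc : 0 < Real.cos θ) (hs : 0 < Real.sin θ)
    (h0 : height z = 0) {δ : ℝ} (hδ : 0 < δ)
    (h : ∀ ζ ∈ sphereCap n θ, δ ≤ support K z ζ) : z ∈ flatInterior K := by
  refine ⟨h0, δ, hδ, fun y hy hyz => mem_flatPart_of_mem hK.subset_halfSpace ?_ hy⟩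
  refine hK.mem_of_support_nonneg hc hs hy fun ζ hζ => ?_
  rw [support_eq_sub hK.isCompact hK.nonempty y z ζ]
  have h1 := h ζ hζ
  have h2 := real_inner_le_norm (y - z) ζ
  rw [(mem_sphereCap.1 hζ).1, mul_one, ← dist_eq_norm] at h2
  linarith

theorem mem_flatInterior_of_pos (hK : IsConeBody θ K) (hc : 0 < Real.cos θ) (hs : 0 < Real.sin θ)
    (h0 : height z = 0)
    (h : ∀ ζ ∈ sphereCap n θ, 0 < support K z ζ) : z ∈ flatInterior K := by
  obtain ⟨ζ, hζ, hmin⟩ := isCompact_sphereCap.exists_isMinOn ⟨_, lastVec_mem_sphereCap⟩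
    (continuous_support hK.isCompact z).continuousOn
  exact hK.mem_flatInterior hc hs h0 (h ζ hζ) fun ξ hξ => hmin hξ

theorem exists_le_support (hK : IsConeBody θ K) (hc : 0 < Real.cos θ) (hz : z ∈ flatInterior K) :
    ∃ δ > 0, ∀ ζ ∈ sphereCap n θ, δ ≤ support K z ζ :=
  exists_le_support_of_mem_flatInterior hc hK.isCompact hK.interior_nonempty hK.subset_halfSpace hz

/-- The point `y` is straight above its foot and the normals in the cap have height at least `cos
θ`. Feet of high points are thus quantitatively interior, which later bounds the height by the
entropy. -/
theorem le_support_foot (hK : IsConeBody θ K) {y : Space n} (hy : y ∈ K) (hζ : ζ ∈ sphereCap n θ) :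
    Real.cos θ * height y ≤ support K (foot y) ζ := by
  have h1 := inner_le_support hK.isCompact hy (foot y) ζ
  rw [show y - foot y = height y • lastVec n by simp [foot], inner_smul_left, lastVec_inner] at h1
  have h2 : 0 ≤ height y := hK.subset_halfSpace hy
  have h3 := (mem_sphereCap.1 hζ).2
  simp only [conj_trivial] at h1
  nlinarith

theorem foot_mem_flatInterior (hK : IsConeBody θ K) (hc : 0 < Real.cos θ) (hs : 0 < Real.sin θ)
    {y : Space n} (hy : y ∈ K) (hpos : 0 < height y) : foot y ∈ flatInterior K :=
  hK.mem_flatInterior hc hs (height_foot y) (mul_pos hc hpos) fun _ hζ => hK.le_support_foot hy hζ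

theorem flatInterior_nonempty (hK : IsConeBody θ K) (hc : 0 < Real.cos θ) (hs : 0 < Real.sin θ) :
    (flatInterior K).Nonempty := by
  obtain ⟨y, hy, hpos⟩ := exists_height_pos hK.interior_nonempty hK.subset_halfSpace
  exact ⟨_, hK.foot_mem_flatInterior hc hs (interior_subset hy) hpos⟩

/-- The contact angle of a convex body with the cone property is at most `θ`. -/
theorem isThetaCapillary (hK : IsConeBody θ K) (hθ : θ ∈ Ioo 0 (Real.pi / 2)) :
    IsThetaCapillary θ K := by
  have hc : 0 < Real.cos θ := Real.cos_pos_of_mem_Ioo ⟨by linarith [hθ.1, Real.pi_pos], hθ.2⟩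
  have hs : 0 < Real.sin θ := Real.sin_pos_of_pos_of_lt_pi hθ.1 (by linarith [hθ.2, Real.pi_pos])
  refine ⟨⟨hK.isCompact, hK.convex, hK.interior_nonempty, hK.subset_halfSpace, ?_,
    hK.flatInterior_nonempty hc hs⟩, fun x hx => ?_⟩
  · obtain ⟨p, hp, hpos⟩ := exists_height_pos hK.interior_nonempty hK.subset_halfSpace
    obtain ⟨y, hy, hmax⟩ := hK.isCompact.exists_isMaxOn hK.nonempty continuous_height.continuousOn
    refine ⟨y, ⟨subset_closure hy, fun hi => ?_⟩,
      lt_of_lt_of_le hpos (hmax (interior_subset hp))⟩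
    obtain ⟨ε, hε, hb⟩ := Metric.mem_nhds_iff.1 (mem_interior_iff_mem_nhds.1 hi)
    have hm : y + (ε / 2) • lastVec n ∈ K := hb (by
      simp [norm_smul, abs_of_pos hε, hε])
    have : height (y + (ε / 2) • lastVec n) ≤ height y := hmax hm
    simp only [height_add, height_smul, height_lastVec] at this
    linarith
  · have hxK := mem_of_mem_flatPart hK.isCompact hx.1
    -- A relative boundary point violates the positivity criterion, and the offending `ζ` is an
    -- outward normal of height at least `cos θ`.
    have : ∃ ζ ∈ sphereCap n θ, support K x ζ ≤ 0 := by
      by_contra! hcon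
      exact hx.2 (hK.mem_flatInterior_of_pos hc hs hx.1.2 hcon)
    obtain ⟨ζ, hζ, hle⟩ := this
    rw [contactAngle, ← Real.arccos_cos hθ.1.le (by linarith [hθ.2, Real.pi_pos])]
    refine Real.arccos_le_arccos ((mem_sphereCap.1 hζ).2.trans ?_)
    refine le_csSup ⟨1, ?_⟩ ⟨ζ, ⟨(mem_sphereCap.1 hζ).1, fun y hy => ?_⟩, inner_lastVec ζ⟩
    · rintro _ ⟨ξ, hξ, rfl⟩
      have := real_inner_le_norm ξ (lastVec n)
      simpa [hξ.1] using this
    · rw [real_inner_comm]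
      exact (inner_le_support hK.isCompact hy x ζ).trans hle

end IsConeBody


/-! ### From the upper surface and the cap to classical support functions -/

/-- A point of a convex body on the hyperplane is either a relative interior point of the flat
part or a limit of boundary points in the open half-space. -/
theorem mem_surface_of_notMem_flatInterior {K : Set (Space n)} (hc : IsCompact K)
    (hconv : Convex ℝ K) (hi : (interior K).Nonempty) (hs : K ⊆ halfSpace n) {x : Space n}
    (hx : x ∈ K) (h0 : height x = 0) (hflat : x ∉ flatInterior K) : x ∈ surface K := by
  by_contra hsurf
  obtain ⟨ε, hε, hb⟩ := Metric.isOpen_iff.1 (isClosed_closure (s := upperPart K)).isOpen_compl x hsurf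
  obtain ⟨p, hp, hpos⟩ := exists_height_pos hi hs
  -- The half ball `H` is convex, contains no boundary point of `K` and meets the interior, so
  -- connectedness puts it inside `K`. Letting the height tend to zero then yields a flat disc about
  -- `x`.
  set H := Metric.ball x ε ∩ {y : Space n | 0 < height y} with hH
  have hHconv : Convex ℝ H := by
    refine (convex_ball x ε).inter fun y hy z hz a b ha hb hab => ?_
    simp only [mem_ofPred_eq, height_add, height_smul] at *
    rcases ha.eq_or_lt with rfl | ha
    · have : b = 1 := by linarith
      subst this; linarith
    · have := mul_pos ha hy
      have := mul_nonneg hb hz.le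
      linarith
  have hHsub : H ⊆ interior K ∪ Kᶜ := by
    intro y hy
    by_cases hyK : y ∈ K
    · left
      by_contra hyi
      exact hb hy.1 (subset_closure ⟨⟨subset_closure hyK, hyi⟩, hy.2⟩)
    · exact Or.inr hyK
  have hHne : (H ∩ interior K).Nonempty := by
    set t := min 1 (ε / (2 * (‖p - x‖ + 1))) with ht
    have hpx : 0 < ‖p - x‖ + 1 := by positivity
    have ht0 : 0 < t := lt_min one_pos (by positivity)
    refine ⟨x + t • (p - x), ⟨?_, ?_⟩,
      hconv.add_smul_sub_mem_interior hx hp ⟨ht0, min_le_left _ _⟩⟩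
    · rw [Metric.mem_ball, dist_self_add_left, norm_smul, Real.norm_of_nonneg ht0.le]
      have h1 : t * (‖p - x‖ + 1) ≤ ε / (2 * (‖p - x‖ + 1)) * (‖p - x‖ + 1) :=
        mul_le_mul_of_nonneg_right (min_le_right _ _) hpx.le
      have h2 : ε / (2 * (‖p - x‖ + 1)) * (‖p - x‖ + 1) = ε / 2 := by field_simp
      nlinarith
    · simpa [h0] using mul_pos ht0 hpos
  have hHK : H ⊆ K := (hHconv.isPreconnected.subset_left_of_subset_union isOpen_interior
    hc.isClosed.isOpen_compl (disjoint_compl_right.mono_left interior_subset) hHsub hHne).trans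
    interior_subset
  refine hflat ⟨h0, ε, hε, fun w hw hwx => mem_flatPart_of_mem hs ?_ hw⟩
  have hlim : Tendsto (fun τ : ℝ => w + τ • lastVec n) (𝓝[>] 0) (𝓝 w) := by
    have : Continuous (fun τ : ℝ => w + τ • lastVec n) := by fun_prop
    simpa using (this.tendsto 0).mono_left nhdsWithin_le_nhds
  refine hc.isClosed.mem_of_tendsto hlim ?_
  filter_upwards [hlim.eventually (Metric.isOpen_ball.mem_nhds hwx), self_mem_nhdsWithin] with τ h1 h2
  exact hHK ⟨h1, by simpa [hw] using h2⟩

theorem surface_subset {K : Set (Space n)} (hc : IsCompact K) : surface K ⊆ K :=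
  closure_minimal (fun _ hx => hc.isClosed.closure_subset hx.1.1) hc.isClosed

/-- On the spherical cap, the maximum over the body is attained on the upper surface. -/
theorem capSupport_eq_support {K : Set (Space n)} (hθ : 0 < Real.cos θ) (hc : IsCompact K)
    (hconv : Convex ℝ K) (hi : (interior K).Nonempty) (hs : K ⊆ halfSpace n)
    {ζ : Space n} (hζ : ζ ∈ sphereCap n θ) (z : Space n) :
    capSupport θ K z (ζ + Real.cos θ • eVec n) = support K z ζ := by
  have hne : K.Nonempty := hi.mono interior_subset
  obtain ⟨y, hy, hye⟩ := exists_support_eq hc hne z ζ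
  have hys : y ∈ surface K := by
    have hy0 : 0 ≤ height y := hs hy
    rcases hy0.eq_or_lt with h0 | hpos
    -- At a maximizer `y` the support function based at `y` vanishes for `ζ`, whereas at relative
    -- interior points of the flat part it is positive on the whole cap.
    · refine mem_surface_of_notMem_flatInterior hc hconv hi hs hy h0.symm fun hflat => ?_
      obtain ⟨δ, hδ, h⟩ := exists_le_support_of_mem_flatInterior hθ hc hi hs hflat
      have h1 := h ζ hζ
      rw [support_eq_sub hc hne y z, hye] at h1
      linarith
    · refine subset_closure ⟨⟨subset_closure hy, fun hyi => ?_⟩, hpos⟩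
      obtain ⟨ε, hε, hb⟩ := Metric.mem_nhds_iff.1 (mem_interior_iff_mem_nhds.1 hyi)
      have hn := (mem_sphereCap.1 hζ).1
      have hm : y + (ε / 2) • ζ ∈ K := hb (by simp [norm_smul, abs_of_pos hε, hε, hn])
      have h1 := inner_le_support hc hm z ζ
      rw [hye, add_sub_right_comm, inner_add_left, inner_smul_left,
        real_inner_self_eq_norm_sq, hn] at h1
      simp at h1
      linarith
  have hf : (fun X => inner ℝ (ζ + Real.cos θ • eVec n - Real.cos θ • eVec n) (X - z))
      = fun X => inner ℝ (X - z) ζ := by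
    funext X; rw [add_sub_cancel_right, real_inner_comm]
  rw [capSupport, hf]
  apply le_antisymm
  · exact csSup_le_csSup (isCompact_image_inner hc z ζ).bddAbove ⟨_, y, hys, rfl⟩
      (image_mono (surface_subset hc))
  · rw [hye]
    exact le_csSup ((isCompact_image_inner hc z ζ).bddAbove.mono
      (image_mono (surface_subset hc))) ⟨y, hys, rfl⟩

theorem capEll_eq (ζ : Space n) : capEll θ (ζ + Real.cos θ • eVec n) = sphereEll θ ζ := by
  simp only [capEll, sphereEll_eq, eVec, inner_neg_right, inner_lastVec, height_add, height_smul,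
    height_neg, height_lastVec]
  have := Real.sin_sq_add_cos_sq θ
  linear_combination this

/-- The integrand of the generalized entropy. -/
def genIntegrand (θ : ℝ) (K : Set (Space n)) (z ζ : Space n) : ℝ :=
  Real.log (support K z ζ / sphereEll θ ζ) * sphereEll θ ζ

/-- The generalized entropy with respect to a point. -/
def genEntropyAt (θ : ℝ) (K : Set (Space n)) (z : Space n) : ℝ :=
  1 / capillaryArea n θ * ∫ ζ in sphereCap n θ, genIntegrand θ K z ζ ∂(sphereMeasure n)

theorem genEntropy_eq (θ : ℝ) (K : Set (Space n)) :
    genEntropy θ K = sSup (genEntropyAt θ K '' flatInterior K) := rfl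

theorem measurableEmbedding_shift :
    MeasurableEmbedding (fun ζ : Space n => ζ + Real.cos θ • eVec n) :=
  (Homeomorph.addRight (Real.cos θ • eVec n)).measurableEmbedding

theorem preimage_cap :
    (fun ζ : Space n => ζ + Real.cos θ • eVec n) ⁻¹' cap n θ = sphereCap n θ := by
  ext ζ
  simp only [cap, mem_preimage, mem_ofPred_eq, add_sub_cancel_right, mem_sphereCap, eVec,
    height_add, height_smul, height_neg, height_lastVec]
  constructor
  · rintro ⟨h1, h2⟩; exact ⟨h2, by linarith⟩
  · rintro ⟨h1, h2⟩; exact ⟨by linarith, h1⟩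

theorem capMeasure_cap : capMeasure n θ (cap n θ) = sphereMeasure n (sphereCap n θ) := by
  rw [capMeasure, measurableEmbedding_shift.map_apply, preimage_cap]

theorem entropyIntegrand_eq {K : Set (Space n)} (hθ : 0 < Real.cos θ) (hc : IsCompact K)
    (hconv : Convex ℝ K) (hi : (interior K).Nonempty) (hs : K ⊆ halfSpace n)
    {ζ : Space n} (hζ : ζ ∈ sphereCap n θ) (z : Space n) :
    entropyIntegrand θ K z (ζ + Real.cos θ • eVec n) = genIntegrand θ K z ζ := by
  rw [entropyIntegrand, capEll_eq, capSupport_eq_support hθ hc hconv hi hs hζ, genIntegrand]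

theorem entropyAt_eq {K : Set (Space n)} (hθ : 0 < Real.cos θ) (hc : IsCompact K)
    (hconv : Convex ℝ K) (hi : (interior K).Nonempty) (hs : K ⊆ halfSpace n) (z : Space n) :
    entropyAt θ K z = genEntropyAt θ K z := by
  rw [entropyAt, genEntropyAt, capMeasure, measurableEmbedding_shift.setIntegral_map, preimage_cap]
  congr 1
  exact setIntegral_congr_fun measurableSet_sphereCap
    fun ζ hζ => entropyIntegrand_eq hθ hc hconv hi hs hζ z

theorem entropy_eq_genEntropy {K : Set (Space n)} (hθ : 0 < Real.cos θ) (hc : IsCompact K)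
    (hconv : Convex ℝ K) (hi : (interior K).Nonempty) (hs : K ⊆ halfSpace n) :
    entropy θ K = genEntropy θ K := by
  rw [entropy, genEntropy_eq]
  congr 1
  exact image_congr fun z _ => entropyAt_eq hθ hc hconv hi hs z

theorem integrableOn_entropyIntegrand_iff {K : Set (Space n)} (hθ : 0 < Real.cos θ)
    (hc : IsCompact K) (hconv : Convex ℝ K) (hi : (interior K).Nonempty) (hs : K ⊆ halfSpace n)
    (z : Space n) : IntegrableOn (entropyIntegrand θ K z) (cap n θ) (capMeasure n θ) ↔
      IntegrableOn (genIntegrand θ K z) (sphereCap n θ) (sphereMeasure n) := by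
  rw [capMeasure, measurableEmbedding_shift.integrableOn_map_iff, preimage_cap]
  exact integrableOn_congr_fun (fun ζ hζ => entropyIntegrand_eq hθ hc hconv hi hs hζ z)
    measurableSet_sphereCap

/-! ### Capillary bodies have the cone property -/

theorem eventually_lt_of_inner_gradient_neg {f : Space n → ℝ} {x v : Space n}
    (hf : DifferentiableAt ℝ f x) (h : inner ℝ (gradient f x) v < 0) :
    ∀ᶠ t : ℝ in 𝓝[>] 0, f (x + t • v) < f x := by
  have h1 : HasLineDerivAt ℝ f (inner ℝ (gradient f x) v) x v := by
    simpa using hf.hasGradientAt.hasFDerivAt.hasLineDerivAt v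
  filter_upwards [h1.tendsto_slope_zero_right.eventually (gt_mem_nhds h), self_mem_nhdsWithin]
    with t ht hpos
  have hpos' : (0 : ℝ) < t := hpos
  have h2 : f (x + t • v) - f x < 0 := by
    by_contra! hcon
    have : 0 ≤ t⁻¹ • (f (x + t • v) - f x) := by
      rw [smul_eq_mul]; positivity
    linarith
  linarith

namespace IsCapillaryConvexBody

variable {K : Set (Space n)}

/-- At a relative boundary point of the flat part there is a unit normal `γ` of a capillary
convex body with vertical component `cos θ`, and the body contains initial segments in all
directions which are not vertically downward and make an obtuse angle with `γ`. -/
theorem exists_normal (hK : IsCapillaryConvexBody θ K) {x : Space n} (hx : x ∈ K)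
    (h0 : height x = 0) (hflat : x ∉ flatInterior K) :
    ∃ γ : Space n, ‖γ‖ = 1 ∧ height γ = Real.cos θ ∧ (∀ y ∈ K, inner ℝ γ (y - x) ≤ 0) ∧
      ∀ v : Space n, 0 ≤ height v → inner ℝ γ v < 0 → ∃ t : ℝ, 0 < t ∧ x + t • v ∈ K := by
  have hsurf := mem_surface_of_notMem_flatInterior hK.isCompact hK.convex hK.interior_nonempty
    hK.subset_halfSpace hx h0 hflat
  obtain ⟨U, f, hU, hxU, hf, hg, hKU, hang⟩ := hK.smooth x hsurf
  have hdiff : DifferentiableAt ℝ f x :=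
    (hf.contDiffAt (hU.mem_nhds hxU)).differentiableAt (by simp)
  have hmem : ∀ y, y ∈ U → f y ≤ 0 → 0 ≤ height y → y ∈ K := fun y h1 h2 h3 =>
    (hKU.symm.subset ⟨h1, h2, h3⟩ : y ∈ K ∩ U).1
  have hfx : f x = 0 := by
    -- If `f x < 0`, the body would fill a half ball about `x`, making `x` a relative interior point
    -- of the flat part.
    refine le_antisymm (hKU.subset ⟨hx, hxU⟩).2.1 ?_
    by_contra! hneg
    have hev : ∀ᶠ y in 𝓝 x, f y < 0 ∧ y ∈ U :=
      (hdiff.continuousAt.eventually (gt_mem_nhds hneg)).and (hU.mem_nhds hxU)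
    obtain ⟨ε, hε, hb⟩ := Metric.eventually_nhds_iff.1 hev
    exact hflat ⟨h0, ε, hε, fun y hy hyx => mem_flatPart_of_mem hK.subset_halfSpace
      (hmem y (hb hyx).2 (hb hyx).1.le hy.ge) hy⟩
  set g := gradient f x with hgdef
  have hgn : 0 < ‖g‖ := norm_pos_iff.2 hg
  have hline : ∀ v : Space n, Tendsto (fun t : ℝ => x + t • v) (𝓝[>] 0) (𝓝 x) := fun v => by
    have : Continuous (fun t : ℝ => x + t • v) := by fun_prop
    simpa using (this.tendsto 0).mono_left nhdsWithin_le_nhds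
  have hinner : ∀ v, inner ℝ (‖g‖⁻¹ • g) v = ‖g‖⁻¹ * inner ℝ g v := fun v => by
    rw [inner_smul_left]; rfl
  refine ⟨‖g‖⁻¹ • g, ?_, ?_, fun y hy => ?_, fun v hv hneg => ?_⟩
  · rw [norm_smul, norm_inv, norm_norm]; field_simp
  · have := hang h0
    rw [eVec, inner_neg_right, inner_lastVec] at this
    rw [height_smul, show height g = Real.cos θ * ‖g‖ by linarith]
    field_simp
  · rw [hinner]
    refine mul_nonpos_of_nonneg_of_nonpos (by positivity) ?_
    by_contra! hpos
    -- Otherwise `f` would become positive along the segment from `x` to `y`, which lies in `K`.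
    have hdiff' : DifferentiableAt ℝ (-f) x := hdiff.neg
    have hgrad : gradient (-f) x = -g := by
      have := hdiff.hasGradientAt.hasFDerivAt.neg
      refine HasGradientAt.gradient (hasGradientAt_iff_hasFDerivAt.2 ?_)
      rwa [map_neg]
    have hev := eventually_lt_of_inner_gradient_neg (v := y - x) hdiff'
      (by rw [hgrad, inner_neg_left]; linarith)
    have hlt : ∀ᶠ t : ℝ in 𝓝[>] 0, t < 1 := nhdsWithin_le_nhds (gt_mem_nhds one_pos)
    obtain ⟨t, h1, h2, h3, h4⟩ := (hev.and (((hline (y - x)).eventually (hU.mem_nhds hxU)).and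
      (hlt.and self_mem_nhdsWithin))).exists
    have hK' : x + t • (y - x) ∈ K := hK.convex.add_smul_sub_mem hx hy ⟨(le_of_lt h4), h3.le⟩
    have := (hKU.subset ⟨hK', h2⟩).2.1
    simp only [Pi.neg_apply, hfx] at h1
    linarith
  · rw [hinner] at hneg
    have hneg' : inner ℝ g v < 0 := by
      by_contra! hcon
      have : 0 ≤ ‖g‖⁻¹ * inner ℝ g v := by positivity
      linarith
    obtain ⟨t, h1, h2, h3⟩ := ((eventually_lt_of_inner_gradient_neg hdiff hneg').and
      (((hline v).eventually (hU.mem_nhds hxU)).and self_mem_nhdsWithin)).exists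
    have h3' : (0 : ℝ) < t := h3
    refine ⟨t, h3', hmem _ h2 (by linarith) ?_⟩
    rw [height_add, h0, height_smul]
    positivity

/-- Outward normals at the relative boundary of the flat part that lie in the spherical cap are
unique. -/
theorem subsingleton_support_nonpos (hK : IsCapillaryConvexBody θ K) {x : Space n} (hx : x ∈ K)
    (h0 : height x = 0) (hflat : x ∉ flatInterior K) :
    ∃ γ : Space n, ∀ ζ ∈ sphereCap n θ, support K x ζ ≤ 0 → ζ = γ := by
  obtain ⟨γ, hγ, hγh, -, hdir⟩ := hK.exists_normal hx h0 hflat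
  refine ⟨γ, fun ζ hζ hle => ?_⟩
  by_contra hne
  have hn := (mem_sphereCap.1 hζ).1
  have hlt := (inner_lt_one_iff_real_of_norm_eq_one hn hγ).2 hne
  -- The direction `ζ - γ` does not point downwards, since `γ` has the least height in the cap, and
  -- it is strictly inward for `γ`. The body therefore contains a point in this direction, where the
  -- functional `ζ` is positive.
  obtain ⟨t, ht, hmem⟩ := hdir (ζ - γ) (by simpa [hγh] using (mem_sphereCap.1 hζ).2) (by
    rw [inner_sub_right, real_inner_self_eq_norm_sq, hγ, real_inner_comm]; linarith)
  have h1 := (inner_le_support hK.isCompact hmem x ζ).trans hle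
  rw [add_sub_cancel_left, inner_smul_left, inner_sub_left, real_inner_self_eq_norm_sq, hn,
    real_inner_comm] at h1
  simp only [conj_trivial] at h1
  nlinarith

/-- Capillary convex bodies with contact angle `θ < π / 2` have the cone property. -/
theorem isConeBody (hK : IsCapillaryConvexBody θ K) (hs : 0 < Real.sin θ) :
    IsConeBody θ K := by
  refine ⟨hK.isCompact, hK.convex, hK.interior_nonempty, hK.subset_halfSpace,
    fun y hy v hv hvn => ?_⟩
  by_contra hw
  set w := foot y + v with hwdef
  have hw0 : height w = 0 := by simp [hwdef, hv]
  set D := K ∩ {x | height x = 0} with hD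
  have hDc : IsClosed D :=
    hK.isCompact.isClosed.inter (isClosed_eq continuous_height continuous_const)
  have hDconv : Convex ℝ D := by
    refine hK.convex.inter fun x hx y hy a b _ _ _ => ?_
    simp only [mem_ofPred_eq] at hx hy ⊢
    simp [hx, hy]
  obtain ⟨p, hp⟩ := hK.flatPart_nonempty
  have hDne : D.Nonempty := ⟨p, mem_of_mem_flatPart hK.isCompact hp, hp.2⟩
  obtain ⟨x, hx, hmin⟩ := exists_norm_eq_iInf_of_complete_convex hDne hDc.isComplete hDconv w
  have hproj := (norm_eq_iInf_iff_real_inner_le_zero hDconv hx).1 hmin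
  set u := w - x with hu
  have hx0 : height x = 0 := hx.2
  have hu0 : height u = 0 := by simp [hu, hw0, hx0]
  have hupos : 0 < ‖u‖ := by
    rw [norm_pos_iff, hu, sub_ne_zero]
    rintro h
    exact hw (h ▸ hx.1)
  have hflat : x ∉ flatInterior K := by
    rintro ⟨-, ε, hε, h⟩
    have hmem : x + (ε / (2 * ‖u‖)) • u ∈ D := by
      have h1 : height (x + (ε / (2 * ‖u‖)) • u) = 0 := by simp [hx0, hu0]
      refine ⟨mem_of_mem_flatPart hK.isCompact (h _ h1 ?_), h1⟩
      rw [dist_self_add_left, norm_smul, Real.norm_of_nonneg (by positivity)]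
      field_simp; linarith
    have h2 := hproj _ hmem
    rw [add_sub_cancel_left, inner_smul_right, real_inner_self_eq_norm_sq] at h2
    have : 0 < ε / (2 * ‖u‖) * ‖u‖ ^ 2 := by positivity
    linarith
  obtain ⟨γ, hγ, hγh, hγK, hdir⟩ := hK.exists_normal hx.1 hx0 hflat
  obtain ⟨ν, hν⟩ : ∃ ν, ν = ‖u‖⁻¹ • u := ⟨_, rfl⟩
  have hν0 : height ν = 0 := by simp [hν, hu0]
  have hνn : ‖ν‖ = 1 := by rw [hν, norm_smul, norm_inv, norm_norm]; field_simp
  have hνu : ∀ y, inner ℝ ν y = ‖u‖⁻¹ * inner ℝ u y := fun y => by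
    rw [hν, inner_smul_left]; rfl
  obtain ⟨ζ, hζ⟩ : ∃ ζ, ζ = Real.sin θ • ν + Real.cos θ • lastVec n := ⟨_, rfl⟩
  have hζm : height ζ = Real.cos θ := by simp [hζ, hν0]
  have hfoot : foot ζ = Real.sin θ • ν := by rw [foot, hζm, hζ]; abel
  have hζn : ‖ζ‖ = 1 := by
    have := norm_sq_eq_foot ζ
    rw [hfoot, hζm, norm_smul, hνn, mul_one, Real.norm_eq_abs, sq_abs,
      Real.sin_sq_add_cos_sq] at this
    nlinarith [norm_nonneg ζ]
  have hζi : ∀ y : Space n, inner ℝ ζ y = Real.sin θ * inner ℝ ν y + Real.cos θ * height y := by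
    intro y
    rw [hζ, inner_add_left, inner_smul_left, inner_smul_left, lastVec_inner]; rfl
  -- If they differ, `ζ - γ` is horizontal and inward for `γ`, so it leads to another flat point of
  -- `K`. The nearest point property gives `⟨ν, ζ - γ⟩ ≤ 0`, contradicting `0 < 1 - ⟨ζ, γ⟩ = sin θ *
  -- ⟨ν, ζ - γ⟩`.
  have hγζ : ζ = γ := by
    by_contra hne
    have hlt := (inner_lt_one_iff_real_of_norm_eq_one hζn hγ).2 hne
    obtain ⟨t, ht, hmem⟩ := hdir (ζ - γ) (by simp [hγh, hζm]) (by
      rw [inner_sub_right, real_inner_self_eq_norm_sq, hγ, real_inner_comm]; linarith)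
    have h1 := hproj _ ⟨hmem, by simp [hx0, hζm, hγh]⟩
    have h2 : inner ℝ ν (ζ - γ) ≤ 0 := by
      rw [add_sub_cancel_left, inner_smul_right] at h1
      rw [hνu]
      exact mul_nonpos_of_nonneg_of_nonpos (by positivity) (by nlinarith)
    have h3 := hζi (ζ - γ)
    rw [height_sub, hζm, hγh, sub_self, mul_zero, add_zero, inner_sub_right,
      real_inner_self_eq_norm_sq, hζn] at h3
    nlinarith
  -- Since `y` lies below the hyperplane with normal `ζ` through `x`, its foot is at least `cot θ *
  -- height y` behind `x` in direction `ν`. The vector `v` is too short to make up for this, so `w`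
  -- cannot be beyond `x`.
  have h1 := hγK y hy
  rw [← hγζ, hζi, height_sub, hx0, sub_zero] at h1
  have h2 : inner ℝ ν (w - x) = ‖u‖ := by
    rw [← hu, hνu, real_inner_self_eq_norm_sq]; field_simp
  have h3 : inner ℝ ν w = inner ℝ ν y + inner ℝ ν v := by
    rw [hwdef, inner_add_right, inner_foot_right_of_height_eq_zero y hν0]
  have h4 := real_inner_le_norm ν v
  rw [hνn, one_mul] at h4
  rw [inner_sub_right] at h1 h2
  nlinarith

end IsCapillaryConvexBody


/-! ### The surface measure of the unit sphere -/

instance : IsFiniteMeasure (sphereMeasure n) := by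
  unfold sphereMeasure; infer_instance

/-- The part in the punctured unit ball of the cone over a set. -/
def unitCone (s : Set (Space n)) : Set (Space n) := {x | x ≠ 0 ∧ ‖x‖ < 1 ∧ ‖x‖⁻¹ • x ∈ s}

open Pointwise in
theorem sphereMeasure_apply {s : Set (Space n)} (hs : MeasurableSet s) :
    sphereMeasure n s = (n + 1) * volume (unitCone s) := by
  rw [sphereMeasure, Measure.map_apply measurable_subtype_coe hs,
    Measure.toSphere_apply' _ (measurable_subtype_coe hs)]
  congr 1
  · simp
  · congr 1
    ext x
    rw [Set.mem_smul]
    constructor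
    · rintro ⟨r, hr, _, ⟨ζ, hζ, rfl⟩, rfl⟩
      have hn : ‖(ζ : Space n)‖ = 1 := by simp
      have hne : (ζ : Space n) ≠ 0 := norm_pos_iff.1 (by rw [hn]; exact one_pos)
      have hr0 : 0 < r := hr.1
      refine ⟨smul_ne_zero hr.1.ne' hne, ?_, ?_⟩
      · change ‖r • (ζ : Space n)‖ < 1
        rw [norm_smul, hn, Real.norm_of_nonneg hr0.le, mul_one]; exact hr.2
      · change ‖r • (ζ : Space n)‖⁻¹ • r • (ζ : Space n) ∈ s
        rw [norm_smul, hn, Real.norm_of_nonneg hr0.le, mul_one, smul_smul,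
          inv_mul_cancel₀ hr.1.ne', one_smul]; exact hζ
    · rintro ⟨h1, h2, h3⟩
      have hx : 0 < ‖x‖ := norm_pos_iff.2 h1
      refine ⟨‖x‖, ⟨hx, h2⟩, ‖x‖⁻¹ • x, ⟨⟨‖x‖⁻¹ • x, ?_⟩, h3, rfl⟩, ?_⟩
      · simp [norm_smul, hx.ne']
      · change ‖x‖ • ‖x‖⁻¹ • x = x
        rw [smul_smul, mul_inv_cancel₀ hx.ne', one_smul]

/-- The surface measure of the unit sphere is invariant under linear isometries. -/
theorem measurePreserving_isometry (ρ : Space n ≃ₗᵢ[ℝ] Space n) :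
    MeasurePreserving ρ (sphereMeasure n) (sphereMeasure n) := by
  refine ⟨ρ.continuous.measurable, ?_⟩
  ext s hs
  rw [Measure.map_apply ρ.continuous.measurable hs, sphereMeasure_apply hs,
    sphereMeasure_apply (ρ.continuous.measurable hs)]
  congr 1
  have : unitCone (ρ ⁻¹' s) = ρ ⁻¹' (unitCone s) := by
    ext x
    simp [unitCone]
  rw [this]
  exact ρ.measurePreserving.measure_preimage_equiv (f := ρ.toMeasurableEquiv) _

/-- The cone over a great subsphere lies in a proper linear subspace, which is a null set. -/
theorem sphereMeasure_hyperplane {v : Space n} (hv : v ≠ 0) :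
    sphereMeasure n {ζ | inner ℝ v ζ = 0} = 0 := by
  have hm : MeasurableSet {ζ : Space n | inner ℝ v ζ = 0} :=
    (isClosed_eq (by fun_prop) continuous_const).measurableSet
  rw [sphereMeasure_apply hm]
  have hsub : unitCone {ζ : Space n | inner ℝ v ζ = 0} ⊆
      (LinearMap.ker (innerₛₗ ℝ v) : Submodule ℝ (Space n)) := by
    rintro x ⟨h1, -, h3⟩
    simp only [mem_ofPred_eq, inner_smul_right, mul_eq_zero, inv_eq_zero, norm_eq_zero] at h3
    simpa using h3.resolve_left h1
  have hne : LinearMap.ker (innerₛₗ ℝ v) ≠ (⊤ : Submodule ℝ (Space n)) := by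
    intro h
    have : v ∈ LinearMap.ker (innerₛₗ ℝ v) := h ▸ Submodule.mem_top
    simp at this
    exact hv this
  rw [measure_mono_null hsub (Measure.addHaar_submodule _ _ hne), mul_zero]

theorem sphereMeasure_pos_of_isOpen {U : Set (Space n)} (hU : IsOpen U) {ζ : Space n}
    (hζ : ‖ζ‖ = 1) (hζU : ζ ∈ U) : 0 < sphereMeasure n U := by
  rw [sphereMeasure, Measure.map_apply measurable_subtype_coe hU.measurableSet]
  exact (hU.preimage continuous_subtype_val).measure_pos _ ⟨⟨ζ, by simpa using hζ⟩, hζU⟩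

theorem sphereMeasure_norm_ne_one : sphereMeasure n {x | ‖x‖ ≠ 1} = 0 := by
  have hm : MeasurableSet {x : Space n | ‖x‖ ≠ 1} :=
    (isOpen_ne_fun continuous_norm continuous_const).measurableSet
  rw [sphereMeasure_apply hm]
  have : unitCone {x : Space n | ‖x‖ ≠ 1} = ∅ := by
    ext x
    simp only [unitCone, mem_ofPred_eq, mem_empty_iff_false, iff_false, not_and, not_not]
    intro h _
    rw [norm_smul, norm_inv, norm_norm, inv_mul_cancel₀ (norm_ne_zero_iff.2 h)]
  rw [this]; simp

/-- Relatively open nonempty subsets of the spherical cap have positive measure. -/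
theorem sphereMeasure_inter_sphereCap_pos (hc : 0 < Real.cos θ) (hθ : Real.cos θ < 1)
    {U : Set (Space n)} (hU : IsOpen U) {ζ : Space n} (hζ : ζ ∈ sphereCap n θ) (hζU : ζ ∈ U) :
    0 < sphereMeasure n (U ∩ sphereCap n θ) := by
  obtain ⟨hn, hh⟩ := mem_sphereCap.1 hζ
  have key : ∃ ξ ∈ U, ‖ξ‖ = 1 ∧ Real.cos θ < height ξ := by
    rcases hh.lt_or_eq with hlt | heq
    · exact ⟨ζ, hζU, hn, hlt⟩
    -- A rim point is pushed towards the pole: normalizing `ζ + t • lastVec n` for small `t > 0`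
    -- keeps it in `U` and raises its height strictly above `cos θ`.
    have hcont0 : Continuous (fun t : ℝ => ζ + t • lastVec n) := by fun_prop
    have hcont : ContinuousAt (fun t : ℝ => ‖ζ + t • lastVec n‖⁻¹ • (ζ + t • lastVec n)) 0 :=
      ContinuousAt.smul (ContinuousAt.inv₀ hcont0.norm.continuousAt (by simp [hn]))
        hcont0.continuousAt
    have hmem : ∀ᶠ t : ℝ in 𝓝[>] 0, ‖ζ + t • lastVec n‖⁻¹ • (ζ + t • lastVec n) ∈ U := by
      refine nhdsWithin_le_nhds (hcont.eventually (hU.mem_nhds ?_))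
      simpa [hn] using hζU
    obtain ⟨t, ht, hpos⟩ := (hmem.and self_mem_nhdsWithin).exists
    have hpos' : (0 : ℝ) < t := hpos
    have hsq : ‖ζ + t • lastVec n‖ ^ 2 = 1 + 2 * t * Real.cos θ + t ^ 2 := by
      rw [norm_add_sq_real, hn, inner_smul_right, inner_lastVec, norm_smul, norm_lastVec, ← heq]
      simp; ring
    have hht : height (ζ + t • lastVec n) = Real.cos θ + t := by simp [heq]
    have hnpos : 0 < ‖ζ + t • lastVec n‖ :=
      lt_of_lt_of_le (by rw [hht]; positivity)
        ((le_abs_self _).trans (abs_height_le (ζ + t • lastVec n)))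
    refine ⟨_, ht, by rw [norm_smul, norm_inv, norm_norm]; field_simp, ?_⟩
    rw [height_smul, hht, inv_mul_eq_div, lt_div_iff₀ hnpos]
    refine lt_of_pow_lt_pow_left₀ 2 (by positivity) ?_
    rw [mul_pow, hsq]
    have h1 : 0 < 1 - Real.cos θ ^ 2 := by nlinarith
    have h2 : 0 < t * (2 * Real.cos θ + t) * (1 - Real.cos θ ^ 2) := by positivity
    nlinarith
  obtain ⟨ξ, hξU, hξn, hξh⟩ := key
  have hV : IsOpen (U ∩ {x : Space n | Real.cos θ < height x}) :=
    hU.inter (isOpen_lt continuous_const continuous_height)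
  have hpos := sphereMeasure_pos_of_isOpen hV hξn ⟨hξU, hξh⟩
  refine hpos.trans_le ?_
  have hsub : U ∩ {x : Space n | Real.cos θ < height x} ⊆
      (U ∩ sphereCap n θ) ∪ {x | ‖x‖ ≠ 1} := by
    rintro x ⟨h1, h2⟩
    by_cases hx : ‖x‖ = 1
    · exact Or.inl ⟨h1, mem_sphereCap.2 ⟨hx, le_of_lt h2⟩⟩
    · exact Or.inr hx
  calc _ ≤ _ := measure_mono hsub
    _ ≤ _ := measure_union_le _ _
    _ = _ := by rw [sphereMeasure_norm_ne_one, add_zero]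

/-- Splitting off the last coordinate. -/
def split (x : Space n) : ℝ × EuclideanSpace ℝ (Fin n) :=
  (height x, WithLp.toLp 2 fun i => x i.castSucc)

theorem measurePreserving_split : MeasurePreserving (split (n := n)) volume volume := by
  have h1 := EuclideanSpace.volume_preserving_symm_measurableEquiv_toLp (Fin (n + 1))
  have h2 := volume_preserving_piFinSuccAbove (fun _ : Fin (n + 1) => ℝ) (Fin.last n)
  have h3 : MeasurePreserving (WithLp.toLp 2 : (Fin n → ℝ) → EuclideanSpace ℝ (Fin n)) :=
    PiLp.volume_preserving_toLp (Fin n)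
  have h4 := ((MeasurePreserving.id (volume : Measure ℝ)).prod h3).comp (h2.comp h1)
  have h5 : split (n := n) = Prod.map id (WithLp.toLp 2) ∘
      (MeasurableEquiv.piFinSuccAbove (fun _ : Fin (n + 1) => ℝ) (Fin.last n)) ∘
        (MeasurableEquiv.toLp 2 (Fin (n + 1) → ℝ)).symm := by
    funext x
    simp [split, height, MeasurableEquiv.piFinSuccAbove, Fin.insertNthEquiv]
    rfl
  rw [h5]
  exact h4

theorem norm_sq_split (x : Space n) : ‖x‖ ^ 2 = (split x).1 ^ 2 + ‖(split x).2‖ ^ 2 := by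
  rw [EuclideanSpace.norm_sq_eq, EuclideanSpace.norm_sq_eq, Fin.sum_univ_castSucc]
  simp [split, height, add_comm]

/-- A measurable cone with vertex at the origin over a ball in the hyperplane. -/
theorem volume_solid_cone {a c : ℝ} (ha : 0 < a) (hc : 0 < c) :
    (n + 1) * volume {x : Space n | 0 < (split x).1 ∧ (split x).1 < c ∧
      ‖(split x).2‖ ≤ a * (split x).1} =
    ENNReal.ofReal (a ^ n * c ^ (n + 1)) *
      volume (Metric.closedBall (0 : EuclideanSpace ℝ (Fin n)) 1) := by
  set Q : Set (ℝ × EuclideanSpace ℝ (Fin n)) := {p | 0 < p.1 ∧ p.1 < c ∧ ‖p.2‖ ≤ a * p.1} with hQ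
  have hQm : MeasurableSet Q := by
    refine (measurableSet_lt measurable_const measurable_fst).inter
      ((measurableSet_lt measurable_fst measurable_const).inter
      (measurableSet_le measurable_snd.norm (measurable_fst.const_mul a)))
  have h1 : volume {x : Space n | 0 < (split x).1 ∧ (split x).1 < c ∧
      ‖(split x).2‖ ≤ a * (split x).1} = volume Q :=
    measurePreserving_split.measure_preimage hQm.nullMeasurableSet
  have h2 : volume Q = ∫⁻ t in Ioo 0 c, ENNReal.ofReal ((a * t) ^ n) *
      volume (Metric.closedBall (0 : EuclideanSpace ℝ (Fin n)) 1) := by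
    rw [Measure.volume_eq_prod, Measure.prod_apply hQm, ← lintegral_indicator measurableSet_Ioo]
    congr 1
    funext t
    by_cases ht : t ∈ Ioo 0 c
    · rw [indicator_of_mem ht]
      have : Prod.mk t ⁻¹' Q = Metric.closedBall 0 (a * t) := by
        ext y; simp [hQ, ht.1, ht.2]
      rw [this, Measure.addHaar_closedBall' _ _ (mul_nonneg ha.le ht.1.le)]
      simp
    · rw [indicator_of_notMem ht]
      have : Prod.mk t ⁻¹' Q = ∅ := by
        ext y
        simp only [hQ, mem_preimage, mem_ofPred_eq, mem_empty_iff_false, iff_false]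
        exact fun h => ht ⟨h.1, h.2.1⟩
      rw [this, measure_empty]
  have h3 : ∫⁻ t in Ioo 0 c, ENNReal.ofReal ((a * t) ^ n) =
      ENNReal.ofReal (a ^ n * (c ^ (n + 1) / (n + 1))) := by
    rw [← ofReal_integral_eq_lintegral_ofReal]
    · congr 1
      rw [← integral_Ioc_eq_integral_Ioo, ← intervalIntegral.integral_of_le hc.le]
      simp_rw [mul_pow]
      rw [intervalIntegral.integral_const_mul, integral_pow]
      simp
    · have : Continuous (fun t : ℝ => (a * t) ^ n) := by fun_prop
      exact (this.integrableOn_Icc (a := 0) (b := c)).mono_set Ioo_subset_Icc_self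
    · filter_upwards [ae_restrict_mem measurableSet_Ioo] with t ht
      have := ht.1
      positivity
  rw [h1, h2, lintegral_mul_const _ (by fun_prop), h3, ← mul_assoc]
  congr 1
  rw [show ((n : ENNReal) + 1) = ENNReal.ofReal (n + 1) by
    rw [ENNReal.ofReal_add (by positivity) one_pos.le]; simp,
    ← ENNReal.ofReal_mul (by positivity)]
  congr 1
  field_simp

theorem capBody_slice (hs : 0 < Real.sin θ) :
    {y : EuclideanSpace ℝ (Fin n) |
      (WithLp.toLp 2 (Fin.snoc (α := fun _ => ℝ) y (0 : ℝ)) : Space n) ∈ capBody n θ} =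
    Metric.closedBall 0 (Real.sin θ) := by
  ext y
  set p : Space n := WithLp.toLp 2 (Fin.snoc (α := fun _ => ℝ) y (0 : ℝ)) with hp
  have hp0 : height p = 0 := by simp [hp, height]
  have hpn : ‖p‖ ^ 2 = ‖y‖ ^ 2 := by
    rw [norm_sq_split]
    simp [split, hp, height]
  have hn : ‖p - Real.cos θ • eVec n‖ ^ 2 = ‖y‖ ^ 2 + Real.cos θ ^ 2 := by
    rw [show p - Real.cos θ • eVec n = p + Real.cos θ • lastVec n by simp [eVec],
      norm_add_sq_real, hpn, inner_smul_right, inner_lastVec, hp0, norm_smul, norm_lastVec]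
    simp
  have h1 := Real.sin_sq_add_cos_sq θ
  rw [mem_closedBall_zero_iff]
  change (0 ≤ height p ∧ ‖p - Real.cos θ • eVec n‖ ≤ 1) ↔ ‖y‖ ≤ Real.sin θ
  rw [hp0, ← sq_le_sq₀ (norm_nonneg _) zero_le_one, ← sq_le_sq₀ (norm_nonneg y) hs.le, hn]
  constructor
  · rintro ⟨-, h⟩; linarith
  · intro h; exact ⟨le_rfl, by linarith⟩

/-- The capillary area of the spherical cap is positive. -/
theorem capillaryArea_pos (hc : 0 < Real.cos θ) (hs : 0 < Real.sin θ) :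
    0 < capillaryArea n θ := by
  have hsc := Real.sin_sq_add_cos_sq θ
  have hc1 : Real.cos θ < 1 := by nlinarith
  -- `Q` is the solid cone with vertex 0, height `cos θ` and a base disc of radius `sin θ`, so `(n +
  -- 1)` times its volume is the subtracted term of `capillaryArea`. `W` is the part of the unit
  -- ball above that disc. Both lie in the cone over the cap, and the volume of `W` makes the
  -- inequality strict.
  set Q := {x : Space n | 0 < (split x).1 ∧ (split x).1 < Real.cos θ ∧
      ‖(split x).2‖ ≤ Real.sin θ / Real.cos θ * (split x).1} with hQ
  set W := {x : Space n | Real.cos θ < height x} ∩ Metric.ball 0 1 with hW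
  have hWo : IsOpen W := (isOpen_lt continuous_const continuous_height).inter Metric.isOpen_ball
  have hWpos : 0 < volume W := by
    refine hWo.measure_pos _ ⟨((1 + Real.cos θ) / 2) • lastVec n, ?_, ?_⟩
    · simp; linarith
    · rw [mem_ball_zero_iff, norm_smul, norm_lastVec, Real.norm_of_nonneg (by positivity)]; linarith
  have hdisj : Disjoint Q W := by
    rw [Set.disjoint_left]
    rintro x ⟨-, h1, -⟩ ⟨h2, -⟩
    exact absurd h1 (not_lt.2 (le_of_lt h2))
  have hcone : ∀ x : Space n, 0 < ‖x‖ → ‖x‖ < 1 → Real.cos θ * ‖x‖ ≤ height x →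
      x ∈ unitCone (sphereCap n θ) := fun x h1 h2 h3 => by
    refine ⟨norm_pos_iff.1 h1, h2, mem_sphereCap.2 ⟨?_, ?_⟩⟩
    · rw [norm_smul, norm_inv, norm_norm]; field_simp
    · rw [height_smul, inv_mul_eq_div, le_div_iff₀ h1]; exact h3
  have hsub : Q ∪ W ⊆ unitCone (sphereCap n θ) := by
    rintro x (⟨h1, h2, h3⟩ | ⟨h1, h2⟩)
    · have hns := norm_sq_split x
      have h4 : Real.cos θ * ‖x‖ ≤ height x := by
        have h1' : 0 < height x := h1
        refine le_of_sq_le_sq ?_ h1'.le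
        have h5 : Real.cos θ * ‖(split x).2‖ ≤ Real.sin θ * (split x).1 := by
          have := mul_le_mul_of_nonneg_left h3 hc.le
          field_simp at this; linarith
        have h6 : (Real.cos θ * ‖(split x).2‖) ^ 2 ≤ (Real.sin θ * (split x).1) ^ 2 :=
          pow_le_pow_left₀ (by positivity) h5 2
        change (Real.cos θ * ‖x‖) ^ 2 ≤ (split x).1 ^ 2
        rw [mul_pow, hns]
        nlinarith
      have h5 : 0 < ‖x‖ := h1.trans_le ((le_abs_self _).trans (abs_height_le x))
      refine hcone x h5 ?_ h4
      have h6 : height x < Real.cos θ := h2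
      by_contra! hcon
      nlinarith
    · have h3 : 0 < ‖x‖ := (hc.trans h1).trans_le ((le_abs_self _).trans (abs_height_le x))
      have h4 : ‖x‖ < 1 := by simpa using h2
      refine hcone x h3 h4 ?_
      have : Real.cos θ < height x := h1
      nlinarith
  have hvol : volume Q + volume W ≤ volume (unitCone (sphereCap n θ)) := by
    rw [← measure_union hdisj hWo.measurableSet]
    exact measure_mono hsub
  have hflat : flatArea (capBody n θ) =
      Real.sin θ ^ n * (volume (Metric.closedBall (0 : EuclideanSpace ℝ (Fin n)) 1)).toReal := by
    rw [flatArea, capBody_slice hs, Measure.real, Measure.addHaar_closedBall' _ _ hs.le,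
      ENNReal.toReal_mul, ENNReal.toReal_ofReal (by positivity)]
    simp
  have hQv := volume_solid_cone (n := n) (div_pos hs hc) hc
  rw [← hQ] at hQv
  have hQr : ((n + 1) * volume Q).toReal = Real.cos θ * flatArea (capBody n θ) := by
    rw [hQv, ENNReal.toReal_mul, ENNReal.toReal_ofReal (by positivity), hflat, div_pow,
      pow_succ]
    field_simp
  have hlt : (n + 1) * volume Q < sphereMeasure n (sphereCap n θ) := by
    rw [sphereMeasure_apply measurableSet_sphereCap]
    have hne : (n + 1) * volume Q ≠ ⊤ := by
      rw [hQv]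
      exact ENNReal.mul_ne_top ENNReal.ofReal_ne_top measure_closedBall_lt_top.ne
    calc (n + 1) * volume Q < (n + 1) * volume Q + (n + 1) * volume W := by
          refine ENNReal.lt_add_right hne (mul_ne_zero (by positivity) hWpos.ne')
      _ = (n + 1) * (volume Q + volume W) := by rw [mul_add]
      _ ≤ _ := by gcongr
  rw [capillaryArea, Measure.real, capMeasure_cap, ← hQr, sub_pos]
  exact (ENNReal.toReal_lt_toReal (ne_top_of_lt hlt) (measure_ne_top _ _)).2 hlt

/-- Neighbourhoods of the equator have small measure. -/
theorem sphereMeasure_slab_le {κ : ℝ} (hκ : 0 ≤ κ) :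
    sphereMeasure n {ζ | |height ζ| ≤ κ} ≤ ENNReal.ofReal ((n + 1) * 2 ^ (n + 1) * κ) := by
  have hm : MeasurableSet {ζ : Space n | |height ζ| ≤ κ} :=
    (isClosed_le (by fun_prop) continuous_const).measurableSet
  rw [sphereMeasure_apply hm]
  -- The cone over the slab lies in this box, of volume `2 ^ n * (2 * κ)`.
  let B : Set (Fin (n + 1) → ℝ) := Icc (fun i => if i = Fin.last n then -κ else -1)
    (fun i => if i = Fin.last n then κ else 1)
  have hsub : unitCone {ζ : Space n | |height ζ| ≤ κ} ⊆ WithLp.ofLp ⁻¹' B := by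
    rintro x ⟨h1, h2, h3⟩
    have hx : 0 < ‖x‖ := norm_pos_iff.2 h1
    have h4 : |height x| ≤ κ := by
      simp only [mem_ofPred_eq, height_smul, abs_mul, abs_inv, abs_norm] at h3
      rw [inv_mul_le_iff₀ hx] at h3
      nlinarith
    have h5 : ∀ i, |x i| ≤ 1 := fun i => by
      have := PiLp.norm_apply_le x i
      rw [Real.norm_eq_abs] at this
      linarith
    refine ⟨fun i => ?_, fun i => ?_⟩
    · by_cases hi : i = Fin.last n
      · subst hi; simp only [if_true]; exact (abs_le.1 h4).1
      · simpa [hi] using (abs_le.1 (h5 i)).1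
    · by_cases hi : i = Fin.last n
      · subst hi; simp only [if_true]; exact (abs_le.1 h4).2
      · simpa [hi] using (abs_le.1 (h5 i)).2
  have hvol : volume (WithLp.ofLp ⁻¹' B : Set (Space n)) = ENNReal.ofReal (2 ^ (n + 1) * κ) := by
    rw [(PiLp.volume_preserving_ofLp (Fin (n + 1))).measure_preimage measurableSet_Icc.nullMeasurableSet,
      Real.volume_Icc_pi, Fin.prod_univ_castSucc]
    have : ∀ i : Fin n, (i.castSucc = Fin.last n) = False := fun i => by
      simp
    simp only [this, if_false, if_true]
    rw [Finset.prod_const, Finset.card_univ, Fintype.card_fin, ← ENNReal.ofReal_pow (by norm_num),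
      ← ENNReal.ofReal_mul (by norm_num)]
    congr 1
    ring
  calc _ ≤ (n + 1) * volume (WithLp.ofLp ⁻¹' B : Set (Space n)) := by gcongr
    _ = _ := by
      rw [hvol, show ((n : ENNReal) + 1) = ENNReal.ofReal (n + 1) by
        rw [ENNReal.ofReal_add (by positivity) one_pos.le]; simp,
        ← ENNReal.ofReal_mul (by positivity), mul_assoc]


/-! ### Logarithmic integrals and comparison of entropies -/

theorem cos_lt_one_of_sin_pos (hs : 0 < Real.sin θ) : Real.cos θ < 1 := by
  have := Real.sin_sq_add_cos_sq θ
  nlinarith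

theorem sphereEll_le_one (hc : 0 < Real.cos θ) {ζ : Space n} (hζ : ζ ∈ sphereCap n θ) :
    sphereEll θ ζ ≤ 1 := by
  rw [sphereEll_eq]
  have := (mem_sphereCap.1 hζ).2
  nlinarith

theorem le_sphereEll (hc : 0 < Real.cos θ) {ζ : Space n} (hζ : ζ ∈ sphereCap n θ) :
    1 - Real.cos θ ≤ sphereEll θ ζ := by
  rw [sphereEll_eq]
  have h1 := (le_abs_self _).trans (abs_height_le ζ)
  rw [(mem_sphereCap.1 hζ).1] at h1
  nlinarith

theorem sphereEll_pos (hc : 0 < Real.cos θ) (hs : 0 < Real.sin θ) {ζ : Space n}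
    (hζ : ζ ∈ sphereCap n θ) : 0 < sphereEll θ ζ := by
  have := le_sphereEll hc hζ
  have := cos_lt_one_of_sin_pos hs
  linarith

@[fun_prop] theorem continuous_sphereEll : Continuous (sphereEll θ : Space n → ℝ) := by
  have : (sphereEll θ : Space n → ℝ) = fun ζ => 1 - Real.cos θ * height ζ := by
    funext ζ; exact sphereEll_eq ζ
  rw [this]; fun_prop

/-- The weighted logarithmic integral of a function over the spherical cap. -/
def logInt (θ : ℝ) (h : Space n → ℝ) : ℝ :=
  ∫ ζ in sphereCap n θ, Real.log (h ζ / sphereEll θ ζ) * sphereEll θ ζ ∂(sphereMeasure n)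

/-- The total mass of the weight `ℓ`. -/
def ellMass (n : ℕ) (θ : ℝ) : ℝ := ∫ ζ in sphereCap n θ, sphereEll θ ζ ∂(sphereMeasure n)

theorem genEntropyAt_eq (K : Set (Space n)) (z : Space n) :
    genEntropyAt θ K z = 1 / capillaryArea n θ * logInt θ (support K z) := rfl

theorem integrableOn_of_continuousOn {f : Space n → ℝ} (hf : ContinuousOn f (sphereCap n θ)) :
    IntegrableOn f (sphereCap n θ) (sphereMeasure n) :=
  hf.integrableOn_compact isCompact_sphereCap

theorem ellMass_nonneg (hc : 0 < Real.cos θ) (hs : 0 < Real.sin θ) : 0 ≤ ellMass n θ :=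
  setIntegral_nonneg measurableSet_sphereCap fun _ hζ => (sphereEll_pos hc hs hζ).le

theorem integrableOn_logInt (hc : 0 < Real.cos θ) (hs : 0 < Real.sin θ) {h : Space n → ℝ}
    (hh : ContinuousOn h (sphereCap n θ)) (hpos : ∀ ζ ∈ sphereCap n θ, 0 < h ζ) :
    IntegrableOn (fun ζ => Real.log (h ζ / sphereEll θ ζ) * sphereEll θ ζ) (sphereCap n θ)
      (sphereMeasure n) := by
  refine integrableOn_of_continuousOn (ContinuousOn.mul (ContinuousOn.log (hh.div
    continuous_sphereEll.continuousOn fun ζ hζ => (sphereEll_pos hc hs hζ).ne') fun ζ hζ =>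
    (div_pos (hpos ζ hζ) (sphereEll_pos hc hs hζ)).ne') continuous_sphereEll.continuousOn)

theorem logInt_mono (hc : 0 < Real.cos θ) (hs : 0 < Real.sin θ) {h g : Space n → ℝ}
    (hh : ContinuousOn h (sphereCap n θ)) (hg : ContinuousOn g (sphereCap n θ))
    (hpos : ∀ ζ ∈ sphereCap n θ, 0 < h ζ) (hle : ∀ ζ ∈ sphereCap n θ, h ζ ≤ g ζ) :
    logInt θ h ≤ logInt θ g := by
  refine setIntegral_mono_on (integrableOn_logInt hc hs hh hpos)
    (integrableOn_logInt hc hs hg fun ζ hζ => (hpos ζ hζ).trans_le (hle ζ hζ))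
    measurableSet_sphereCap fun ζ hζ => ?_
  have hl := sphereEll_pos hc hs hζ
  have h1 := hpos ζ hζ
  have h2 := hle ζ hζ
  gcongr

theorem logInt_const_mul (hc : 0 < Real.cos θ) (hs : 0 < Real.sin θ) {h : Space n → ℝ}
    (hh : ContinuousOn h (sphereCap n θ)) (hpos : ∀ ζ ∈ sphereCap n θ, 0 < h ζ) {a : ℝ}
    (ha : 0 < a) : logInt θ (fun ζ => a * h ζ) = Real.log a * ellMass n θ + logInt θ h := by
  rw [logInt, logInt, ellMass, ← integral_const_mul, ← integral_add]
  · refine setIntegral_congr_fun measurableSet_sphereCap fun ζ hζ => ?_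
    have hl := sphereEll_pos hc hs hζ
    have h1 := hpos ζ hζ
    change Real.log (a * h ζ / sphereEll θ ζ) * sphereEll θ ζ = _
    rw [mul_div_assoc, Real.log_mul ha.ne' (by positivity), add_mul]
  · exact (integrableOn_of_continuousOn continuous_sphereEll.continuousOn).const_mul _
  · exact integrableOn_logInt hc hs hh hpos

/-- This is the form in which closeness of support functions enters: the error is multiplicative,
and the logarithm turns it into an additive constant. -/
theorem logInt_le_of_le_mul (hc : 0 < Real.cos θ) (hs : 0 < Real.sin θ) {h g : Space n → ℝ}
    (hh : ContinuousOn h (sphereCap n θ)) (hg : ContinuousOn g (sphereCap n θ)) {a : ℝ}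
    (ha : 0 < a) (hpos : ∀ ζ ∈ sphereCap n θ, 0 < h ζ)
    (hle : ∀ ζ ∈ sphereCap n θ, h ζ ≤ a * g ζ) :
    logInt θ h ≤ Real.log a * ellMass n θ + logInt θ g := by
  have hgpos : ∀ ζ ∈ sphereCap n θ, 0 < g ζ := fun ζ hζ => by
    have := (hpos ζ hζ).trans_le (hle ζ hζ)
    exact pos_of_mul_pos_right this ha.le
  rw [← logInt_const_mul hc hs hg hgpos ha]
  exact logInt_mono hc hs hh (continuousOn_const.mul hg) hpos hle

theorem abs_support_le {K : Set (Space n)} (hK : IsCompact K) (hne : K.Nonempty) (z : Space n) :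
    ∃ R > 0, ∀ ζ : Space n, ‖ζ‖ = 1 → |support K z ζ| ≤ R := by
  obtain ⟨R, hR⟩ := hK.isBounded.subset_closedBall z
  refine ⟨max R 1, by positivity, fun ζ hζ => ?_⟩
  obtain ⟨y, hy, he⟩ := exists_support_eq hK hne z ζ
  rw [he]
  have h1 := abs_real_inner_le_norm (y - z) ζ
  rw [hζ, mul_one] at h1
  have h2 : ‖y - z‖ ≤ R := by simpa [dist_eq_norm] using hR hy
  exact (h1.trans h2).trans (le_max_left _ _)

theorem support_le_add_norm {K : Set (Space n)} (hK : IsCompact K) (hne : K.Nonempty)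
    (z w : Space n) {ζ : Space n} (hζ : ‖ζ‖ = 1) : support K z ζ ≤ support K w ζ + ‖z - w‖ := by
  rw [support_eq_sub hK hne z w]
  have := abs_real_inner_le_norm (z - w) ζ
  rw [hζ, mul_one] at this
  linarith [neg_abs_le (inner ℝ (z - w) ζ)]

namespace IsConeBody

variable {K L : Set (Space n)}

theorem support_pos (hK : IsConeBody θ K) (hc : 0 < Real.cos θ) {z : Space n}
    (hz : z ∈ flatInterior K) {ζ : Space n} (hζ : ζ ∈ sphereCap n θ) : 0 < support K z ζ := by
  obtain ⟨δ, hδ, h⟩ := hK.exists_le_support hc hz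
  exact hδ.trans_le (h ζ hζ)

theorem continuousOn_support (hK : IsConeBody θ K) (z : Space n) :
    ContinuousOn (support K z) (sphereCap n θ) :=
  (continuous_support hK.isCompact z).continuousOn

/-- Comparison of the entropies of two bodies after a homothety centred at `o`. -/
theorem logInt_support_le (hK : IsConeBody θ K) (hL : IsConeBody θ L) (hc : 0 < Real.cos θ)
    (hs : 0 < Real.sin θ) {o z : Space n} (ho : height o = 0) {a : ℝ} (ha : 0 < a)
    (h : ∀ ζ ∈ sphereCap n θ, support K o ζ ≤ a * support L o ζ) (hz : z ∈ flatInterior K) :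
    o + a⁻¹ • (z - o) ∈ flatInterior L ∧
      logInt θ (support K z) ≤
        Real.log a * ellMass n θ + logInt θ (support L (o + a⁻¹ • (z - o))) := by
  -- Changing the base point from `o` subtracts the same linear term on both sides, because the
  -- factors `a` and `a⁻¹` cancel.
  have hle : ∀ ζ ∈ sphereCap n θ, support K z ζ ≤ a * support L (o + a⁻¹ • (z - o)) ζ := by
    intro ζ hζ
    rw [support_eq_sub hK.isCompact hK.nonempty z o, support_eq_sub hL.isCompact hL.nonempty _ o,
      add_sub_cancel_left, inner_smul_left, mul_sub]
    have : a * (a⁻¹ * inner ℝ (z - o) ζ) = inner ℝ (z - o) ζ := by field_simp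
    simp only [conj_trivial]
    rw [this]
    linarith [h ζ hζ]
  refine ⟨hL.mem_flatInterior_of_pos hc hs (by simp [ho, hz.1]) fun ζ hζ => ?_, ?_⟩
  · exact pos_of_mul_pos_right ((hK.support_pos hc hz hζ).trans_le (hle ζ hζ)) ha.le
  · exact logInt_le_of_le_mul hc hs (hK.continuousOn_support z) (hL.continuousOn_support _) ha
      (fun ζ hζ => hK.support_pos hc hz hζ) hle

/-- The support functions are bounded by twice the radius of a ball about 0 containing the body.
Without this bound the real supremum would only be a default value. -/
theorem bddAbove_genEntropyAt (hK : IsConeBody θ K) (hc : 0 < Real.cos θ) (hs : 0 < Real.sin θ) :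
    BddAbove (genEntropyAt θ K '' flatInterior K) := by
  obtain ⟨R, hR⟩ := hK.isCompact.isBounded.exists_norm_le
  have hRpos : 0 < 2 * (|R| + 1) := by positivity
  refine ⟨1 / capillaryArea n θ * (Real.log (2 * (|R| + 1)) * ellMass n θ +
    logInt θ (fun _ : Space n => 1)), ?_⟩
  rintro _ ⟨z, hz, rfl⟩
  rw [genEntropyAt_eq]
  have hω := capillaryArea_pos (n := n) hc hs
  refine mul_le_mul_of_nonneg_left ?_ (by positivity)
  refine logInt_le_of_le_mul hc hs (hK.continuousOn_support z) continuousOn_const hRpos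
    (fun ζ hζ => hK.support_pos hc hz hζ) fun ζ hζ => ?_
  refine support_le_of_forall hK.isCompact hK.nonempty fun y hy => ?_
  have h1 := real_inner_le_norm (y - z) ζ
  rw [(mem_sphereCap.1 hζ).1, mul_one] at h1
  have h2 := norm_sub_le y z
  have h3 := hR y hy
  have h4 := hR z (mem_of_mem_flatPart hK.isCompact (mem_flatPart_of_mem_flatInterior hz))
  have h5 := le_abs_self R
  linarith

theorem genEntropyAt_le (hK : IsConeBody θ K) (hc : 0 < Real.cos θ) (hs : 0 < Real.sin θ)
    {z : Space n} (hz : z ∈ flatInterior K) : genEntropyAt θ K z ≤ genEntropy θ K :=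
  le_csSup (hK.bddAbove_genEntropyAt hc hs) ⟨z, hz, rfl⟩

theorem logInt_le (hK : IsConeBody θ K) (hc : 0 < Real.cos θ) (hs : 0 < Real.sin θ)
    {z : Space n} (hz : z ∈ flatInterior K) :
    logInt θ (support K z) ≤ capillaryArea n θ * genEntropy θ K := by
  have h := hK.genEntropyAt_le hc hs hz
  have hω := capillaryArea_pos (n := n) hc hs
  rw [genEntropyAt_eq, one_div, inv_mul_le_iff₀ hω] at h
  exact h

/-- Each competitor for `K` is moved to one for `L` by the homothety of ratio `a⁻¹` about `o`, at
the cost of `log a` times the mass of the weight. -/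
theorem genEntropy_le (hK : IsConeBody θ K) (hL : IsConeBody θ L) (hc : 0 < Real.cos θ)
    (hs : 0 < Real.sin θ) {o : Space n} (ho : height o = 0) {a : ℝ} (ha : 0 < a)
    (h : ∀ ζ ∈ sphereCap n θ, support K o ζ ≤ a * support L o ζ) :
    genEntropy θ K ≤ ellMass n θ / capillaryArea n θ * Real.log a + genEntropy θ L := by
  have hω := capillaryArea_pos (n := n) hc hs
  rw [genEntropy_eq θ K]
  refine csSup_le ((hK.flatInterior_nonempty hc hs).image _) ?_
  rintro _ ⟨z, hz, rfl⟩
  obtain ⟨h1, h2⟩ := hK.logInt_support_le hL hc hs ho ha h hz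
  have h3 := hL.logInt_le hc hs h1
  rw [genEntropyAt_eq, one_div, inv_mul_le_iff₀ hω, mul_add]
  have : capillaryArea n θ * (ellMass n θ / capillaryArea n θ * Real.log a) =
    Real.log a * ellMass n θ := by field_simp
  linarith

end IsConeBody

/-! ### Hausdorff limits and continuity of the entropy -/

/-- Two sets are within Hausdorff distance `ε` of each other. -/
def HausdorffClose (ε : ℝ) (K L : Set (Space n)) : Prop :=
  (∀ y ∈ K, ∃ x ∈ L, dist y x < ε) ∧ ∀ x ∈ L, ∃ y ∈ K, dist x y < ε

theorem HausdorffClose.symm {ε : ℝ} {K L : Set (Space n)} (h : HausdorffClose ε K L) :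
    HausdorffClose ε L K := ⟨h.2, h.1⟩

theorem HausdorffClose.mono {ε δ : ℝ} {K L : Set (Space n)} (h : HausdorffClose ε K L)
    (hle : ε ≤ δ) : HausdorffClose δ K L :=
  ⟨fun y hy => (h.1 y hy).imp fun _ h => ⟨h.1, h.2.trans_le hle⟩,
    fun y hy => (h.2 y hy).imp fun _ h => ⟨h.1, h.2.trans_le hle⟩⟩

theorem HausdorffClose.support_le {ε : ℝ} {K L : Set (Space n)} (h : HausdorffClose ε K L)
    (hK : IsCompact K) (hne : K.Nonempty) (hL : IsCompact L) (z : Space n) {ζ : Space n}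
    (hζ : ‖ζ‖ = 1) : support K z ζ ≤ support L z ζ + ε := by
  refine support_le_of_forall hK hne fun y hy => ?_
  obtain ⟨x, hx, hxy⟩ := h.1 y hy
  have h1 := inner_le_support hL hx z ζ
  have h2 := real_inner_le_norm (y - x) ζ
  rw [hζ, mul_one, ← dist_eq_norm] at h2
  have h3 : inner ℝ (y - z) ζ = inner ℝ (y - x) ζ + inner ℝ (x - z) ζ := by
    rw [← inner_add_left, sub_add_sub_cancel]
  linarith

theorem hausdorffClose_of_tendsto {K : ℕ → Set (Space n)} {L : Set (Space n)}
    (h : Tendsto (fun k => Metric.hausdorffEDist (K k) L) atTop (𝓝 0)) {ε : ℝ} (hε : 0 < ε) :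
    ∀ᶠ k in atTop, HausdorffClose ε (K k) L := by
  filter_upwards [h.eventually (gt_mem_nhds (ENNReal.ofReal_pos.2 hε))] with k hk
  refine ⟨fun y hy => ?_, fun x hx => ?_⟩
  · obtain ⟨x, hx, hxy⟩ := Metric.exists_edist_lt_of_hausdorffEDist_lt hy hk
    exact ⟨x, hx, by rwa [edist_dist, ENNReal.ofReal_lt_ofReal_iff hε] at hxy⟩
  · rw [Metric.hausdorffEDist_comm] at hk
    obtain ⟨y, hy, hxy⟩ := Metric.exists_edist_lt_of_hausdorffEDist_lt hx hk
    exact ⟨y, hy, by rwa [edist_dist, ENNReal.ofReal_lt_ofReal_iff hε] at hxy⟩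

/-- Bodies which are Hausdorff close to a body with the cone property are comparable with it
after homotheties with ratio close to one. -/
theorem IsConeBody.exists_comparison {L : Set (Space n)} (hL : IsConeBody θ L)
    (hc : 0 < Real.cos θ) {o : Space n} (ho : o ∈ flatInterior L) {a : ℝ} (ha : 1 < a) :
    ∃ ε > 0, ∀ K : Set (Space n), IsConeBody θ K → HausdorffClose ε K L → ∀ ζ ∈ sphereCap n θ,
      support K o ζ ≤ a * support L o ζ ∧ support L o ζ ≤ a * support K o ζ := by
  obtain ⟨r, hr, hrL⟩ := hL.exists_le_support hc ho
  -- The second bound keeps both support functions above `r / 2`; the first then makes the additive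
  -- error at most `a - 1` times either of them.
  refine ⟨min ((a - 1) * (r / 2)) (r / 2), lt_min (mul_pos (by linarith) (by positivity))
    (by positivity), fun K hK hKL ζ hζ => ?_⟩
  have hn := (mem_sphereCap.1 hζ).1
  have h1 := hKL.support_le hK.isCompact hK.nonempty hL.isCompact o hn
  have h2 := hKL.symm.support_le hL.isCompact hL.nonempty hK.isCompact o hn
  have h3 := hrL ζ hζ
  have h4 := min_le_left ((a - 1) * (r / 2)) (r / 2)
  have h5 := min_le_right ((a - 1) * (r / 2)) (r / 2)
  constructor <;> nlinarith

/-- The homothety comparison is applied in both directions with ratio `exp t`, so that each costs `C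
* t < η`. -/
theorem IsConeBody.genEntropy_continuous {L : Set (Space n)} (hL : IsConeBody θ L)
    (hc : 0 < Real.cos θ) (hs : 0 < Real.sin θ) {η : ℝ} (hη : 0 < η) :
    ∃ ε > 0, ∀ K : Set (Space n), IsConeBody θ K → HausdorffClose ε K L →
      |genEntropy θ K - genEntropy θ L| < η := by
  obtain ⟨o, ho⟩ := hL.flatInterior_nonempty hc hs
  have hω := capillaryArea_pos (n := n) hc hs
  set C := ellMass n θ / capillaryArea n θ with hC
  have hC0 : 0 ≤ C := div_nonneg (ellMass_nonneg hc hs) hω.le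
  set t := η / (2 * (C + 1)) with ht
  have ht0 : 0 < t := by positivity
  have hCt : C * t < η := by
    have : (C + 1) * t = η / 2 := by rw [ht]; field_simp
    nlinarith
  obtain ⟨ε, hε, h⟩ := hL.exists_comparison hc ho (Real.one_lt_exp_iff.2 ht0)
  refine ⟨ε, hε, fun K hK hKL => ?_⟩
  have h1 := hK.genEntropy_le hL hc hs ho.1 (Real.exp_pos t) fun ζ hζ => (h K hK hKL ζ hζ).1
  have h2 := hL.genEntropy_le hK hc hs ho.1 (Real.exp_pos t) fun ζ hζ => (h K hK hKL ζ hζ).2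
  rw [Real.log_exp, ← hC] at h1 h2
  rw [abs_sub_lt_iff]
  constructor <;> linarith


theorem mem_of_forall_dist_lt {L : Set (Space n)} (hL : IsCompact L) {p : Space n} {C : ℝ}
    (h : ∀ ε > 0, ∃ x ∈ L, dist p x < C * ε) : p ∈ L := by
  rw [← hL.isClosed.closure_eq, Metric.mem_closure_iff]
  intro ε hε
  obtain ⟨x, hx, hpx⟩ := h (ε / (|C| + 1)) (by positivity)
  refine ⟨x, hx, hpx.trans_le ?_⟩
  have h1 : (|C| + 1) * (ε / (|C| + 1)) = ε := by field_simp
  have h2 : 0 ≤ ε / (|C| + 1) := by positivity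
  have h3 := le_abs_self C
  nlinarith

theorem norm_foot_sub_foot_le (x y : Space n) : ‖foot x - foot y‖ ≤ ‖x - y‖ := by
  have : foot x - foot y = foot (x - y) := by
    simp only [foot, height_sub, sub_smul]; abel
  rw [this]; exact norm_foot_le _

/-- Hausdorff limits of bodies with the cone property, with volume bounded from below, have the
cone property. -/
theorem isConeBody_of_limit (hs : 0 < Real.sin θ) {K : ℕ → Set (Space n)} {L : Set (Space n)}
    (hK : ∀ k, IsConeBody θ (K k)) {V : ENNReal} (hV : 0 < V)
    (hvol : ∀ k, V ≤ volume (K k)) (hL : IsCompact L)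
    (h : ∀ ε > 0, ∀ᶠ k in atTop, HausdorffClose ε (K k) L) : IsConeBody θ L := by
  have hconv : Convex ℝ L := by
    intro x hx y hy a b ha hb hab
    refine mem_of_forall_dist_lt (C := 2) hL fun ε hε => ?_
    obtain ⟨k, hk⟩ := (h ε hε).exists
    obtain ⟨x', hx', hxx⟩ := hk.2 x hx
    obtain ⟨y', hy', hyy⟩ := hk.2 y hy
    obtain ⟨w, hw, hww⟩ := hk.1 _ ((hK k).convex hx' hy' ha hb hab)
    refine ⟨w, hw, ?_⟩
    have h1 : dist (a • x + b • y) (a • x' + b • y') ≤ ε := by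
      rw [dist_eq_norm] at *
      have e : a • x + b • y - (a • x' + b • y') = a • (x - x') + b • (y - y') := by
        simp only [smul_sub]; abel
      rw [e]
      refine (norm_add_le _ _).trans ?_
      rw [norm_smul, norm_smul, Real.norm_of_nonneg ha, Real.norm_of_nonneg hb]
      nlinarith
    linarith [dist_triangle (a • x + b • y) (a • x' + b • y') w]
  -- Every closed thickening of `L` contains some `K k`, and the volumes of the thickenings tend to
  -- that of the compact set `L`. Positive volume forces interior points, as the frontier of a
  -- convex set is null.
  have hvolL : V ≤ volume L := by
    have hlim := tendsto_measure_cthickening_of_isCompact (μ := volume) hL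
    have hlim' := hlim.mono_left (nhdsWithin_le_nhds (s := Ioi 0))
    refine ge_of_tendsto hlim' ?_
    filter_upwards [self_mem_nhdsWithin] with ε hε
    obtain ⟨k, hk⟩ := (h ε hε).exists
    refine (hvol k).trans (measure_mono fun y hy => ?_)
    obtain ⟨x, hx, hxy⟩ := hk.1 y hy
    exact Metric.mem_cthickening_of_dist_le y x ε L hx hxy.le
  refine ⟨hL, hconv, ?_, fun x hx => ?_, fun y hy v hv hvn => ?_⟩
  · by_contra hint
    rw [not_nonempty_iff_eq_empty] at hint
    have h1 : volume L = 0 := by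
      refine measure_mono_null (t := frontier L) (fun x hx => ?_) (hconv.addHaar_frontier volume)
      exact ⟨subset_closure hx, by simp [hint]⟩
    rw [h1] at hvolL
    exact absurd hV (not_lt.2 hvolL)
  · change (0 : ℝ) ≤ height x
    refine le_of_forall_pos_le_add fun ε hε => ?_
    obtain ⟨k, hk⟩ := (h ε hε).exists
    obtain ⟨x', hx', hxx⟩ := hk.2 x hx
    have h1 : 0 ≤ height x' := (hK k).subset_halfSpace hx'
    have h2 := abs_height_le (x - x')
    rw [← dist_eq_norm, height_sub] at h2
    linarith [neg_abs_le (height x - height x')]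
  · have hy0 : 0 ≤ height y := by
      refine le_of_forall_pos_le_add fun ε hε => ?_
      obtain ⟨k, hk⟩ := (h ε hε).exists
      obtain ⟨x', hx', hxx⟩ := hk.2 y hy
      have h1 : 0 ≤ height x' := (hK k).subset_halfSpace hx'
      have h2 := abs_height_le (y - x')
      rw [← dist_eq_norm, height_sub] at h2
      linarith [neg_abs_le (height y - height x')]
    rcases hy0.eq_or_lt with h0 | hpos
    · rw [← h0, mul_zero] at hvn
      have : ‖v‖ ≤ 0 := by
        by_contra! hcon
        nlinarith [mul_pos hs hcon]
      rw [norm_le_zero_iff.1 this, add_zero, foot_eq_self h0.symm]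
      exact hy
    · refine mem_of_forall_dist_lt (C := 2 + ‖v‖ / height y) hL fun ε hε => ?_
      obtain ⟨k, hk⟩ := (h ε hε).exists
      obtain ⟨y', hy', hyy⟩ := hk.2 y hy
      have hy'0 : 0 ≤ height y' := (hK k).subset_halfSpace hy'
      -- Rescaling `v` by the ratio of the heights keeps it admissible for the approximating point
      -- `y'`. The rescaling error produces the term `‖v‖ / height y` in the constant.
      have hmem : foot y' + (height y' / height y) • v ∈ K k := by
        refine (hK k).cone_mem y' hy' _ (by simp [hv]) ?_
        rw [norm_smul, Real.norm_of_nonneg (by positivity)]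
        have : height y' / height y * (Real.sin θ * ‖v‖) ≤
            height y' / height y * (Real.cos θ * height y) :=
          mul_le_mul_of_nonneg_left hvn (by positivity)
        have e : height y' / height y * (Real.cos θ * height y) = Real.cos θ * height y' := by
          field_simp
        linarith
      obtain ⟨w, hw, hww⟩ := hk.1 _ hmem
      refine ⟨w, hw, ?_⟩
      have h1 : dist (foot y + v) (foot y' + (height y' / height y) • v) ≤
          ε + ‖v‖ / height y * ε := by
        rw [dist_eq_norm] at *
        have e : foot y + v - (foot y' + (height y' / height y) • v) =
            (foot y - foot y') + ((height y - height y') / height y) • v := by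
          rw [sub_div, div_self hpos.ne', sub_smul, one_smul]; abel
        rw [e]
        refine (norm_add_le _ _).trans (add_le_add ((norm_foot_sub_foot_le _ _).trans hyy.le) ?_)
        have h2 := abs_height_le (y - y')
        rw [height_sub] at h2
        rw [norm_smul, Real.norm_eq_abs, abs_div, abs_of_pos hpos, div_mul_eq_mul_div,
          div_mul_eq_mul_div, mul_comm]
        gcongr
        exact h2.trans hyy.le
      have := dist_triangle (foot y + v) (foot y' + (height y' / height y) • v) w
      linarith

theorem volume_capBody_pos (hθ : Real.cos θ < 1) (hc : 0 < Real.cos θ) :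
    0 < volume (capBody n θ) := by
  have hsub : {x : Space n | 0 < height x} ∩ Metric.ball (Real.cos θ • eVec n) 1 ⊆ capBody n θ := by
    rintro x ⟨h1, h2⟩
    exact ⟨le_of_lt h1, by rw [← dist_eq_norm]; exact le_of_lt h2⟩
  refine lt_of_lt_of_le (IsOpen.measure_pos _ ((isOpen_lt continuous_const
    continuous_height).inter Metric.isOpen_ball) ⟨((1 - Real.cos θ) / 2) • lastVec n, ?_, ?_⟩)
    (measure_mono hsub)
  · simp; linarith
  · have : ((1 - Real.cos θ) / 2) • lastVec n - Real.cos θ • eVec n =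
        ((1 + Real.cos θ) / 2) • lastVec n := by
      rw [eVec, smul_neg, sub_neg_eq_add, ← add_smul]; ring_nf
    rw [Metric.mem_ball, dist_eq_norm, this, norm_smul, norm_lastVec,
      Real.norm_of_nonneg (by positivity)]
    linarith

theorem isConeBody_of_mem_Gam {A : ℝ} (hs : 0 < Real.sin θ) {K : Set (Space n)}
    (hK : K ∈ Gam n θ A) : IsConeBody θ K := hK.1.isConeBody hs

theorem IsCapillaryConvexBody.entropy_eq {K : Set (Space n)} (hK : IsCapillaryConvexBody θ K)
    (hc : 0 < Real.cos θ) : entropy θ K = genEntropy θ K :=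
  entropy_eq_genEntropy hc hK.isCompact hK.convex hK.interior_nonempty hK.subset_halfSpace

/-- Hausdorff limits in `Γ_A` are `θ`-capillary convex bodies, and the entropies converge. -/
theorem limit_of_Gam (hθ : θ ∈ Ioo 0 (Real.pi / 2)) (hc : 0 < Real.cos θ) (hs : 0 < Real.sin θ)
    {A : ℝ} {K : ℕ → Set (Space n)} {L : Set (Space n)} (hK : ∀ k, K k ∈ Gam n θ A)
    (hL : IsCompact L) (h : Tendsto (fun k => Metric.hausdorffEDist (K k) L) atTop (𝓝 0)) :
    IsThetaCapillary θ L ∧ Tendsto (fun k => entropy θ (K k)) atTop (𝓝 (genEntropy θ L)) := by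
  have hKc := fun k => isConeBody_of_mem_Gam hs (hK k)
  have hLc : IsConeBody θ L := isConeBody_of_limit hs hKc
    (volume_capBody_pos (n := n) (cos_lt_one_of_sin_pos hs) hc) (fun k => (hK k).2.2.1.ge) hL
    fun ε hε => hausdorffClose_of_tendsto h hε
  refine ⟨hLc.isThetaCapillary hθ, Metric.tendsto_nhds.2 fun η hη => ?_⟩
  obtain ⟨ε, hε, hcont⟩ := hLc.genEntropy_continuous hc hs hη
  filter_upwards [hausdorffClose_of_tendsto h hε] with k hk
  rw [(hK k).1.entropy_eq hc, Real.dist_eq]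
  exact hcont _ (hKc k) hk


/-! ### Strict gain at relative boundary points of the flat part -/

/-- Here `p ≤ q` are the values at a direction and at its mirror image, moved to `p + x` and `q -
x`. Even if `p = q`, the first order terms cancel: the sum is at least `log (1 - (x / q) ^ 2)`. -/
theorem neg_two_mul_sq_le_log_add_log {p q x t : ℝ} (hp : 0 < p) (hpq : p ≤ q) (hx : 0 ≤ x)
    (hxq : x ≤ t * q) (ht2 : t ≤ 1 / 2) :
    -(2 * t ^ 2) ≤ Real.log ((p + x) / p) + Real.log ((q - x) / q) := by
  have hq : 0 < q := hp.trans_le hpq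
  have hy0 : 0 ≤ x / q := by positivity
  have hyt : x / q ≤ t := by rwa [div_le_iff₀ hq]
  set y := x / q with hy
  have hy2 : y ^ 2 ≤ t ^ 2 := pow_le_pow_left₀ hy0 hyt 2
  have ht4 : t ^ 2 ≤ 1 / 4 := by nlinarith
  have h1 : Real.log (1 + y) ≤ Real.log ((p + x) / p) := by
    refine Real.log_le_log (by positivity) ?_
    rw [add_div, div_self hp.ne']
    have : y ≤ x / p := div_le_div_of_nonneg_left hx hp hpq
    linarith
  have h2 : (q - x) / q = 1 - y := by rw [hy]; field_simp
  have h3 : Real.log (1 + y) + Real.log (1 - y) = Real.log (1 - y ^ 2) := by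
    rw [← Real.log_mul (by positivity) (by nlinarith)]; ring_nf
  have hpos : 0 < 1 - y ^ 2 := by linarith
  have h4 := Real.one_sub_inv_le_log_of_pos hpos
  have h5 : (1 - y ^ 2)⁻¹ ≤ 1 + 2 * y ^ 2 := by
    rw [inv_le_iff_one_le_mul₀ hpos]
    nlinarith [sq_nonneg y]
  rw [h2]
  linarith

/-- With a definite gap between the two values the product of the ratios is `1 + x * (q - p - x) /
(p * q)`, whose excess over 1 is linear in `t`. -/
theorem mul_le_log_add_log {p q x t κ R : ℝ} (hp : 0 < p) (hpq : p + κ ≤ q) (hqR : q ≤ R)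
    (hR : 1 ≤ R) (ht : 0 < t) (ht1 : t ≤ 1) (hκ : 0 < κ) (hx : t * κ ≤ x)
    (hx2 : x ≤ κ / 2) :
    t * (κ ^ 2 / (4 * R ^ 2)) ≤ Real.log ((p + x) / p) + Real.log ((q - x) / q) := by
  have hq : 0 < q := by linarith
  have hx0 : 0 < x := (mul_pos ht hκ).trans_le hx
  have hqx : 0 < q - x := by linarith
  rw [← Real.log_mul (by positivity) (by positivity)]
  set b := t * (κ ^ 2 / (2 * R ^ 2)) with hb
  have hb0 : 0 ≤ b := by positivity
  have hb1 : b ≤ 2 := by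
    have : κ ^ 2 / (2 * R ^ 2) ≤ 1 := by
      rw [div_le_one (by positivity)]; nlinarith
    nlinarith
  have hprod : 1 + b ≤ (p + x) / p * ((q - x) / q) := by
    have e : (p + x) / p * ((q - x) / q) = 1 + x * (q - p - x) / (p * q) := by
      field_simp; ring
    rw [e]
    have h1 : t * κ * (κ / 2) ≤ x * (q - p - x) :=
      mul_le_mul hx (by linarith) (by positivity) hx0.le
    have h2 : p * q ≤ R ^ 2 := by nlinarith
    have h3 : b = t * κ * (κ / 2) / R ^ 2 := by rw [hb]; field_simp
    rw [h3]
    have : t * κ * (κ / 2) / R ^ 2 ≤ x * (q - p - x) / (p * q) :=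
      div_le_div₀ (by nlinarith) h1 (by positivity) h2
    linarith
  have h1 := Real.le_log_one_add_of_nonneg hb0
  have h2 : b / 2 ≤ 2 * b / (b + 2) := by
    rw [le_div_iff₀ (by positivity)]
    nlinarith
  have h3 : t * (κ ^ 2 / (4 * R ^ 2)) = b / 2 := by rw [hb]; field_simp; norm_num
  rw [h3]
  exact h2.trans (h1.trans (Real.log_le_log (by positivity) hprod))

/-- Increase of the logarithmic integral in a direction which is odd with respect to a reflection,
when the reflection increases the function on the half where the direction is positive. -/
theorem logInt_reflect_gain (hc : 0 < Real.cos θ) (hs : 0 < Real.sin θ) {h a : Space n → ℝ}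
    (hh : Continuous h) (ha : Continuous a) (ρ : Space n ≃ₗᵢ[ℝ] Space n)
    (hρS : ∀ ζ, ρ ζ ∈ sphereCap n θ ↔ ζ ∈ sphereCap n θ)
    (hρℓ : ∀ ζ, sphereEll θ (ρ ζ) = sphereEll θ ζ) (hρρ : ∀ ζ, ρ (ρ ζ) = ζ)
    (hρa : ∀ ζ, a (ρ ζ) = -a ζ) (hnn : ∀ ζ ∈ sphereCap n θ, 0 ≤ h ζ)
    (hsum : ∀ ζ ∈ sphereCap n θ, 0 ≤ h ζ + a ζ)
    (hle : ∀ ζ ∈ sphereCap n θ, 0 ≤ a ζ → h ζ ≤ h (ρ ζ))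
    {ζ₀ : Space n} (hζ₀ : ζ₀ ∈ sphereCap n θ) (ha₀ : 0 < a ζ₀) (hlt : h ζ₀ < h (ρ ζ₀)) :
    ∃ t κ : ℝ, 0 < t ∧ t ≤ 1 / 2 ∧ 0 < κ ∧ ∀ ε : ℝ, 0 < ε → ε ≤ 1 →
      logInt θ (fun ζ => h ζ + ε) + κ ≤ logInt θ (fun ζ => h ζ + t * a ζ + ε) := by
  have hcl := cos_lt_one_of_sin_pos hs
  obtain ⟨κ₁, hκ₁, hκ1, hκa, hκh⟩ : ∃ κ₁ : ℝ, 0 < κ₁ ∧ κ₁ ≤ 1 ∧ κ₁ < a ζ₀ ∧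
      κ₁ < h (ρ ζ₀) - h ζ₀ := by
    refine ⟨min 1 (min (a ζ₀) (h (ρ ζ₀) - h ζ₀)) / 2, ?_, ?_, ?_, ?_⟩
    · have : 0 < min 1 (min (a ζ₀) (h (ρ ζ₀) - h ζ₀)) :=
        lt_min one_pos (lt_min ha₀ (by linarith))
      linarith
    · linarith [min_le_left 1 (min (a ζ₀) (h (ρ ζ₀) - h ζ₀))]
    · have h1 := min_le_right 1 (min (a ζ₀) (h (ρ ζ₀) - h ζ₀))
      have h2 := min_le_left (a ζ₀) (h (ρ ζ₀) - h ζ₀)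
      linarith
    · have h1 := min_le_right 1 (min (a ζ₀) (h (ρ ζ₀) - h ζ₀))
      have h2 := min_le_right (a ζ₀) (h (ρ ζ₀) - h ζ₀)
      linarith
  -- On this open set both the shift and the gap between mirror values exceed `κ₁`, so the first
  -- order gain applies; elsewhere only the second order loss is controlled.
  set U : Set (Space n) := {ζ | κ₁ < a ζ} ∩ {ζ | κ₁ < h (ρ ζ) - h ζ} with hU
  have hUo : IsOpen U := (isOpen_lt continuous_const ha).inter
    (isOpen_lt continuous_const ((hh.comp ρ.continuous).sub hh))
  set μ := sphereMeasure n with hμ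
  have hPpos : 0 < μ.real (U ∩ sphereCap n θ) := by
    refine ENNReal.toReal_pos ?_ (measure_ne_top _ _)
    exact (sphereMeasure_inter_sphereCap_pos hc hcl hUo hζ₀ ⟨hκa, hκh⟩).ne'
  have hPm : MeasurableSet (U ∩ sphereCap n θ) := hUo.measurableSet.inter measurableSet_sphereCap
  obtain ⟨B, hB⟩ := isCompact_sphereCap (n := n) (θ := θ).exists_bound_of_continuousOn
    hh.continuousOn
  obtain ⟨B', hB'⟩ := isCompact_sphereCap (n := n) (θ := θ).exists_bound_of_continuousOn
    ha.continuousOn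
  set R := |B| + |B'| + 1 with hR
  have hR1 : 1 ≤ R := by rw [hR]; linarith [abs_nonneg B, abs_nonneg B']
  have hhR : ∀ ζ ∈ sphereCap n θ, h ζ + 1 ≤ R := fun ζ hζ => by
    have h1 := (le_abs_self _).trans ((hB ζ hζ).trans (le_abs_self B))
    linarith [abs_nonneg B']
  have haR : ∀ ζ ∈ sphereCap n θ, a ζ ≤ R := fun ζ hζ => by
    have h1 := (le_abs_self _).trans ((hB' ζ hζ).trans (le_abs_self B'))
    linarith [abs_nonneg B]
  set b := κ₁ ^ 2 / (4 * R ^ 2) with hb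
  have hb0 : 0 < b := by positivity
  set m := b * (1 - Real.cos θ) * μ.real (U ∩ sphereCap n θ) with hm
  have hm0 : 0 < m := mul_pos (mul_pos hb0 (by linarith)) hPpos
  set M := μ.real (sphereCap n θ) with hM
  have hM0 : 0 ≤ M := measureReal_nonneg
  -- The three bounds serve the quadratic estimate, the condition that the shift is at most half the
  -- gap on `U`, and the absorption of the loss `2 * t ^ 2 * M` into half of the gain `t * m`. None
  -- depends on `ε`.
  set t := min (1 / 2) (min (κ₁ / (2 * R)) (m / (4 * (M + 1)))) with ht
  have ht0 : 0 < t := lt_min (by norm_num) (lt_min (by positivity) (by positivity))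
  have ht2 : t ≤ 1 / 2 := min_le_left _ _
  have htR : t * R ≤ κ₁ / 2 := by
    have h1 : t ≤ κ₁ / (2 * R) := (min_le_right _ _).trans (min_le_left _ _)
    rw [le_div_iff₀ (by positivity)] at h1
    linarith
  have htM : t * (2 * M) ≤ m / 2 := by
    have h1 : t ≤ m / (4 * (M + 1)) := (min_le_right _ _).trans (min_le_right _ _)
    rw [le_div_iff₀ (by positivity)] at h1
    nlinarith
  refine ⟨t, t * m / 4, ht0, ht2, by positivity, fun ε hε hε1 => ?_⟩
  set g : Space n → ℝ := fun ζ => Real.log ((h ζ + ε + t * a ζ) / (h ζ + ε)) with hg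
  have hp1 : ∀ ζ ∈ sphereCap n θ, 0 < h ζ + ε := fun ζ hζ => by linarith [hnn ζ hζ]
  have hp2 : ∀ ζ ∈ sphereCap n θ, 0 < h ζ + ε + t * a ζ := fun ζ hζ => by
    have h1 := mul_nonneg ht0.le (hsum ζ hζ)
    have h2 := mul_nonneg (show 0 ≤ 1 - t by linarith) (hnn ζ hζ)
    linarith
  have hp2' : ∀ ζ ∈ sphereCap n θ, 0 < h ζ + t * a ζ + ε := fun ζ hζ => by linarith [hp2 ζ hζ]
  have hgc : ContinuousOn g (sphereCap n θ) := by
    refine ContinuousOn.log (ContinuousOn.div (by fun_prop) (by fun_prop)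
      fun ζ hζ => (hp1 ζ hζ).ne') fun ζ hζ => (div_pos (hp2 ζ hζ) (hp1 ζ hζ)).ne'
  have hgc' : ContinuousOn (fun ζ => g (ρ ζ)) (sphereCap n θ) :=
    hgc.comp ρ.continuous.continuousOn fun ζ hζ => (hρS ζ).2 hζ
  have hint : IntegrableOn (fun ζ => g ζ * sphereEll θ ζ) (sphereCap n θ) μ :=
    integrableOn_of_continuousOn (hgc.mul continuous_sphereEll.continuousOn)
  have hint' : IntegrableOn (fun ζ => g (ρ ζ) * sphereEll θ ζ) (sphereCap n θ) μ :=
    integrableOn_of_continuousOn (hgc'.mul continuous_sphereEll.continuousOn)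
  have hdiff : logInt θ (fun ζ => h ζ + t * a ζ + ε) - logInt θ (fun ζ => h ζ + ε) =
      ∫ ζ in sphereCap n θ, g ζ * sphereEll θ ζ ∂μ := by
    rw [logInt, logInt, ← integral_sub
      (integrableOn_logInt hc hs (by fun_prop) hp2')
      (integrableOn_logInt hc hs (by fun_prop) hp1)]
    refine setIntegral_congr_fun measurableSet_sphereCap fun ζ hζ => ?_
    have hl := sphereEll_pos hc hs hζ
    have h1 := hp1 ζ hζ
    have h2 := hp2 ζ hζ
    have h3 := hp2' ζ hζ
    simp only [hg]
    rw [Real.log_div h3.ne' hl.ne', Real.log_div h1.ne' hl.ne', Real.log_div h2.ne' h1.ne',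
      add_right_comm]
    ring
  have hrefl : ∫ ζ in sphereCap n θ, g (ρ ζ) * sphereEll θ ζ ∂μ =
      ∫ ζ in sphereCap n θ, g ζ * sphereEll θ ζ ∂μ := by
    have h1 := (measurePreserving_isometry ρ).setIntegral_preimage_emb
      ρ.toHomeomorph.measurableEmbedding (fun ζ => g ζ * sphereEll θ ζ) (sphereCap n θ)
    have h2 : ρ ⁻¹' sphereCap n θ = sphereCap n θ := by
      ext ζ; exact hρS ζ
    rw [h2] at h1
    simp only [hρℓ] at h1
    exact h1
  have hpt : ∀ ζ ∈ sphereCap n θ, 0 ≤ a ζ → -(2 * t ^ 2) ≤ g ζ + g (ρ ζ) ∧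
      (ζ ∈ U → t * b ≤ g ζ + g (ρ ζ)) := by
    intro ζ hζ haζ
    have hρζ := (hρS ζ).2 hζ
    have h1 := hsum _ hρζ
    have h2 : g (ρ ζ) = Real.log ((h (ρ ζ) + ε - t * a ζ) / (h (ρ ζ) + ε)) := by
      simp only [hg, hρa]; ring_nf
    have h3 := hle ζ hζ haζ
    rw [hρa] at h1
    rw [h2]
    refine ⟨neg_two_mul_sq_le_log_add_log (hp1 ζ hζ) (by linarith) (by positivity) ?_ ht2,
      fun hζU => ?_⟩
    · exact mul_le_mul_of_nonneg_left (by linarith) ht0.le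
    · have h4 : κ₁ < a ζ := hζU.1
      have h5 : κ₁ < h (ρ ζ) - h ζ := hζU.2
      refine mul_le_log_add_log (hp1 ζ hζ) (by linarith) (R := R) ?_ hR1 ht0 (by linarith) hκ₁
        (mul_le_mul_of_nonneg_left h4.le ht0.le) ?_
      · linarith [hhR _ hρζ]
      · have := mul_le_mul_of_nonneg_left (haR ζ hζ) ht0.le
        linarith
  have hlower : ∀ ζ ∈ sphereCap n θ,
      (U ∩ sphereCap n θ).indicator (fun _ => t * b * (1 - Real.cos θ)) ζ - 2 * t ^ 2 ≤
        (g ζ + g (ρ ζ)) * sphereEll θ ζ := by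
    intro ζ hζ
    have hl0 := le_sphereEll hc hζ
    have hl1 := sphereEll_le_one hc hζ
    have hmin : -(2 * t ^ 2) ≤ g ζ + g (ρ ζ) := by
      rcases le_total 0 (a ζ) with h0 | h0
      · exact (hpt ζ hζ h0).1
      · have := (hpt (ρ ζ) ((hρS ζ).2 hζ) (by rw [hρa]; linarith)).1
        rw [hρρ] at this; linarith
    by_cases hζU : ζ ∈ U
    · rw [indicator_of_mem (show ζ ∈ U ∩ sphereCap n θ from ⟨hζU, hζ⟩)]
      have h4 : κ₁ < a ζ := hζU.1
      have h5 := (hpt ζ hζ (by linarith)).2 hζU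
      have h6 : t * b * (1 - Real.cos θ) ≤ (g ζ + g (ρ ζ)) * sphereEll θ ζ :=
        mul_le_mul h5 hl0 (by linarith) ((mul_pos ht0 hb0).le.trans h5)
      nlinarith [sq_nonneg t]
    · rw [indicator_of_notMem (fun h => hζU h.1)]
      nlinarith [sq_nonneg t]
  have hsumint : t * m - 2 * t ^ 2 * M ≤
      ∫ ζ in sphereCap n θ, (g ζ + g (ρ ζ)) * sphereEll θ ζ ∂μ := by
    have hi1 : IntegrableOn ((U ∩ sphereCap n θ).indicator
        fun _ : Space n => t * b * (1 - Real.cos θ)) (sphereCap n θ) μ :=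
      (integrable_const _).indicator hPm
    have h1 : ∫ ζ in sphereCap n θ, ((U ∩ sphereCap n θ).indicator
        (fun _ => t * b * (1 - Real.cos θ)) ζ - 2 * t ^ 2) ∂μ = t * m - 2 * t ^ 2 * M := by
      rw [integral_sub hi1 (integrable_const _), setIntegral_indicator hPm, setIntegral_const,
        setIntegral_const, inter_eq_right.2 inter_subset_right, smul_eq_mul, smul_eq_mul]
      rw [hm, hM]; ring
    rw [← h1]
    refine setIntegral_mono_on (hi1.sub (integrable_const _)) ?_ measurableSet_sphereCap hlower
    simp only [add_mul]
    exact hint.add hint'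
  -- By reflection invariance the integral of the paired sum is twice the increase, whence the
  -- quarter in the constant `t * m / 4`.
  simp only [add_mul] at hsumint
  rw [integral_add hint hint', hrefl, ← hdiff] at hsumint
  nlinarith

/-- The reflection across the orthogonal complement of `v`. -/
def mirror (v : Space n) : Space n ≃ₗᵢ[ℝ] Space n := (ℝ ∙ v)ᗮ.reflection

theorem mirror_apply (v ζ : Space n) :
    mirror v ζ = ζ - (2 * (inner ℝ v ζ / ‖v‖ ^ 2)) • v := by
  rw [mirror, Submodule.reflection_orthogonal_apply, Submodule.reflection_singleton_apply, two_smul,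
    ← add_smul, ← two_mul]
  simp

theorem mirror_mirror (v ζ : Space n) : mirror v (mirror v ζ) = ζ :=
  Submodule.reflection_reflection _ ζ

theorem height_mirror {v : Space n} (hv : height v = 0) (ζ : Space n) :
    height (mirror v ζ) = height ζ := by
  simp [mirror_apply, hv]

theorem inner_mirror {v : Space n} (hv : v ≠ 0) (ζ : Space n) :
    inner ℝ v (mirror v ζ) = -inner ℝ v ζ := by
  have : 0 < ‖v‖ := norm_pos_iff.2 hv
  rw [mirror_apply, inner_sub_right, inner_smul_right, real_inner_self_eq_norm_sq]
  field_simp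
  ring

theorem mirror_mem_sphereCap {v : Space n} (hv : height v = 0) (ζ : Space n) :
    mirror v ζ ∈ sphereCap n θ ↔ ζ ∈ sphereCap n θ := by
  rw [mem_sphereCap, mem_sphereCap, height_mirror hv, LinearIsometryEquiv.norm_map]

namespace IsConeBody

variable {L : Set (Space n)}

/-- At a relative boundary point `z` of the flat part there is an inner normal `v` which points
into the interior of the flat part. -/
theorem exists_inward_normal (hL : IsConeBody θ L) (hc : 0 < Real.cos θ) (hs : 0 < Real.sin θ)
    {z ζ₀ : Space n} (hz : z ∈ L) (h0 : height z = 0) (hζ₀ : ζ₀ ∈ sphereCap n θ)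
    (hz0 : support L z ζ₀ ≤ 0) :
    ∃ v : Space n, height v = 0 ∧ v ≠ 0 ∧ (∀ y ∈ L, 0 ≤ inner ℝ v (y - z)) ∧
      ∃ δ > 0, ∀ ζ ∈ sphereCap n θ, δ ≤ support L z ζ - inner ℝ v ζ := by
  obtain ⟨p, hp⟩ := hL.flatInterior_nonempty hc hs
  obtain ⟨r, hr, hrp⟩ := hL.exists_le_support hc hp
  set N := sphereCap n θ ∩ {ζ | support L z ζ ≤ 0} with hN
  set W : Set (Space n) := {v | height v = 0 ∧ ∀ ζ ∈ N, inner ℝ v ζ ≤ -1} with hW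
  have hWne : W.Nonempty := by
    refine ⟨r⁻¹ • (p - z), by simp [h0, hp.1], fun ζ hζ => ?_⟩
    have h1 := hrp ζ hζ.1
    rw [support_eq_sub hL.isCompact hL.nonempty p z] at h1
    have h2 : support L z ζ ≤ 0 := hζ.2
    rw [inner_smul_left, conj_trivial, inv_mul_le_iff₀ hr]
    linarith
  have hWc : IsClosed W := by
    have : W = {v | height v = 0} ∩ ⋂ ζ ∈ N, {v : Space n | inner ℝ v ζ ≤ -1} := by
      ext v; simp [hW]
    rw [this]
    exact (isClosed_eq continuous_height continuous_const).inter
      (isClosed_biInter fun ζ _ => isClosed_le (by fun_prop) continuous_const)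
  have hWconv : Convex ℝ W := by
    rintro x ⟨hx, hx'⟩ y ⟨hy, hy'⟩ a b ha hb hab
    refine ⟨by simp [hx, hy], fun ζ hζ => ?_⟩
    rw [inner_add_left, inner_smul_left, inner_smul_left, conj_trivial, conj_trivial]
    nlinarith [hx' ζ hζ, hy' ζ hζ]
  obtain ⟨v, hv, hmin⟩ := exists_norm_eq_iInf_of_complete_convex hWne hWc.isComplete hWconv 0
  have hproj := (norm_eq_iInf_iff_real_inner_le_zero hWconv hv).1 hmin
  have hvne : v ≠ 0 := by
    rintro rfl
    have := hv.2 ζ₀ ⟨hζ₀, hz0⟩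
    rw [inner_zero_left] at this
    linarith
  have hvn : 0 < ‖v‖ := norm_pos_iff.2 hvne
  have hinner : ∀ y ∈ L, 0 ≤ inner ℝ v (y - z) := by
    intro y hy
    -- Adding a direction into the flat part keeps a vector in `W`, so minimality of the norm yields
    -- `⟨v, foot y - z⟩ ≥ 0`.
    have hmem : v + (foot y - z) ∈ W := by
      refine ⟨by simp [hv.1, h0], fun ζ hζ => ?_⟩
      have h1 := inner_le_support hL.isCompact (hL.foot_mem hc hy) z ζ
      have h2 : support L z ζ ≤ 0 := hζ.2
      rw [inner_add_left]
      linarith [hv.2 ζ hζ]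
    have h1 := hproj _ hmem
    rw [zero_sub, add_sub_cancel_left, inner_neg_left, inner_sub_right,
      inner_foot_right_of_height_eq_zero y hv.1] at h1
    rw [inner_sub_right]
    linarith
  -- Where `⟨v, ζ⟩ ≥ -1/2` there are no elements of `N`, so by compactness the support function has
  -- a positive minimum `b`, which dominates a small multiple of `v`; elsewhere that multiple itself
  -- contributes positively.
  have hcomp : IsCompact (sphereCap n θ ∩ {ζ | -(1 / 2) ≤ inner ℝ v ζ}) :=
    isCompact_sphereCap.inter_right (isClosed_le continuous_const (by fun_prop))
  obtain ⟨b, hb, hbB⟩ : ∃ b > 0, ∀ ζ ∈ sphereCap n θ ∩ {ζ | -(1 / 2) ≤ inner ℝ v ζ},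
      b ≤ support L z ζ := by
    rcases (sphereCap n θ ∩ {ζ | -(1 / 2) ≤ inner ℝ v ζ}).eq_empty_or_nonempty with he | hne
    · exact ⟨1, one_pos, fun ζ hζ => absurd hζ (by rw [he]; exact notMem_empty ζ)⟩
    · obtain ⟨ξ, hξ, hξmin⟩ := hcomp.exists_isMinOn hne
        (continuous_support hL.isCompact z).continuousOn
      refine ⟨support L z ξ, ?_, fun ζ hζ => hξmin hζ⟩
      by_contra! hcon
      have h1 := hv.2 ξ ⟨hξ.1, hcon⟩
      have h2 : -(1 / 2) ≤ inner ℝ v ξ := hξ.2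
      linarith
  set t := b / (2 * (‖v‖ + 1)) with ht
  have ht0 : 0 < t := by positivity
  have htb : t * ‖v‖ ≤ b / 2 := by
    have : t * (‖v‖ + 1) = b / 2 := by rw [ht]; field_simp
    nlinarith
  refine ⟨t • v, by simp [hv.1], smul_ne_zero ht0.ne' hvne, fun y hy => ?_, min (t / 2) (b / 2),
    lt_min (by positivity) (by positivity), fun ζ hζ => ?_⟩
  · rw [inner_smul_left, conj_trivial]
    exact mul_nonneg ht0.le (hinner y hy)
  · rw [inner_smul_left, conj_trivial]
    by_cases hvζ : -(1 / 2) ≤ inner ℝ v ζ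
    · have h1 := hbB ζ ⟨hζ, hvζ⟩
      have h2 := real_inner_le_norm v ζ
      rw [(mem_sphereCap.1 hζ).1, mul_one] at h2
      have h3 := mul_le_mul_of_nonneg_left h2 ht0.le
      linarith [min_le_right (t / 2) (b / 2)]
    · have h1 := support_nonneg hL.isCompact hz ζ
      have h2 : t * inner ℝ v ζ ≤ t * (-(1 / 2)) :=
        mul_le_mul_of_nonneg_left (not_le.1 hvζ).le ht0.le
      linarith [min_le_left (t / 2) (b / 2)]

/-- Relative boundary points of the flat part do not maximize the logarithmic integral, even
approximately. -/
theorem exists_logInt_gain (hL : IsConeBody θ L) (hc : 0 < Real.cos θ) (hs : 0 < Real.sin θ)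
    {z ζ₀ : Space n} (hz : z ∈ L) (h0 : height z = 0) (hζ₀ : ζ₀ ∈ sphereCap n θ)
    (hz0 : support L z ζ₀ ≤ 0) :
    ∃ w ∈ flatInterior L, ∃ κ > 0, ∀ ε : ℝ, 0 < ε → ε ≤ 1 →
      logInt θ (fun ζ => support L z ζ + ε) + κ ≤ logInt θ (fun ζ => support L w ζ + ε) := by
  obtain ⟨v, hv0, hvne, hvL, δ, hδ, hδL⟩ := hL.exists_inward_normal hc hs hz h0 hζ₀ hz0
  have hnn : ∀ ζ ∈ sphereCap n θ, 0 ≤ support L z ζ := fun ζ _ => support_nonneg hL.isCompact hz ζ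
  have hmir : ∀ ζ ∈ sphereCap n θ, 0 ≤ -inner ℝ v ζ →
      support L z ζ ≤ support L z (mirror v ζ) := fun ζ _ hζ => by
    refine support_le_of_forall hL.isCompact hL.nonempty fun y hy => ?_
    have h1 := inner_le_support hL.isCompact hy z (mirror v ζ)
    have e : inner ℝ (y - z) (mirror v ζ) =
        inner ℝ (y - z) ζ - 2 * (inner ℝ v ζ / ‖v‖ ^ 2) * inner ℝ v (y - z) := by
      rw [mirror_apply, inner_sub_right, inner_smul_right, real_inner_comm v]
    rw [e] at h1
    have h2 := hvL y hy
    have h3 : 2 * (inner ℝ v ζ / ‖v‖ ^ 2) ≤ 0 := by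
      have := div_nonneg hζ (sq_nonneg ‖v‖)
      rw [neg_div] at this
      linarith
    have h4 := mul_nonpos_of_nonpos_of_nonneg h3 h2
    linarith
  have ha₀ : δ ≤ -inner ℝ v ζ₀ := by linarith [hδL ζ₀ hζ₀]
  have hmem₀ := (mirror_mem_sphereCap (θ := θ) hv0 ζ₀).2 hζ₀
  -- At `ζ₀` the support function is at most 0, and at its mirror image it is at least `δ - ⟨v, ζ₀⟩
  -- > 0`; this is the required strict inequality.
  obtain ⟨t, κ, ht0, ht2, hκ, hgain⟩ := logInt_reflect_gain hc hs
    (h := support L z) (a := fun ζ => -inner ℝ v ζ) (continuous_support hL.isCompact z)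
    (by fun_prop) (mirror v) (mirror_mem_sphereCap hv0)
    (fun ζ => by rw [sphereEll_eq, sphereEll_eq, height_mirror hv0]) (mirror_mirror v)
    (fun ζ => by rw [inner_mirror hvne]) hnn (fun ζ hζ => by linarith [hδL ζ hζ]) hmir hζ₀
    (by linarith) (by
      have := hδL _ hmem₀
      rw [inner_mirror hvne] at this
      linarith)
  have hw : ∀ ζ, support L (z + t • v) ζ = support L z ζ + t * -inner ℝ v ζ := fun ζ => by
    rw [support_eq_sub hL.isCompact hL.nonempty _ z, add_sub_cancel_left, inner_smul_left,
      conj_trivial]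
    ring
  refine ⟨z + t • v, hL.mem_flatInterior hc hs (by simp [h0, hv0]) (mul_pos ht0 hδ)
    fun ζ hζ => ?_, κ, hκ, fun ε hε hε1 => ?_⟩
  · rw [hw]
    have h1 := mul_le_mul_of_nonneg_left (hδL ζ hζ) ht0.le
    have h2 := mul_nonneg (show 0 ≤ 1 - t by linarith) (hnn ζ hζ)
    nlinarith
  · simp only [hw]
    exact hgain ε hε hε1

/-- Points which almost maximize the entropy stay away from the relative boundary of the flat
part. -/
theorem exists_le_support_of_almost_max (hL : IsConeBody θ L) (hc : 0 < Real.cos θ)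
    (hs : 0 < Real.sin θ) : ∃ η > 0, ∃ δ > 0, ∀ w ∈ flatInterior L,
      capillaryArea n θ * genEntropy θ L - η ≤ logInt θ (support L w) →
        ∀ ζ ∈ sphereCap n θ, δ ≤ support L w ζ := by
  by_contra! hcon
  have hseq : ∀ k : ℕ, ∃ q : Space n × Space n, q.1 ∈ flatInterior L ∧ q.2 ∈ sphereCap n θ ∧
      capillaryArea n θ * genEntropy θ L - 1 / ((k : ℝ) + 1) ≤ logInt θ (support L q.1) ∧
      support L q.1 q.2 < 1 / ((k : ℝ) + 1) := fun k => by
    obtain ⟨w, hw, h1, ζ, hζ, h2⟩ := hcon (1 / ((k : ℝ) + 1)) Nat.one_div_pos_of_nat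
      (1 / ((k : ℝ) + 1)) Nat.one_div_pos_of_nat
    exact ⟨(w, ζ), hw, hζ, h1, h2⟩
  choose q hq1 hq2 hq3 hq4 using hseq
  have hqL : ∀ k, (q k).1 ∈ L := fun k =>
    mem_of_mem_flatPart hL.isCompact (mem_flatPart_of_mem_flatInterior (hq1 k))
  obtain ⟨⟨z, ζ₀⟩, hz, φ, hφ, hlim⟩ := (hL.isCompact.prod isCompact_sphereCap).tendsto_subseq
    (x := q) fun k => ⟨hqL k, hq2 k⟩
  have hlim1 : Tendsto (fun k => (q (φ k)).1) atTop (𝓝 z) :=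
    (continuous_fst.tendsto _).comp hlim
  have hone : Tendsto (fun k => 1 / ((φ k : ℝ) + 1)) atTop (𝓝 0) :=
    tendsto_one_div_add_atTop_nhds_zero_nat.comp hφ.tendsto_atTop
  have hz0 : height z = 0 := by
    refine tendsto_nhds_unique ((continuous_height.tendsto z).comp hlim1) ?_
    refine tendsto_const_nhds.congr fun k => ?_
    exact (hq1 (φ k)).1.symm
  have hsupp : support L z ζ₀ ≤ 0 := by
    have hcont : Continuous (fun p : Space n × Space n => support L 0 p.2 - inner ℝ p.1 p.2) :=
      ((continuous_support hL.isCompact 0).comp continuous_snd).sub (by fun_prop)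
    have h1 : Tendsto (fun k => support L (q (φ k)).1 (q (φ k)).2) atTop
        (𝓝 (support L 0 ζ₀ - inner ℝ z ζ₀)) := by
      refine ((hcont.tendsto (z, ζ₀)).comp hlim).congr fun k => ?_
      simp only [Function.comp]
      rw [support_eq_sub hL.isCompact hL.nonempty (q (φ k)).1 0, sub_zero]
    rw [support_eq_sub hL.isCompact hL.nonempty z 0, sub_zero]
    exact le_of_tendsto_of_tendsto' h1 hone fun k => (hq4 (φ k)).le
  obtain ⟨w, hw, κ, hκ, hgain⟩ := hL.exists_logInt_gain hc hs hz.1 hz0 hz.2 hsupp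
  obtain ⟨δ, hδ, hδw⟩ := hL.exists_le_support hc hw
  have hM := ellMass_nonneg (n := n) hc hs
  set M := ellMass n θ with hMdef
  -- The shift by `ε` avoids integrating a logarithm that may be singular at the limit point `z`. It
  -- costs at most `ε / δ * M` at `w`, less than the gain `κ`.
  obtain ⟨ε, hε, hε1, hεM⟩ : ∃ ε : ℝ, 0 < ε ∧ ε ≤ 1 ∧ ε / δ * M < κ := by
    refine ⟨min 1 (κ * δ / (2 * (M + 1))), lt_min one_pos (by positivity), min_le_left _ _, ?_⟩
    have h1 : min 1 (κ * δ / (2 * (M + 1))) ≤ κ * δ / (2 * (M + 1)) := min_le_right _ _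
    rw [le_div_iff₀ (by positivity)] at h1
    have h2 : 0 < min 1 (κ * δ / (2 * (M + 1))) := lt_min one_pos (by positivity)
    rw [div_mul_eq_mul_div, div_lt_iff₀ hδ]
    have := mul_pos hκ hδ
    nlinarith
  have hpos : ∀ x ∈ L, ∀ ζ ∈ sphereCap n θ, 0 < support L x ζ + ε := fun x hx ζ _ => by
    linarith [support_nonneg hL.isCompact hx ζ]
  have hlow : capillaryArea n θ * genEntropy θ L ≤ logInt θ (fun ζ => support L z ζ + ε) := by
    have h1 : Tendsto (fun k => capillaryArea n θ * genEntropy θ L - 1 / ((φ k : ℝ) + 1)) atTop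
        (𝓝 (capillaryArea n θ * genEntropy θ L)) := by
      simpa using tendsto_const_nhds.sub hone
    refine le_of_tendsto h1 ?_
    filter_upwards [hlim1.eventually (Metric.ball_mem_nhds z hε)] with k hk
    refine (hq3 (φ k)).trans (logInt_mono hc hs (hL.continuousOn_support _)
      ((hL.continuousOn_support z).add continuousOn_const)
      (fun ζ hζ => hL.support_pos hc (hq1 _) hζ) fun ζ hζ => ?_)
    have h2 := support_le_add_norm hL.isCompact hL.nonempty (q (φ k)).1 z (mem_sphereCap.1 hζ).1
    have hk' : ‖(q (φ k)).1 - z‖ < ε := by rw [← dist_eq_norm]; exact hk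
    linarith
  have hup : logInt θ (fun ζ => support L w ζ + ε) ≤
      ε / δ * M + capillaryArea n θ * genEntropy θ L := by
    have hwL := mem_of_mem_flatPart hL.isCompact (mem_flatPart_of_mem_flatInterior hw)
    have h1 : 0 < 1 + ε / δ := by positivity
    have h2 := logInt_le_of_le_mul hc hs (h := fun ζ => support L w ζ + ε) ((hL.continuousOn_support w).add continuousOn_const)
      (hL.continuousOn_support w) h1 (hpos w hwL) fun ζ hζ => by
        have h3 := hδw ζ hζ
        have h4 : ε ≤ ε / δ * support L w ζ := by
          rw [div_mul_eq_mul_div, le_div_iff₀ hδ]; nlinarith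
        linarith
    have h5 := Real.log_le_sub_one_of_pos h1
    have h6 := hL.logInt_le hc hs hw
    have h7 : Real.log (1 + ε / δ) * M ≤ ε / δ * M := mul_le_mul_of_nonneg_right (by linarith) hM
    linarith
  linarith [hgain ε hε hε1]

end IsConeBody


/-! ### Existence and uniqueness of the maximum point -/

/-- A point lies on a hyperplane through 0. Finding a nonzero normal to `γ` takes a second
coordinate, hence `n ≥ 1`: for `n = 0` the sphere consists of two atoms. -/
theorem sphereMeasure_singleton (hn : 1 ≤ n) (γ : Space n) : sphereMeasure n {γ} = 0 := by
  have hne : (0 : Fin (n + 1)) ≠ Fin.last n := by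
    intro h
    have := congrArg Fin.val h
    simp at this
    omega
  by_cases hγ : height γ = 0
  · refine measure_mono_null ?_ (sphereMeasure_hyperplane (v := lastVec n) ?_)
    · rintro _ rfl
      simpa [lastVec_inner] using hγ
    · intro h
      have := norm_lastVec (n := n)
      rw [h, norm_zero] at this
      exact zero_ne_one this
  · set v : Space n := EuclideanSpace.single 0 (γ (Fin.last n)) -
      EuclideanSpace.single (Fin.last n) (γ 0) with hv
    refine measure_mono_null ?_ (sphereMeasure_hyperplane (v := v) ?_)
    · rintro _ rfl
      simp [hv, inner_sub_left, EuclideanSpace.inner_single_left, mul_comm]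
    · intro h
      have : v 0 = 0 := by rw [h]; rfl
      simp [hv, hne] at this
      exact hγ this

theorem sphereMeasure_sphereCap_pos (hc : 0 < Real.cos θ) (hs : 0 < Real.sin θ) :
    0 < sphereMeasure n (sphereCap n θ) := by
  have := sphereMeasure_inter_sphereCap_pos hc (cos_lt_one_of_sin_pos hs) isOpen_univ
    (lastVec_mem_sphereCap (n := n)) (mem_univ _)
  rwa [univ_inter] at this

theorem ellMass_pos (hc : 0 < Real.cos θ) (hs : 0 < Real.sin θ) : 0 < ellMass n θ := by
  have hcl := cos_lt_one_of_sin_pos hs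
  have h1 : ∫ ζ in sphereCap n θ, (1 - Real.cos θ) ∂(sphereMeasure n) ≤ ellMass n θ :=
    setIntegral_mono_on (integrable_const _)
      (integrableOn_of_continuousOn continuous_sphereEll.continuousOn) measurableSet_sphereCap
      fun ζ hζ => le_sphereEll hc hζ
  refine lt_of_lt_of_le ?_ h1
  rw [setIntegral_const, smul_eq_mul]
  exact mul_pos (ENNReal.toReal_pos (sphereMeasure_sphereCap_pos hc hs).ne' (measure_ne_top _ _))
    (by linarith)

namespace IsConeBody

variable {K L : Set (Space n)}

/-- The entropy is attained at a relative interior point of the flat part. -/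
theorem exists_max (hL : IsConeBody θ L) (hc : 0 < Real.cos θ) (hs : 0 < Real.sin θ) :
    ∃ z ∈ flatInterior L, logInt θ (support L z) = capillaryArea n θ * genEntropy θ L := by
  obtain ⟨η, hη, δ, hδ, hT⟩ := hL.exists_le_support_of_almost_max hc hs
  have hω := capillaryArea_pos (n := n) hc hs
  set F := capillaryArea n θ * genEntropy θ L with hF
  -- Almost maximal points lie in `T`, which is compact, and on `T` the logarithmic integral is
  -- Lipschitz because the support functions are bounded below by `δ`.
  set T : Set (Space n) := {z | height z = 0 ∧ ∀ ζ ∈ sphereCap n θ, δ ≤ support L z ζ} with hTdef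
  have hTflat : T ⊆ flatInterior L := fun z hz => hL.mem_flatInterior hc hs hz.1 hδ hz.2
  have hTc : IsCompact T := by
    refine hL.isCompact.of_isClosed_subset ?_ fun z hz =>
      hL.mem_of_support_nonneg hc hs hz.1 fun ζ hζ => hδ.le.trans (hz.2 ζ hζ)
    have : T = {z | height z = 0} ∩
        ⋂ ζ ∈ sphereCap n θ, {z : Space n | δ ≤ support L 0 ζ - inner ℝ z ζ} := by
      ext z
      simp only [hTdef, mem_ofPred_eq, mem_inter_iff, mem_iInter]
      refine and_congr_right fun _ => forall₂_congr fun ζ _ => ?_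
      rw [support_eq_sub hL.isCompact hL.nonempty z 0, sub_zero]
    rw [this]
    exact (isClosed_eq continuous_height continuous_const).inter
      (isClosed_biInter fun ζ _ => isClosed_le continuous_const (by fun_prop))
  have hM := ellMass_nonneg (n := n) hc hs
  have hcont : ContinuousOn (fun z => logInt θ (support L z)) T := by
    refine (LipschitzOnWith.of_le_add_mul (K := (⟨ellMass n θ / δ, by positivity⟩ : NNReal))
      fun z hz w hw => ?_).continuousOn
    have h1 : 0 < 1 + ‖z - w‖ / δ := by positivity
    have h2 := logInt_le_of_le_mul hc hs (hL.continuousOn_support z) (hL.continuousOn_support w) h1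
      (fun ζ hζ => hδ.trans_le (hz.2 ζ hζ)) fun ζ hζ => by
        have h3 := support_le_add_norm hL.isCompact hL.nonempty z w (mem_sphereCap.1 hζ).1
        have h4 : ‖z - w‖ ≤ ‖z - w‖ / δ * support L w ζ := by
          rw [div_mul_eq_mul_div, le_div_iff₀ hδ]
          exact mul_le_mul_of_nonneg_left (hw.2 ζ hζ) (norm_nonneg _)
        linarith
    have h5 := Real.log_le_sub_one_of_pos h1
    have h6 : Real.log (1 + ‖z - w‖ / δ) * ellMass n θ ≤ ‖z - w‖ / δ * ellMass n θ :=
      mul_le_mul_of_nonneg_right (by linarith) hM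
    change logInt θ (support L z) ≤ logInt θ (support L w) + ellMass n θ / δ * dist z w
    rw [dist_eq_norm, div_mul_eq_mul_div, mul_comm (ellMass n θ), ← div_mul_eq_mul_div]
    linarith
  obtain ⟨z₁, hz₁, hz₁F⟩ : ∃ z₁ ∈ flatInterior L, F - η < logInt θ (support L z₁) := by
    have h1 : genEntropy θ L - η / capillaryArea n θ < genEntropy θ L := by
      linarith [div_pos hη hω]
    rw [genEntropy_eq] at h1
    obtain ⟨_, ⟨z, hz, rfl⟩, hlt⟩ := exists_lt_of_lt_csSup
      ((hL.flatInterior_nonempty hc hs).image _) h1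
    refine ⟨z, hz, ?_⟩
    rw [← genEntropy_eq, genEntropyAt_eq, one_div, inv_mul_eq_div, lt_div_iff₀ hω, sub_mul] at hlt
    have : η / capillaryArea n θ * capillaryArea n θ = η := by field_simp
    rw [hF]
    linarith
  have hz₁T : z₁ ∈ T := ⟨hz₁.1, hT z₁ hz₁ hz₁F.le⟩
  obtain ⟨z, hz, hmax⟩ := hTc.exists_isMaxOn ⟨z₁, hz₁T⟩ hcont
  refine ⟨z, hTflat hz, le_antisymm (hL.logInt_le hc hs (hTflat hz)) ?_⟩
  have hall : ∀ w ∈ flatInterior L, logInt θ (support L w) ≤ logInt θ (support L z) := by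
    intro w hw
    by_cases h : F - η ≤ logInt θ (support L w)
    · exact hmax ⟨hw.1, hT w hw h⟩
    · exact ((not_le.1 h).le.trans hz₁F.le).trans (hmax hz₁T)
  have hle : genEntropy θ L ≤ 1 / capillaryArea n θ * logInt θ (support L z) := by
    rw [genEntropy_eq]
    refine csSup_le ((hL.flatInterior_nonempty hc hs).image _) ?_
    rintro _ ⟨w, hw, rfl⟩
    rw [genEntropyAt_eq]
    exact mul_le_mul_of_nonneg_left (hall w hw) (by positivity)
  rw [one_div, inv_mul_eq_div, le_div_iff₀ hω] at hle
  rw [hF]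
  linarith

/-- Strict concavity: the maximum point of the entropy is unique. -/
theorem eq_of_isMax (hn : 1 ≤ n) (hK : IsConeBody θ K) (hc : 0 < Real.cos θ) (hs : 0 < Real.sin θ)
    {z w : Space n} (hz : z ∈ flatInterior K)
    (hzF : logInt θ (support K z) = capillaryArea n θ * genEntropy θ K)
    (hw : w ∈ K) (hw0 : height w = 0)
    (hint : IntegrableOn (genIntegrand θ K w) (sphereCap n θ) (sphereMeasure n))
    (hwF : logInt θ (support K w) = capillaryArea n θ * genEntropy θ K)
    {γ : Space n} (hγ : ∀ ζ ∈ sphereCap n θ, support K w ζ ≤ 0 → ζ = γ) : w = z := by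
  by_contra hne
  set p := (1 / 2 : ℝ) • (z + w) with hp
  have hsupp : ∀ ζ, support K p ζ = (1 / 2 : ℝ) • support K z ζ + (1 / 2 : ℝ) • support K w ζ := by
    intro ζ
    rw [support_eq_sub hK.isCompact hK.nonempty p 0, support_eq_sub hK.isCompact hK.nonempty z 0,
      support_eq_sub hK.isCompact hK.nonempty w 0]
    simp only [hp, sub_zero, inner_smul_left, inner_add_left, smul_eq_mul, conj_trivial]
    ring
  have hzpos := fun ζ (hζ : ζ ∈ sphereCap n θ) => hK.support_pos hc hz hζ
  have hwnn := fun ζ => support_nonneg hK.isCompact hw ζ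
  have hppos : ∀ ζ ∈ sphereCap n θ, 0 < support K p ζ := fun ζ hζ => by
    rw [hsupp, smul_eq_mul, smul_eq_mul]; linarith [hzpos ζ hζ, hwnn ζ]
  have hpflat : p ∈ flatInterior K :=
    hK.mem_flatInterior_of_pos hc hs (by simp [hp, hz.1, hw0]) hppos
  have hpF := hK.logInt_le hc hs hpflat
  have hip := integrableOn_logInt hc hs (hK.continuousOn_support p) hppos
  have hiz := integrableOn_logInt hc hs (hK.continuousOn_support z) hzpos
  have hiw : IntegrableOn (fun ζ => Real.log (support K w ζ / sphereEll θ ζ) * sphereEll θ ζ)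
    (sphereCap n θ) (sphereMeasure n) := hint
  -- The concavity defect at the midpoint: its integral is at most 0, since `z` and `w` both attain
  -- the supremum, but it is positive almost everywhere.
  set D : Space n → ℝ := fun ζ => Real.log (support K p ζ / sphereEll θ ζ) * sphereEll θ ζ -
    ((1 / 2) * (Real.log (support K z ζ / sphereEll θ ζ) * sphereEll θ ζ) +
      (1 / 2) * (Real.log (support K w ζ / sphereEll θ ζ) * sphereEll θ ζ)) with hD
  have hsum : IntegrableOn (fun ζ =>
      (1 / 2) * (Real.log (support K z ζ / sphereEll θ ζ) * sphereEll θ ζ) +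
      (1 / 2) * (Real.log (support K w ζ / sphereEll θ ζ) * sphereEll θ ζ)) (sphereCap n θ)
      (sphereMeasure n) := (hiz.const_mul _).add (hiw.const_mul _)
  have hDint : IntegrableOn D (sphereCap n θ) (sphereMeasure n) := hip.sub hsum
  have hDval : ∫ ζ in sphereCap n θ, D ζ ∂(sphereMeasure n) ≤ 0 := by
    have h1 : ∫ ζ in sphereCap n θ, D ζ ∂(sphereMeasure n) = logInt θ (support K p) -
        ((1 / 2) * logInt θ (support K z) + (1 / 2) * logInt θ (support K w)) := by
      simp only [hD]
      rw [integral_sub hip hsum,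
        integral_add (hiz.const_mul _) (hiw.const_mul _), integral_const_mul, integral_const_mul]
      rfl
    rw [h1, hzF, hwF]
    linarith
  have hDpos : ∀ᵐ ζ ∂(sphereMeasure n).restrict (sphereCap n θ), 0 < D ζ := by
    rw [ae_restrict_iff' measurableSet_sphereCap]
    have h1 : ∀ᵐ ζ ∂sphereMeasure n, ζ ≠ γ := by
      rw [ae_iff]
      simpa using sphereMeasure_singleton hn γ
    have h2 : ∀ᵐ ζ ∂sphereMeasure n, inner ℝ (w - z) ζ ≠ 0 := by
      rw [ae_iff]
      simpa using sphereMeasure_hyperplane (sub_ne_zero.2 hne)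
    filter_upwards [h1, h2] with ζ hζ1 hζ2 hζ
    have hl := sphereEll_pos hc hs hζ
    have hz' := hzpos ζ hζ
    -- Positivity almost everywhere is what `hγ` provides. At a zero the convention `log 0 = 0`
    -- would invalidate the concavity inequality.
    have hw' : 0 < support K w ζ := by
      by_contra! hcon
      exact hζ1 (hγ ζ hζ hcon)
    have hzw : support K z ζ ≠ support K w ζ := by
      rw [support_eq_sub hK.isCompact hK.nonempty w z]
      intro h
      exact hζ2 (by linarith)
    have hlog := strictConcaveOn_log_Ioi.2 (show support K z ζ ∈ Ioi 0 from hz')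
      (show support K w ζ ∈ Ioi 0 from hw') hzw (show (0 : ℝ) < 1 / 2 by norm_num)
      (show (0 : ℝ) < 1 / 2 by norm_num) (by norm_num)
    rw [← hsupp, smul_eq_mul, smul_eq_mul] at hlog
    simp only [hD]
    rw [Real.log_div (hppos ζ hζ).ne' hl.ne', Real.log_div hz'.ne' hl.ne',
      Real.log_div hw'.ne' hl.ne']
    nlinarith
  have hD0 : ∫ ζ in sphereCap n θ, D ζ ∂(sphereMeasure n) = 0 :=
    le_antisymm hDval (integral_nonneg_of_ae (hDpos.mono fun ζ h => h.le))
  rw [integral_eq_zero_iff_of_nonneg_ae (hDpos.mono fun ζ h => h.le) hDint] at hD0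
  have hfalse : ∀ᵐ ζ ∂(sphereMeasure n).restrict (sphereCap n θ), False := by
    filter_upwards [hD0, hDpos] with ζ h1 h2
    rw [h1] at h2
    exact lt_irrefl _ h2
  rw [Filter.eventually_false_iff_eq_bot, ae_eq_bot, Measure.restrict_eq_zero] at hfalse
  exact (sphereMeasure_sphereCap_pos hc hs).ne' hfalse

/-! ### Distance to the surface and stability of maximum points -/

/-- Boundary points in the open half-space have an outward normal in the spherical cap. -/
theorem exists_normal_mem_sphereCap (hK : IsConeBody θ K) (hc : 0 < Real.cos θ)
    (hs : 0 < Real.sin θ) {y : Space n} (hy : y ∈ upperPart K) :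
    ∃ ζ ∈ sphereCap n θ, ∀ x ∈ K, inner ℝ (x - y) ζ ≤ 0 := by
  obtain ⟨f, hf⟩ := geometric_hahn_banach_open_point hK.convex.interior isOpen_interior hy.1.2
  have hyK : y ∈ K := hK.isCompact.isClosed.closure_subset hy.1.1
  set g : Space n := (InnerProductSpace.toDual ℝ (Space n)).symm f with hg
  have hgf : ∀ x, inner ℝ g x = f x := fun x => InnerProductSpace.toDual_symm_apply
  have hgK : ∀ x ∈ K, inner ℝ g (x - y) ≤ 0 := by
    intro x hx
    have hcl : x ∈ closure (interior K) := by
      rw [hK.convex.closure_interior_eq_closure_of_nonempty_interior hK.interior_nonempty]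
      exact subset_closure hx
    have hsub : closure (interior K) ⊆ {x | f x ≤ f y} :=
      closure_minimal (fun a ha => (hf a ha).le) (isClosed_le f.continuous continuous_const)
    rw [inner_sub_right, hgf, hgf]
    linarith [show f x ≤ f y from hsub hcl]
  have hgn : 0 < ‖g‖ := by
    obtain ⟨a, ha⟩ := hK.interior_nonempty
    rw [norm_pos_iff]
    intro h
    have h1 := hf a ha
    rw [← hgf, ← hgf, h, inner_zero_left, inner_zero_left] at h1
    exact lt_irrefl _ h1
  obtain ⟨ζ, hζ⟩ : ∃ ζ, ζ = ‖g‖⁻¹ • g := ⟨_, rfl⟩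
  have hζn : ‖ζ‖ = 1 := by rw [hζ, norm_smul, norm_inv, norm_norm]; field_simp
  have hζK : ∀ x ∈ K, inner ℝ (x - y) ζ ≤ 0 := fun x hx => by
    rw [hζ, inner_smul_right, real_inner_comm]
    exact mul_nonpos_of_nonneg_of_nonpos (by positivity) (hgK x hx)
  refine ⟨ζ, mem_sphereCap.2 ⟨hζn, ?_⟩, hζK⟩
  have hpos : 0 < height y := hy.2
  have hsq := norm_sq_eq_foot ζ
  rw [hζn, one_pow] at hsq
  have hA := norm_nonneg (foot ζ)
  -- The supporting inequality is tested at points of the base of the cone below `y`. The value `t =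
  -- 0` gives a non-negative height of `ζ`, and the largest admissible `t` gives `cos θ * ‖foot ζ‖ ≤
  -- sin θ * height ζ`.
  have hv : ∀ t : ℝ, 0 ≤ t → Real.sin θ * (t * ‖foot ζ‖) ≤ Real.cos θ * height y →
      t * ‖foot ζ‖ ^ 2 ≤ height y * height ζ := by
    intro t ht htn
    have h1 := hζK _ (hK.cone_mem y hyK (t • foot ζ) (by simp) (by
      rwa [norm_smul, Real.norm_of_nonneg ht]))
    have e : foot y + t • foot ζ - y = t • foot ζ - height y • lastVec n := by
      rw [foot]; abel
    have e2 : inner ℝ (foot ζ) ζ = ‖foot ζ‖ ^ 2 := by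
      rw [← inner_foot_right_of_height_eq_zero ζ (height_foot ζ), real_inner_self_eq_norm_sq]
    rw [e, inner_sub_left, inner_smul_left, inner_smul_left, lastVec_inner, e2, conj_trivial,
      conj_trivial] at h1
    linarith
  have hsc := Real.sin_sq_add_cos_sq θ
  have hb : 0 ≤ height ζ := by
    have := hv 0 le_rfl (by rw [zero_mul, mul_zero]; positivity)
    rw [zero_mul] at this
    exact nonneg_of_mul_nonneg_right this hpos
  have hcA : Real.cos θ * ‖foot ζ‖ ≤ Real.sin θ * height ζ := by
    rcases hA.eq_or_lt with h0 | hApos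
    · rw [← h0, mul_zero]; positivity
    · have h1 := hv (Real.cos θ * height y / (Real.sin θ * ‖foot ζ‖)) (by positivity)
        (by apply le_of_eq; field_simp)
      have h2 : Real.cos θ * height y / (Real.sin θ * ‖foot ζ‖) * ‖foot ζ‖ ^ 2 =
          height y * (Real.cos θ * ‖foot ζ‖) / Real.sin θ := by field_simp
      rw [h2, div_le_iff₀ hs] at h1
      have h3 : height y * (Real.cos θ * ‖foot ζ‖) ≤ height y * (Real.sin θ * height ζ) := by
        linarith
      exact le_of_mul_le_mul_left h3 hpos
  have hsq2 : (Real.cos θ * ‖foot ζ‖) ^ 2 ≤ (Real.sin θ * height ζ) ^ 2 :=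
    pow_le_pow_left₀ (by positivity) hcA 2
  refine le_of_sq_le_sq ?_ hb
  rw [mul_pow, mul_pow] at hsq2
  nlinarith

/-- The distance to the surface is bounded from below by the support function. -/
theorem le_infDist_surface (hK : IsConeBody θ K) (hθ : θ ∈ Ioo 0 (Real.pi / 2))
    (hc : 0 < Real.cos θ) (hs : 0 < Real.sin θ) {z : Space n} {δ : ℝ}
    (hδ : ∀ ζ ∈ sphereCap n θ, δ ≤ support K z ζ) : δ ≤ Metric.infDist z (surface K) := by
  rw [surface, Metric.infDist_closure,
    Metric.le_infDist (hK.isThetaCapillary hθ).restricted.upperPart_nonempty]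
  intro y hy
  obtain ⟨ζ, hζ, hζK⟩ := hK.exists_normal_mem_sphereCap hc hs hy
  -- For an outward normal `ζ` at `y` the support value at `z` is at most `⟨y - z, ζ⟩`, hence at
  -- most the distance from `z` to `y`.
  refine (hδ ζ hζ).trans (support_le_of_forall hK.isCompact hK.nonempty fun x hx => ?_)
  have h1 := hζK x hx
  have h2 := real_inner_le_norm (y - z) ζ
  rw [(mem_sphereCap.1 hζ).1, mul_one, ← dist_eq_norm, dist_comm] at h2
  have h3 : inner ℝ (x - z) ζ = inner ℝ (x - y) ζ + inner ℝ (y - z) ζ := by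
    rw [← inner_add_left, sub_add_sub_cancel]
  linarith

/-- Near a body with the cone property, the maximum points of the entropy have uniformly positive
support functions on the spherical cap. -/
theorem exists_uniform_le_support (hL : IsConeBody θ L) (hc : 0 < Real.cos θ)
    (hs : 0 < Real.sin θ) : ∃ ε > 0, ∃ δ > 0, ∀ K : Set (Space n), IsConeBody θ K →
      HausdorffClose ε K L → ∀ z ∈ flatInterior K,
        logInt θ (support K z) = capillaryArea n θ * genEntropy θ K →
          ∀ ζ ∈ sphereCap n θ, δ ≤ support K z ζ := by
  obtain ⟨o, ho⟩ := hL.flatInterior_nonempty hc hs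
  obtain ⟨η, hη, δ, hδ, hT⟩ := hL.exists_le_support_of_almost_max hc hs
  obtain ⟨R, hR, hRL⟩ := abs_support_le hL.isCompact hL.nonempty o
  have hω := capillaryArea_pos (n := n) hc hs
  have hM := ellMass_nonneg (n := n) hc hs
  obtain ⟨τ, hτ, hτR, hτM⟩ : ∃ τ : ℝ, 0 < τ ∧ τ * R ≤ δ / 4 ∧ τ * ellMass n θ ≤ η / 2 := by
    refine ⟨min (δ / (4 * R)) (η / (2 * (ellMass n θ + 1))), lt_min (by positivity)
      (by positivity), ?_, ?_⟩
    · have h1 : min (δ / (4 * R)) (η / (2 * (ellMass n θ + 1))) ≤ δ / (4 * R) := min_le_left _ _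
      rw [le_div_iff₀ (by positivity)] at h1
      linarith
    · have h1 : min (δ / (4 * R)) (η / (2 * (ellMass n θ + 1))) ≤ η / (2 * (ellMass n θ + 1)) :=
        min_le_right _ _
      have h2 : 0 < min (δ / (4 * R)) (η / (2 * (ellMass n θ + 1))) :=
        lt_min (by positivity) (by positivity)
      rw [le_div_iff₀ (by positivity)] at h1
      linarith
  obtain ⟨ε₁, hε₁, h₁⟩ := hL.exists_comparison hc ho (a := 1 + τ) (by linarith)
  obtain ⟨ε₂, hε₂, h₂⟩ := hL.genEntropy_continuous hc hs
    (η := η / (2 * capillaryArea n θ)) (by positivity)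
  refine ⟨min ε₁ ε₂, lt_min hε₁ hε₂, δ / 2, by positivity, fun K hK hKL z hz hzF ζ hζ => ?_⟩
  have hcomp := h₁ K hK (hKL.mono (min_le_left _ _))
  have hent := abs_lt.1 (h₂ K hK (hKL.mono (min_le_right _ _)))
  have ha : 0 < 1 + τ := by linarith
  obtain ⟨hwflat, hwle⟩ := hK.logInt_support_le hL hc hs ho.1 ha (fun ζ hζ => (hcomp ζ hζ).1) hz
  -- The transported point is optimal for `L` up to `η`: one half is lost in the homothety and the
  -- other in the difference of the entropies.
  set w := o + (1 + τ)⁻¹ • (z - o) with hw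
  have hlog := Real.log_le_sub_one_of_pos ha
  have hlogM : Real.log (1 + τ) * ellMass n θ ≤ τ * ellMass n θ :=
    mul_le_mul_of_nonneg_right (by linarith) hM
  have hF : capillaryArea n θ * (-(η / (2 * capillaryArea n θ))) = -(η / 2) := by field_simp
  have hF2 : capillaryArea n θ * (-(η / (2 * capillaryArea n θ))) ≤
      capillaryArea n θ * (genEntropy θ K - genEntropy θ L) :=
    mul_le_mul_of_nonneg_left hent.1.le hω.le
  have hδw := hT w hwflat (by
    rw [hF, mul_sub] at hF2
    linarith) ζ hζ
  have hRo := (le_abs_self _).trans (hRL ζ (mem_sphereCap.1 hζ).1)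
  have hLo := hL.support_pos hc ho hζ
  have h3 := (hcomp ζ hζ).2
  have h4 : support L w ζ = support L o ζ - (1 + τ)⁻¹ * inner ℝ (z - o) ζ := by
    rw [support_eq_sub hL.isCompact hL.nonempty w o, hw, add_sub_cancel_left, inner_smul_left,
      conj_trivial]
  have h5 : support K z ζ = support K o ζ - inner ℝ (z - o) ζ :=
    support_eq_sub hK.isCompact hK.nonempty z o ζ
  have h6 : (1 + τ) * support L w ζ = (1 + τ) * support L o ζ - inner ℝ (z - o) ζ := by
    rw [h4, mul_sub]; field_simp
  have h7 : (1 - τ) * support L o ζ ≤ support K o ζ := by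
    have h8 : (1 - τ) * support L o ζ * (1 + τ) ≤ support K o ζ * (1 + τ) := by
      nlinarith [mul_pos hτ hτ, mul_nonneg (mul_pos hτ hτ).le hLo.le]
    exact le_of_mul_le_mul_right h8 ha
  have h9 : τ * support L o ζ ≤ τ * R := mul_le_mul_of_nonneg_left hRo hτ.le
  have h10 : (1 + τ) * δ ≤ (1 + τ) * support L w ζ := mul_le_mul_of_nonneg_left hδw ha.le
  -- The previous bounds combine to `support K z ζ ≥ (1 + τ) * support L w ζ - 2 * τ * support L o ζ
  -- ≥ δ - δ / 2`.
  nlinarith [mul_pos hτ hδ]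

end IsConeBody


/-! ### A priori bounds and compactness -/

theorem ae_norm_eq_one : ∀ᵐ ζ ∂sphereMeasure n, ‖ζ‖ = 1 := by
  rw [ae_iff]; exact sphereMeasure_norm_ne_one

/-- The logarithm of the distance to the equator is integrable on the sphere. -/
theorem integrable_log_abs_height :
    Integrable (fun ζ : Space n => Real.log |height ζ|) (sphereMeasure n) := by
  have hmeas : Measurable (fun ζ : Space n => Real.log |height ζ|) :=
    Real.measurable_log.comp (continuous_height.abs.measurable)
  have hnn : 0 ≤ᵐ[sphereMeasure n] fun ζ => -Real.log |height ζ| := by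
    filter_upwards [ae_norm_eq_one] with ζ hζ
    have h1 := abs_height_le ζ
    rw [hζ] at h1
    simpa using Real.log_nonpos (abs_nonneg _) h1
  suffices h : Integrable (fun ζ : Space n => -Real.log |height ζ|) (sphereMeasure n) by
    simpa using h.neg
  refine ⟨hmeas.neg.aestronglyMeasurable, ?_⟩
  rw [hasFiniteIntegral_iff_ofReal hnn, lintegral_eq_lintegral_meas_le _ hnn
    hmeas.neg.aemeasurable]
  -- Layer cake formula: the level `t` is exceeded only in the slab of half-width `exp (-t)`, whose
  -- measure decays exponentially.
  have hle : ∀ t ∈ Ioi (0 : ℝ), sphereMeasure n {ζ | t ≤ -Real.log |height ζ|} ≤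
      ENNReal.ofReal ((n + 1) * 2 ^ (n + 1) * Real.exp (-1 * t)) := by
    intro t _
    refine (measure_mono fun ζ hζ => ?_).trans (sphereMeasure_slab_le (Real.exp_pos (-1 * t)).le)
    simp only [mem_ofPred_eq] at hζ ⊢
    rcases (abs_nonneg (height ζ)).eq_or_lt with h0 | hpos
    · rw [← h0]; exact (Real.exp_pos _).le
    · rw [← Real.log_le_iff_le_exp hpos]; linarith
  refine lt_of_le_of_lt (setLIntegral_mono_ae' measurableSet_Ioi (ae_of_all _ hle)) ?_
  have hexp : IntegrableOn (fun t : ℝ => (n + 1) * 2 ^ (n + 1) * Real.exp (-1 * t)) (Ioi 0) :=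
    (exp_neg_integrableOn_Ioi 0 one_pos).const_mul _
  exact hexp.lintegral_lt_top

/-- A reflection carries the vertical axis to `e`. The independence from `e` makes the diameter
bound below uniform. -/
theorem integral_abs_log_abs_inner {e : Space n} (he : ‖e‖ = 1) :
    Integrable (fun ζ : Space n => Real.log |inner ℝ e ζ|) (sphereMeasure n) ∧
    ∫ ζ, |(Real.log |inner ℝ e ζ|)| ∂(sphereMeasure n) =
      ∫ ζ : Space n, |(Real.log |height ζ|)| ∂(sphereMeasure n) := by
  have hm : mirror (lastVec n - e) (lastVec n) = e :=
    Submodule.reflection_sub (by rw [norm_lastVec, he])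
  have hinner : ∀ ζ : Space n, inner ℝ e ζ = height (mirror (lastVec n - e) ζ) := fun ζ => by
    rw [← lastVec_inner, ← (mirror (lastVec n - e)).inner_map_map (lastVec n), mirror_mirror, hm]
  have hmp := measurePreserving_isometry (mirror (lastVec n - e))
  have hemb : MeasurableEmbedding (mirror (lastVec n - e)) :=
    (mirror (lastVec n - e)).toHomeomorph.measurableEmbedding
  simp only [hinner]
  exact ⟨hmp.integrable_comp_of_integrable integrable_log_abs_height,
    hmp.integral_comp hemb (fun ζ => |(Real.log |height ζ|)|)⟩

namespace IsConeBody

variable {K : Set (Space n)}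

/-- The foot of `y` serves as competitor: its support function is at least `cos θ * height y` on the
cap. An entropy bound thus bounds the height. -/
theorem log_mul_ellMass_le_of_foot (hK : IsConeBody θ K) (hc : 0 < Real.cos θ)
    (hs : 0 < Real.sin θ) {y : Space n} (hy : y ∈ K) (hpos : 0 < height y) :
    Real.log (Real.cos θ * height y) * ellMass n θ ≤ capillaryArea n θ * genEntropy θ K := by
  refine le_trans ?_ (hK.logInt_le hc hs (hK.foot_mem_flatInterior hc hs hy hpos))
  have hpos' : 0 < Real.cos θ * height y := mul_pos hc hpos
  rw [ellMass, ← integral_const_mul]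
  refine setIntegral_mono_on
    ((integrableOn_of_continuousOn continuous_sphereEll.continuousOn).const_mul _)
    (integrableOn_logInt hc hs (hK.continuousOn_support _)
      fun ζ hζ => hpos'.trans_le (hK.le_support_foot hy hζ)) measurableSet_sphereCap fun ζ hζ => ?_
  have hl := sphereEll_pos hc hs hζ
  have hl1 := sphereEll_le_one hc hζ
  have h1 := hK.le_support_foot hy hζ
  refine mul_le_mul_of_nonneg_right (Real.log_le_log hpos' (h1.trans ?_)) hl.le
  rw [le_div_iff₀ hl]
  nlinarith [hpos'.trans_le h1]

/-- The midpoint of the segment from 0 to `a` serves as competitor. The segment alone makes its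
support function at least `‖a‖ / 2 * |⟨e, ζ⟩|`, with `e` the direction of `a`, and the logarithm of
the last factor is integrable. This bounds the width of the flat part. -/
theorem log_mul_ellMass_le_of_flat (hK : IsConeBody θ K) (hc : 0 < Real.cos θ)
    (hs : 0 < Real.sin θ) (h0 : (0 : Space n) ∈ flatInterior K) {a : Space n} (ha : a ∈ K)
    (ha0 : height a = 0) (hne : a ≠ 0) :
    Real.log (‖a‖ / 2) * ellMass n θ - ∫ ζ : Space n, |(Real.log |height ζ|)| ∂(sphereMeasure n) ≤
      capillaryArea n θ * genEntropy θ K := by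
  have han : 0 < ‖a‖ := norm_pos_iff.2 hne
  obtain ⟨z, hz⟩ : ∃ z, z = (1 / 2 : ℝ) • a := ⟨_, rfl⟩
  have h0K := mem_of_mem_flatPart hK.isCompact (mem_flatPart_of_mem_flatInterior h0)
  have hsupp : ∀ ζ, support K z ζ = (support K 0 ζ + support K a ζ) / 2 := fun ζ => by
    rw [support_eq_sub hK.isCompact hK.nonempty z 0, support_eq_sub hK.isCompact hK.nonempty a 0,
      hz, sub_zero, sub_zero, inner_smul_left, conj_trivial]
    ring
  have hzpos : ∀ ζ ∈ sphereCap n θ, 0 < support K z ζ := fun ζ hζ => by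
    rw [hsupp]
    linarith [hK.support_pos hc h0 hζ, support_nonneg hK.isCompact ha ζ]
  have hzflat : z ∈ flatInterior K :=
    hK.mem_flatInterior_of_pos hc hs (by simp [hz, ha0]) hzpos
  refine le_trans ?_ (hK.logInt_le hc hs hzflat)
  obtain ⟨e, he⟩ : ∃ e, e = ‖a‖⁻¹ • a := ⟨_, rfl⟩
  have hen : ‖e‖ = 1 := by rw [he, norm_smul, norm_inv, norm_norm]; field_simp
  have hene : e ≠ 0 := norm_pos_iff.1 (by rw [hen]; exact one_pos)
  have hae : a = ‖a‖ • e := by rw [he, smul_smul, mul_inv_cancel₀ han.ne', one_smul]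
  obtain ⟨hint, hval⟩ := integral_abs_log_abs_inner hen
  have hbound : ∀ ζ, ‖a‖ / 2 * |inner ℝ e ζ| ≤ support K z ζ := fun ζ => by
    have h1 := inner_le_support hK.isCompact ha z ζ
    have h2 := inner_le_support hK.isCompact h0K z ζ
    have e1 : inner ℝ a ζ = ‖a‖ * inner ℝ e ζ := by
      conv_lhs => rw [hae]
      rw [inner_smul_left, conj_trivial]
    have e2 : inner ℝ z ζ = 1 / 2 * inner ℝ a ζ := by rw [hz, inner_smul_left, conj_trivial]
    rw [inner_sub_left, e2, e1] at h1
    rw [zero_sub, inner_neg_left, e2, e1] at h2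
    rcases abs_cases (inner ℝ e ζ) with ⟨h, _⟩ | ⟨h, _⟩ <;> rw [h] <;> linarith
  have hell : IntegrableOn (sphereEll θ) (sphereCap n θ) (sphereMeasure n) :=
    integrableOn_of_continuousOn continuous_sphereEll.continuousOn
  have hmain : ∫ ζ in sphereCap n θ, (Real.log (‖a‖ / 2) * sphereEll θ ζ -
      |(Real.log |inner ℝ e ζ|)|) ∂(sphereMeasure n) ≤ logInt θ (support K z) := by
    refine integral_mono_ae ((hell.const_mul _).sub hint.abs.integrableOn)
      (integrableOn_logInt hc hs (hK.continuousOn_support z) hzpos) ?_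
    rw [EventuallyLE, ae_restrict_iff' measurableSet_sphereCap]
    have h1 : ∀ᵐ ζ ∂sphereMeasure n, inner ℝ e ζ ≠ 0 := by
      rw [ae_iff]
      simpa using sphereMeasure_hyperplane hene
    filter_upwards [h1] with ζ hζ1 hζ
    have hl := sphereEll_pos hc hs hζ
    have hl1 := sphereEll_le_one hc hζ
    have hpos : 0 < |inner ℝ e ζ| := abs_pos.2 hζ1
    have h2 : Real.log (‖a‖ / 2) + Real.log |inner ℝ e ζ| ≤
        Real.log (support K z ζ / sphereEll θ ζ) := by
      rw [← Real.log_mul (by positivity) hpos.ne']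
      refine Real.log_le_log (by positivity) ((hbound ζ).trans ?_)
      rw [le_div_iff₀ hl]
      nlinarith [hzpos ζ hζ]
    have h3 := mul_le_mul_of_nonneg_right h2 hl.le
    have h4 : -|(Real.log |inner ℝ e ζ|)| ≤ Real.log |inner ℝ e ζ| * sphereEll θ ζ := by
      have h5 := neg_abs_le (Real.log |inner ℝ e ζ|)
      have h6 := abs_nonneg (Real.log |inner ℝ e ζ|)
      nlinarith
    rw [add_mul] at h3
    linarith
  refine le_trans ?_ hmain
  rw [integral_sub (hell.const_mul _) hint.abs.integrableOn, integral_const_mul, ← ellMass, ← hval]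
  have := setIntegral_le_integral (s := sphereCap n θ) hint.abs
    (ae_of_all _ fun ζ => abs_nonneg _)
  linarith

end IsConeBody

/-- Bodies with bounded entropy are uniformly bounded. -/
theorem exists_bound (n : ℕ) {θ : ℝ} (hc : 0 < Real.cos θ) (hs : 0 < Real.sin θ) (A : ℝ) :
    ∃ R : ℝ, ∀ K : Set (Space n), IsConeBody θ K → (0 : Space n) ∈ flatInterior K →
      genEntropy θ K ≤ A → K ⊆ Metric.closedBall 0 R := by
  have hω := capillaryArea_pos (n := n) hc hs
  have hM := ellMass_pos (n := n) hc hs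
  set C := ∫ ζ : Space n, |(Real.log |height ζ|)| ∂(sphereMeasure n) with hC
  set R₁ := 2 * Real.exp ((capillaryArea n θ * A + C) / ellMass n θ) with hR₁
  set R₂ := Real.exp (capillaryArea n θ * A / ellMass n θ) / Real.cos θ with hR₂
  have hR₁0 : 0 < R₁ := by positivity
  have hR₂0 : 0 < R₂ := by positivity
  refine ⟨R₁ + R₂, fun K hK h0 hA y hy => ?_⟩
  have hAω : capillaryArea n θ * genEntropy θ K ≤ capillaryArea n θ * A :=
    mul_le_mul_of_nonneg_left hA hω.le
  have hfoot : ‖foot y‖ ≤ R₁ := by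
    by_cases hne : foot y = 0
    · rw [hne, norm_zero]; exact hR₁0.le
    · have h1 := hK.log_mul_ellMass_le_of_flat hc hs h0 (hK.foot_mem hc hy) (height_foot y) hne
      have hpos : 0 < ‖foot y‖ / 2 := half_pos (norm_pos_iff.2 hne)
      have h2 : Real.log (‖foot y‖ / 2) ≤ (capillaryArea n θ * A + C) / ellMass n θ := by
        rw [le_div_iff₀ hM]; linarith
      rw [Real.log_le_iff_le_exp hpos] at h2
      rw [hR₁]; linarith
  have hheight : height y ≤ R₂ := by
    have hy0 : 0 ≤ height y := hK.subset_halfSpace hy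
    rcases hy0.eq_or_lt with h | hpos
    · rw [← h]; exact hR₂0.le
    · have h1 := hK.log_mul_ellMass_le_of_foot hc hs hy hpos
      have h2 : Real.log (Real.cos θ * height y) ≤ capillaryArea n θ * A / ellMass n θ := by
        rw [le_div_iff₀ hM]; linarith
      rw [Real.log_le_iff_le_exp (mul_pos hc hpos)] at h2
      rw [hR₂, le_div_iff₀ hc]; linarith
  rw [mem_closedBall_zero_iff]
  have hy0 : 0 ≤ height y := hK.subset_halfSpace hy
  calc ‖y‖ = ‖foot y + height y • lastVec n‖ := by rw [foot_add]
    _ ≤ ‖foot y‖ + ‖height y • lastVec n‖ := norm_add_le _ _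
    _ ≤ R₁ + R₂ := by
      rw [norm_smul, norm_lastVec, mul_one, Real.norm_of_nonneg hy0]
      exact add_le_add hfoot hheight

/-- In `Γ_A` the maximum points of the entropy have uniformly positive support functions on the
spherical cap. -/
theorem exists_uniform_le_support_Gam (n : ℕ) {θ : ℝ} (hc : 0 < Real.cos θ)
    (hs : 0 < Real.sin θ) (A : ℝ) : ∃ δ > 0, ∀ K ∈ Gam n θ A, ∀ z ∈ flatInterior K,
      logInt θ (support K z) = capillaryArea n θ * genEntropy θ K →
        ∀ ζ ∈ sphereCap n θ, δ ≤ support K z ζ := by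
  by_contra! hcon
  obtain ⟨R, hR⟩ := exists_bound n hc hs A
  have hseq : ∀ k : ℕ, ∃ K ∈ Gam n θ A, ∃ z ∈ flatInterior K,
      logInt θ (support K z) = capillaryArea n θ * genEntropy θ K ∧
      ∃ ζ ∈ sphereCap n θ, support K z ζ < 1 / ((k : ℝ) + 1) :=
    fun k => hcon _ Nat.one_div_pos_of_nat
  choose K hK z hz hzF ζ hζ hlt using hseq
  have hKc := fun k => isConeBody_of_mem_Gam hs (hK k)
  have hKR : ∀ k, K k ⊆ Metric.closedBall 0 R := fun k =>
    hR (K k) (hKc k) (hK k).2.1 (by rw [← (hK k).1.entropy_eq hc]; exact (hK k).2.2.2)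
  -- Blaschke selection: the uniform bound places all `K k` in one ball, and the common volume keeps
  -- the limit a body with the cone property.
  let N : ℕ → TopologicalSpace.NonemptyCompacts (Space n) := fun k =>
    ⟨⟨K k, (hKc k).isCompact⟩, (hKc k).nonempty⟩
  have hcomp := TopologicalSpace.NonemptyCompacts.isCompact_subsets_of_isCompact
    (isCompact_closedBall (0 : Space n) R)
  obtain ⟨L, -, φ, hφ, hlim⟩ := hcomp.tendsto_subseq (x := N) fun k => hKR k
  have hlim' : Tendsto (fun k => Metric.hausdorffEDist (K (φ k)) (L : Set (Space n))) atTop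
      (𝓝 0) := by
    exact tendsto_iff_edist_tendsto_0.1 hlim
  have hLc : IsConeBody θ (L : Set (Space n)) := isConeBody_of_limit hs (fun k => hKc (φ k))
    (volume_capBody_pos (n := n) (cos_lt_one_of_sin_pos hs) hc)
    (fun k => (hK (φ k)).2.2.1.ge) L.isCompact fun ε hε => hausdorffClose_of_tendsto hlim' hε
  obtain ⟨ε, hε, δ, hδ, h⟩ := hLc.exists_uniform_le_support hc hs
  have hone : Tendsto (fun k => 1 / ((φ k : ℝ) + 1)) atTop (𝓝 0) :=
    tendsto_one_div_add_atTop_nhds_zero_nat.comp hφ.tendsto_atTop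
  obtain ⟨k, hk1, hk2⟩ := ((hausdorffClose_of_tendsto hlim' hε).and
    (hone.eventually (gt_mem_nhds hδ))).exists
  have h1 := h _ (hKc (φ k)) hk1 _ (hz (φ k)) (hzF (φ k)) _ (hζ (φ k))
  linarith [hlt (φ k)]

end Capillary

end


/-! ### The theorem -/

open Capillary in
theorem theorem6 (n : ℕ) (hn : 1 ≤ n) (θ : ℝ) (hθ : θ ∈ Set.Ioo 0 (Real.pi / 2))
    (A : ℝ) (hA : 0 < A) :
    (∀ (K : ℕ → Set (Capillary.Space n)) (Kstar : Set (Capillary.Space n)),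
      (∀ k, K k ∈ Capillary.Gam n θ A) → IsCompact Kstar →
      Tendsto (fun k => Metric.hausdorffEDist (K k) Kstar) atTop (𝓝 0) →
        Capillary.IsThetaCapillary θ Kstar ∧
        Tendsto (fun k => Capillary.entropy θ (K k)) atTop
          (𝓝 (Capillary.genEntropy θ Kstar))) ∧
    ∃ δ : ℝ, 0 < δ ∧ ∀ K ∈ Capillary.Gam n θ A,
      ∃ z, Capillary.IsEntropyPoint θ K z ∧
        (∀ w, Capillary.IsEntropyPoint θ K w → w = z) ∧
        δ ≤ Metric.infDist z (Capillary.surface K) := by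
  have hc : 0 < Real.cos θ := Real.cos_pos_of_mem_Ioo ⟨by linarith [hθ.1, Real.pi_pos], hθ.2⟩
  have hs : 0 < Real.sin θ := Real.sin_pos_of_pos_of_lt_pi hθ.1 (by linarith [hθ.2, Real.pi_pos])
  have hω := capillaryArea_pos (n := n) hc hs
  refine ⟨fun K L hK hL h => limit_of_Gam hθ hc hs hK hL h, ?_⟩
  obtain ⟨δ, hδ, hδK⟩ := exists_uniform_le_support_Gam n hc hs A
  refine ⟨δ, hδ, fun K hK => ?_⟩
  have hKc := isConeBody_of_mem_Gam hs hK
  have hEnt : ∀ w, IsEntropyPoint θ K w ↔ w ∈ flatPart K ∧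
      IntegrableOn (genIntegrand θ K w) (sphereCap n θ) (sphereMeasure n) ∧
      logInt θ (support K w) = capillaryArea n θ * genEntropy θ K := fun w => by
    rw [IsEntropyPoint, integrableOn_entropyIntegrand_iff hc hKc.isCompact hKc.convex
      hKc.interior_nonempty hKc.subset_halfSpace, hK.1.entropy_eq hc,
      entropyAt_eq hc hKc.isCompact hKc.convex hKc.interior_nonempty hKc.subset_halfSpace,
      genEntropyAt_eq, one_div, eq_inv_mul_iff_mul_eq₀ hω.ne', eq_comm (b := logInt θ _)]
  obtain ⟨z, hz, hzF⟩ := hKc.exists_max hc hs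
  refine ⟨z, (hEnt z).2 ⟨mem_flatPart_of_mem_flatInterior hz, integrableOn_logInt hc hs
    (hKc.continuousOn_support z) fun ζ hζ => hKc.support_pos hc hz hζ, hzF⟩, fun w hw => ?_,
    hKc.le_infDist_surface hθ hc hs (hδK K hK z hz hzF)⟩
  obtain ⟨hwflat, hwint, hwF⟩ := (hEnt w).1 hw
  have hwK := mem_of_mem_flatPart hKc.isCompact hwflat
  -- For a relative interior point there are no zeros and any `γ` will do. At a relative boundary
  -- point the smoothness of `Σ` leaves at most one.
  obtain ⟨γ, hγ⟩ : ∃ γ : Space n, ∀ ζ ∈ sphereCap n θ, support K w ζ ≤ 0 → ζ = γ := by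
    by_cases hwi : w ∈ flatInterior K
    · exact ⟨0, fun ζ hζ hle => absurd hle (not_le.2 (hKc.support_pos hc hwi hζ))⟩
    · exact hK.1.subsingleton_support_nonpos hwK hwflat.2 hwi
  exact IsConeBody.eq_of_isMax hn hKc hc hs hz hzF hwK hwflat.2 hwint hwF hγ
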